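/- **Conventions.** A semi-algebraic set $X\subset\mathbb P^n(\mathbb R)$ is *arc-symmetric* if for every real analytic arc $\gamma:\,]-1,1[\to\mathbb P^n(\mathbb R)$ with $\gamma(]-1,0[)\subset X$ there is $\epsilon>0$ with $\gamma(]0,\epsilon[)\subset X$. A nonempty arc-symmetric set is *irreducible* if it is not the union of two proper closed arc-symmetric subsets; the irreducible components of an arc-symmetric set are its maximal irreducible closed arc-symmetric subsets. An irreducible arc-symmetric set is *nonsingular* if it does not meet the singular locus of its Zariski closure; an arc-symmetric set is *nonsingular* if it is a finite disjoint union of nonsingular irreducible arc-symmetric sets that are closed in it. Let $G=\mathbb Z/2\mathbb Z$. A *$G$-action* on an arc-symmetric set $X$ is given by a regular involution $\sigma$ (possibly the identity) of the Zariski closure $\overline X^Z$ with $\sigma(X)\subset X$ (regular: locally given by homogeneous polynomials of the same degree without common real zero). A *quotient* of $\overline X^Z$ by $G$ is a regular map $p:\overline X^Z\to\mathbb P^m(\mathbb R)$ whose fibres are the orbits of $\sigma$ and such that every $\sigma$-invariant regular function on $\overline X^Z$ is of the form $g\circ p$ with $g$ a regular function on $p(\overline X^Z)$; this realizes $\overline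 X^Z/G$ inside the real points of the algebraic quotient variety, and the quotient space $X/G$ is the semi-algebraic set $p(X)$. **Proposition 4.3.** Let $X\subset\mathbb P^n(\mathbb R)$ be a nonsingular arc-symmetric set endowed with a $G$-action, $G=\mathbb Z/2\mathbb Z$. Let $\widetilde X\subset\mathbb P^n(\mathbb R)$ be a nonsingular equivariant compactification of $X$, that is, a compact nonsingular arc-symmetric set with a $G$-action that contains $X$ as a dense subset and whose action restricts to that of $X$, and assume that $\widetilde X\setminus X$ is compact. Then a quotient $p$ of $\overline X^Z$ by $G$ exists, and for every such quotient the set $X/G=p(X)$ is arc-symmetric if and only if the action of $G$ on $\widetilde X$ is trivial on each irreducible component of $\widetilde X$ containing a fixed point. (The case $X=\widetilde X$ is that of a compact nonsingular arc-symmetric set.) -/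

import Mathlib

open scoped LinearAlgebra.Projectivization Topology

namespace ArcSym

/-- Real projective space `ℙⁿ(ℝ)`. -/
abbrev RP (n : ℕ) : Type := ℙ ℝ (Fin (n + 1) → ℝ)

/-- The Euclidean (quotient) topology of `ℙⁿ(ℝ)`. -/
noncomputable instance instTopologicalSpaceRP (n : ℕ) : TopologicalSpace (RP n) :=
  TopologicalSpace.coinduced (Projectivization.mk' ℝ) inferInstance

/-- The cone in `ℝⁿ⁺¹ ∖ {0}` over a subset of `ℙⁿ(ℝ)`. -/
def cone {n : ℕ} (X : Set (RP n)) : Set (Fin (n + 1) → ℝ) :=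
  {v | ∃ h : v ≠ 0, Projectivization.mk ℝ v h ∈ X}

/-- Semi-algebraic subsets of `ℝᴺ`: the smallest Boolean algebra of subsets that contains all sets
`{f > 0}` with `f` a polynomial. -/
inductive IsSemialgebraic {N : ℕ} : Set (Fin N → ℝ) → Prop
  | pos (f : MvPolynomial (Fin N) ℝ) : IsSemialgebraic {v | 0 < MvPolynomial.eval v f}
  | compl (A : Set (Fin N → ℝ)) : IsSemialgebraic A → IsSemialgebraic Aᶜ
  | inter (A B : Set (Fin N → ℝ)) :
      IsSemialgebraic A → IsSemialgebraic B → IsSemialgebraic (A ∩ B)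

/-- `γ : ]-1,1[ → ℙⁿ(ℝ)` is a real analytic arc (the values of `γ` outside `]-1,1[` are
irrelevant): locally it has real analytic homogeneous coordinates. -/
def IsAnalyticArc {n : ℕ} (γ : ℝ → RP n) : Prop :=
  ∀ t₀ ∈ Set.Ioo (-1 : ℝ) 1, ∃ g : ℝ → (Fin (n + 1) → ℝ), AnalyticAt ℝ g t₀ ∧
    ∀ᶠ t in 𝓝 t₀, ∃ h : g t ≠ 0, γ t = Projectivization.mk ℝ (g t) h

/-- Arc-symmetric subsets of `ℙⁿ(ℝ)`. -/
structure IsArcSymmetric {n : ℕ} (X : Set (RP n)) : Prop where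
  semialgebraic : IsSemialgebraic (cone X)
  arc : ∀ γ : ℝ → RP n, IsAnalyticArc γ → (∀ t ∈ Set.Ioo (-1 : ℝ) 0, γ t ∈ X) →
    ∃ ε > 0, ∀ t ∈ Set.Ioo (0 : ℝ) ε, γ t ∈ X

/-- `Y` is a closed arc-symmetric subset of `X` (closed for the Euclidean topology of `X`). -/
def IsClosedArcSymmetricIn {n : ℕ} (Y X : Set (RP n)) : Prop :=
  IsArcSymmetric Y ∧ ∃ K : Set (RP n), IsClosed K ∧ Y = X ∩ K

/-- Irreducible arc-symmetric sets: non-empty, and not the union of two proper closed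
arc-symmetric subsets. -/
structure IsIrreducibleArcSymmetric {n : ℕ} (X : Set (RP n)) : Prop where
  arcSymmetric : IsArcSymmetric X
  nonempty : X.Nonempty
  irreducible : ∀ Y Z : Set (RP n), IsClosedArcSymmetricIn Y X → IsClosedArcSymmetricIn Z X →
    X = Y ∪ Z → Y = X ∨ Z = X

/-- The irreducible components of an arc-symmetric set: its maximal irreducible closed
arc-symmetric subsets. -/
def IsIrreducibleComponent {n : ℕ} (C X : Set (RP n)) : Prop :=
  Maximal (fun Y => IsIrreducibleArcSymmetric Y ∧ IsClosedArcSymmetricIn Y X) C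

/-- The ideal of the polynomials that vanish on (the cone over) `X`. -/
noncomputable def idealOf {n : ℕ} (X : Set (RP n)) : Ideal (MvPolynomial (Fin (n + 1)) ℝ) :=
  MvPolynomial.vanishingIdeal ℝ (cone X)

/-- The Zariski closure of `X` in `ℙⁿ(ℝ)`. -/
def zariskiClosure {n : ℕ} (X : Set (RP n)) : Set (RP n) :=
  {x | ∀ F ∈ idealOf X, MvPolynomial.eval x.rep F = 0}

/-- The rank at `x` of the Jacobian matrix of (generators of) the ideal of `V`. -/
noncomputable def jacobianRank {n : ℕ} (V : Set (RP n)) (x : RP n) : ℕ :=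
  Module.finrank ℝ (Submodule.span ℝ
    {w : Fin (n + 1) → ℝ | ∃ F ∈ idealOf V,
      w = fun i => MvPolynomial.eval x.rep (MvPolynomial.pderiv i F)})

/-- The singular locus of an irreducible real algebraic set `V ⊆ ℙⁿ(ℝ)`: the points where the
Jacobian matrix does not have the largest rank that it attains on `V` (this rank is the
codimension of `V`). -/
def singularLocus {n : ℕ} (V : Set (RP n)) : Set (RP n) :=
  {x | x ∈ V ∧ ∃ y ∈ V, jacobianRank V x < jacobianRank V y}

/-- An irreducible arc-symmetric set is nonsingular if it does not meet the singular locus of its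
Zariski closure (which is irreducible). -/
def IsNonsingularIrreducible {n : ℕ} (X : Set (RP n)) : Prop :=
  IsIrreducibleArcSymmetric X ∧ Disjoint X (singularLocus (zariskiClosure X))

/-- An arc-symmetric set is nonsingular if it is a finite disjoint union of nonsingular
irreducible arc-symmetric sets that are closed in it (these are then its irreducible
components). -/
def IsNonsingular {n : ℕ} (X : Set (RP n)) : Prop :=
  IsArcSymmetric X ∧ ∃ S : Set (Set (RP n)), S.Finite ∧ S.PairwiseDisjoint id ∧ ⋃₀ S = X ∧
    ∀ C ∈ S, IsNonsingularIrreducible C ∧ IsClosedArcSymmetricIn C X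

/-- `f : ℙⁿ(ℝ) → ℙᵐ(ℝ)` is a regular map on `V`: around every point of `V` it is given by
homogeneous polynomials of the same degree without common zero there. -/
def IsRegularMapOn {n m : ℕ} (V : Set (RP n)) (f : RP n → RP m) : Prop :=
  ∀ x ∈ V, ∃ (d : ℕ) (F : Fin (m + 1) → MvPolynomial (Fin (n + 1)) ℝ),
    (∀ i, (F i).IsHomogeneous d) ∧ (fun i => MvPolynomial.eval x.rep (F i)) ≠ 0 ∧
    ∀ y ∈ V, ∀ h : (fun i => MvPolynomial.eval y.rep (F i)) ≠ 0,
      f y = Projectivization.mk ℝ (fun i => MvPolynomial.eval y.rep (F i)) h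

/-- `f : ℙⁿ(ℝ) → ℝ` is a regular function on `V`: around every point of `V` it is a quotient of
two homogeneous polynomials of the same degree whose denominator does not vanish there. -/
def IsRegularFunctionOn {n : ℕ} (V : Set (RP n)) (f : RP n → ℝ) : Prop :=
  ∀ x ∈ V, ∃ (d : ℕ) (P Q : MvPolynomial (Fin (n + 1)) ℝ),
    P.IsHomogeneous d ∧ Q.IsHomogeneous d ∧ MvPolynomial.eval x.rep Q ≠ 0 ∧
    ∀ y ∈ V, MvPolynomial.eval y.rep Q ≠ 0 →
      f y = MvPolynomial.eval y.rep P / MvPolynomial.eval y.rep Q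

/-- `σ` defines an (algebraic) action of `ℤ/2ℤ` on `X`: it is an algebraic involution of the
Zariski closure of `X` that maps `X` to itself. Only the values of `σ` on the Zariski closure
matter. The identity is allowed. -/
structure IsAlgebraicInvolution {n : ℕ} (X : Set (RP n)) (σ : RP n → RP n) : Prop where
  regular : IsRegularMapOn (zariskiClosure X) σ
  mapsTo_closure : Set.MapsTo σ (zariskiClosure X) (zariskiClosure X)
  involutive : ∀ x ∈ zariskiClosure X, σ (σ x) = x
  mapsTo : Set.MapsTo σ X X

/-- `p : V → ℙᵐ(ℝ)` is the quotient of the real algebraic set `V` by the involution `σ`: it is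
regular, its fibres on `V` are the orbits, and the `σ`-invariant regular functions on `V` are
exactly the regular functions of `p`. The image `p '' V` is then the semi-algebraic set `V/G`
inside the real points of the algebraic quotient variety, in some projective embedding of it. -/
structure IsQuotientMap {n m : ℕ} (V : Set (RP n)) (σ : RP n → RP n) (p : RP n → RP m) :
    Prop where
  regular : IsRegularMapOn V p
  fibres : ∀ x ∈ V, ∀ y ∈ V, p x = p y ↔ y = x ∨ y = σ x
  invariants : ∀ f : RP n → ℝ, IsRegularFunctionOn V f → (∀ x ∈ V, f (σ x) = f x) →
    ∃ g : RP m → ℝ, IsRegularFunctionOn (p '' V) g ∧ ∀ x ∈ V, f x = g (p x)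

end ArcSym

namespace ArcSym

open MvPolynomial Filter

/-! A point of projective space is encoded by the matrix `emb` of the orthogonal projection onto its
line. Maps become families of real functions, and equality of points becomes a set of polynomial
identities. Under the involution `σ` each matrix entry `e` splits into the even function `e + e ∘ σ`
and the odd function `e - e ∘ σ`. The even functions together with the products of two odd ones
separate the orbits. An invariant regular function `A / B` with `B > 0` equals `(A + A ∘ σ) / (B + B
∘ σ)`, which is a quotient of polynomials in these invariants. Hence a quotient exists
(`exists_isQuotientMap`).

For an arbitrary quotient `p` the same invariants are rational functions on the image, so preimages
are given by formulas: at a fixed point the even functions suffice, and elsewhere a nonzero odd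
function is, up to sign, the square root of its square and determines the other odd functions. This
makes `p '' X` semi-algebraic (`IsQuotientMap.isSemialgebraic_image`). If `σ` is trivial near each
of its fixed points in the compactification, it also lifts analytic arcs through `p`: near a fixed
point no root is needed, and elsewhere the radicand is positive. The lifted arc crosses `0` inside
`X` because `X` is arc-symmetric (`IsQuotientMap.isArcSymmetric_image`).

Conversely, let a component `C` contain a fixed point. There is a chart of `C` around it in which
`σ` changes the signs of some coordinates, which are odd functions (`exists_equivariant_chart`). If
there are no such coordinates, `σ` is trivial near the point, and analytic continuation makes it
trivial on `C` (`IsNonsingularIrreducible.forall_fixed`). Otherwise an arc `γ` with `σ (γ t) = γ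
(-t)` is folded by `p`: `p (γ t)` is an analytic function `h` of `t ^ 2`. The arc `h (-s)` lies in
the image for `s < 0`, but for `s > 0` the square of an odd function would be negative on it
(`IsQuotientMap.not_germClosed_of_arc`).

Two geometric facts support this. Charts at nonsingular points come from the rank condition through
a Gronwall estimate for the generators of the ideal (`exists_regular_system`). Local properties
spread over `C` because a clopen subset of a compact arc-symmetric set is arc-symmetric, so
irreducibility forbids proper ones (`IsNonsingularIrreducible.eventually_mem_of_interior`). -/

/-! ### Projective space -/

/-- The squared Euclidean norm. -/
def nsq {k : ℕ} (v : Fin k → ℝ) : ℝ := ∑ i, v i ^ 2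

theorem nsq_pos {k : ℕ} {v : Fin k → ℝ} (h : v ≠ 0) : 0 < nsq v := by
  obtain ⟨i, hi⟩ := Function.ne_iff.1 h
  exact Finset.sum_pos' (fun j _ => sq_nonneg _) ⟨i, Finset.mem_univ _, by
    have : v i ≠ 0 := hi
    positivity⟩

theorem nsq_smul {k : ℕ} (c : ℝ) (v : Fin k → ℝ) : nsq (c • v) = c ^ 2 * nsq v := by
  simp [nsq, mul_pow, Finset.mul_sum]

/-- The embedding of `ℙⁿ(ℝ)` into the space of matrices that maps a line to the orthogonal
projection onto it. -/
noncomputable def emb {n : ℕ} (x : RP n) (i j : Fin (n + 1)) : ℝ :=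
  x.rep i * x.rep j / nsq x.rep

theorem exists_mk_rep_eq_smul {n : ℕ} (v : Fin (n + 1) → ℝ) (h : v ≠ 0) :
    ∃ c : ℝ, c ≠ 0 ∧ (Projectivization.mk ℝ v h).rep = c • v := by
  obtain ⟨a, ha⟩ := Projectivization.exists_smul_eq_mk_rep ℝ v h
  exact ⟨a, a.ne_zero, ha.symm⟩

theorem emb_mk {n : ℕ} (v : Fin (n + 1) → ℝ) (h : v ≠ 0) (i j : Fin (n + 1)) :
    emb (Projectivization.mk ℝ v h) i j = v i * v j / nsq v := by
  obtain ⟨c, hc, hr⟩ := exists_mk_rep_eq_smul v h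
  have := (nsq_pos h).ne'
  simp only [emb, hr, nsq_smul, Pi.smul_apply, smul_eq_mul]
  field_simp

theorem mk_smul {n : ℕ} (v : Fin (n + 1) → ℝ) (h : v ≠ 0) {c : ℝ} (hc : c ≠ 0) :
    Projectivization.mk ℝ (c • v) (smul_ne_zero hc h) = Projectivization.mk ℝ v h :=
  (Projectivization.mk_eq_mk_iff' ℝ _ _ _ _).2 ⟨c, rfl⟩

theorem minors_of_mk_eq_mk {n : ℕ} {v w : Fin (n + 1) → ℝ} (hv : v ≠ 0) (hw : w ≠ 0)
    (h : Projectivization.mk ℝ v hv = Projectivization.mk ℝ w hw) (i j : Fin (n + 1)) :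
    v i * w j = v j * w i := by
  obtain ⟨c, rfl⟩ := (Projectivization.mk_eq_mk_iff' ℝ _ _ _ _).1 h
  simp only [Pi.smul_apply, smul_eq_mul]
  ring

/-- The point of `ℙⁿ(ℝ)` is given by any nonzero row of its projection matrix. -/
theorem emb_row {n : ℕ} (x : RP n) (i : Fin (n + 1)) :
    emb x i = (x.rep i / nsq x.rep) • x.rep := by
  ext j
  simp only [emb, Pi.smul_apply, smul_eq_mul]
  ring

theorem emb_row_ne_zero {n : ℕ} {x : RP n} {i : Fin (n + 1)} (h : emb x i i ≠ 0) : emb x i ≠ 0 :=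
  fun h0 => h (by rw [h0]; rfl)

theorem mk_emb_row {n : ℕ} {x : RP n} {i : Fin (n + 1)} (h : emb x i ≠ 0) :
    Projectivization.mk ℝ (emb x i) h = x := by
  conv_rhs => rw [← Projectivization.mk_rep x]
  exact (Projectivization.mk_eq_mk_iff' ℝ _ _ _ _).2 ⟨_, (emb_row x i).symm⟩

theorem exists_emb_pos {n : ℕ} (x : RP n) : ∃ i, 0 < emb x i i := by
  obtain ⟨i, hi⟩ := Function.ne_iff.1 x.rep_nonzero
  have hi : x.rep i ≠ 0 := hi
  have := nsq_pos x.rep_nonzero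
  refine ⟨i, ?_⟩
  unfold emb
  rw [← sq]
  positivity

theorem emb_injective {n : ℕ} : Function.Injective (emb (n := n)) := by
  intro x y h
  obtain ⟨i, hi⟩ := exists_emb_pos x
  have hx := emb_row_ne_zero hi.ne'
  rw [← mk_emb_row hx]
  have hy : emb y i ≠ 0 := h ▸ hx
  rw [← mk_emb_row hy]
  congr 1
  rw [h]

theorem continuous_mk' {n : ℕ} :
    Continuous (Projectivization.mk' ℝ : {v : Fin (n + 1) → ℝ // v ≠ 0} → RP n) :=
  continuous_coinduced_rng

theorem continuous_nsq {k : ℕ} : Continuous (nsq (k := k)) := by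
  unfold nsq; fun_prop

theorem continuous_emb {n : ℕ} : Continuous (emb (n := n)) := by
  refine continuous_coinduced_dom.2 ?_
  refine continuous_pi fun i => continuous_pi fun j => ?_
  have : (fun v : {v : Fin (n + 1) → ℝ // v ≠ 0} => v.1 i * v.1 j / nsq v.1) =
      fun v => (emb ∘ Projectivization.mk' ℝ) v i j := by
    ext v
    exact (emb_mk v.1 v.2 i j).symm
  rw [← this]
  have h2 : Continuous fun v : {v : Fin (n + 1) → ℝ // v ≠ 0} => nsq v.1 :=
    continuous_nsq.comp continuous_subtype_val
  exact Continuous.div (((continuous_apply i).comp continuous_subtype_val).mul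
    ((continuous_apply j).comp continuous_subtype_val)) h2 fun v => (nsq_pos v.2).ne'

instance instT2SpaceRP (n : ℕ) : T2Space (RP n) :=
  T2Space.of_injective_continuous emb_injective continuous_emb

instance instCompactSpaceRP (n : ℕ) : CompactSpace (RP n) := by
  let f : Metric.sphere (0 : Fin (n + 1) → ℝ) 1 → RP n := fun v =>
    Projectivization.mk' ℝ ⟨v.1, fun h => by simpa [h] using v.2⟩
  have hf : Continuous f := continuous_mk'.comp (by fun_prop)
  have hs : Function.Surjective f := by
    intro x
    have h0 : ‖x.rep‖ ≠ 0 := norm_ne_zero_iff.2 x.rep_nonzero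
    refine ⟨⟨‖x.rep‖⁻¹ • x.rep, by simp [norm_smul, h0]⟩, ?_⟩
    conv_rhs => rw [← Projectivization.mk_rep x]
    exact mk_smul x.rep x.rep_nonzero (inv_ne_zero h0)
  exact ⟨by rw [← hs.range_eq]; exact isCompact_range hf⟩

theorem isOpenMap_mk' {n : ℕ} :
    IsOpenMap (Projectivization.mk' ℝ : {v : Fin (n + 1) → ℝ // v ≠ 0} → RP n) := by
  intro U hU
  rw [isOpen_coinduced]
  have : (Projectivization.mk' ℝ : {v : Fin (n + 1) → ℝ // v ≠ 0} → RP n) ⁻¹'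
      (Projectivization.mk' ℝ '' U) =
      ⋃ c : ℝˣ, (fun v : {v : Fin (n + 1) → ℝ // v ≠ 0} =>
        (⟨(c : ℝ) • v.1, smul_ne_zero c.ne_zero v.2⟩ : {v : Fin (n + 1) → ℝ // v ≠ 0})) ⁻¹' U := by
    ext v
    simp only [Set.mem_preimage, Set.mem_image, Set.mem_iUnion]
    constructor
    · rintro ⟨w, hw, h⟩
      obtain ⟨c, hc⟩ := (Projectivization.mk_eq_mk_iff ℝ w.1 v.1 w.2 v.2).1 h
      refine ⟨c, ?_⟩
      convert! hw
    · rintro ⟨c, hc⟩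
      exact ⟨_, hc, mk_smul v.1 v.2 c.ne_zero⟩
  rw [this]
  refine isOpen_iUnion fun c => hU.preimage ?_
  fun_prop

/-- The projection from nonzero vectors is open and continuous, so it pushes neighbourhood filters
forward. Local statements on projective space are checked on homogeneous coordinates through this
equivalence. -/
theorem eventually_nhds_mk {n : ℕ} {v : Fin (n + 1) → ℝ} (h : v ≠ 0) {P : RP n → Prop} :
    (∀ᶠ y in 𝓝 (Projectivization.mk ℝ v h), P y) ↔
      ∀ᶠ w in 𝓝 v, ∀ hw : w ≠ 0, P (Projectivization.mk ℝ w hw) := by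
  have h1 : 𝓝 (Projectivization.mk ℝ v h) =
      Filter.map (Projectivization.mk' ℝ) (𝓝 (⟨v, h⟩ : {v : Fin (n + 1) → ℝ // v ≠ 0})) :=
    (isOpenMap_mk'.map_nhds_eq continuous_mk'.continuousAt).symm
  have h2 : IsOpen {v : Fin (n + 1) → ℝ | v ≠ 0} := isOpen_ne
  rw [h1, Filter.eventually_map]
  have h3 : 𝓝 v = Filter.map Subtype.val (𝓝 (⟨v, h⟩ : {v : Fin (n + 1) → ℝ // v ≠ 0})) :=
    (h2.isOpenEmbedding_subtypeVal.map_nhds_eq ⟨v, h⟩).symm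
  rw [h3, Filter.eventually_map]
  refine Filter.eventually_congr (Filter.Eventually.of_forall fun w => ?_)
  exact ⟨fun hP _ => hP, fun hP => hP w.2⟩

/-! ### Cones and Zariski closures -/

theorem mk_mem_of_mem_cone {n : ℕ} {X : Set (RP n)} {v : Fin (n + 1) → ℝ} (h : v ∈ cone X)
    (hv : v ≠ 0) : Projectivization.mk ℝ v hv ∈ X := h.2

theorem ne_zero_of_mem_cone {n : ℕ} {X : Set (RP n)} {v : Fin (n + 1) → ℝ} (h : v ∈ cone X) :
    v ≠ 0 := h.1

theorem mem_cone_iff {n : ℕ} {X : Set (RP n)} {v : Fin (n + 1) → ℝ} (hv : v ≠ 0) :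
    v ∈ cone X ↔ Projectivization.mk ℝ v hv ∈ X :=
  ⟨fun h => h.2, fun h => ⟨hv, h⟩⟩

theorem rep_mem_cone {n : ℕ} {X : Set (RP n)} {x : RP n} : x.rep ∈ cone X ↔ x ∈ X := by
  rw [mem_cone_iff x.rep_nonzero, Projectivization.mk_rep]

theorem smul_mem_cone {n : ℕ} {X : Set (RP n)} {v : Fin (n + 1) → ℝ} (h : v ∈ cone X) {c : ℝ}
    (hc : c ≠ 0) : c • v ∈ cone X :=
  ⟨smul_ne_zero hc h.1, by rw [mk_smul v h.1 hc]; exact h.2⟩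

theorem cone_mono {n : ℕ} {X Y : Set (RP n)} (h : X ⊆ Y) : cone X ⊆ cone Y :=
  fun _ hv => ⟨hv.1, h hv.2⟩

theorem mem_idealOf {n : ℕ} {X : Set (RP n)} {F : MvPolynomial (Fin (n + 1)) ℝ} :
    F ∈ idealOf X ↔ ∀ v ∈ cone X, eval v F = 0 := Iff.rfl

/-- The polynomial `F(c x)`. -/
noncomputable def dilate {k : ℕ} (c : ℝ) (F : MvPolynomial (Fin k) ℝ) : MvPolynomial (Fin k) ℝ :=
  bind₁ (fun i => C c * X i) F

theorem eval_dilate {k : ℕ} (c : ℝ) (F : MvPolynomial (Fin k) ℝ) (v : Fin k → ℝ) :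
    eval v (dilate c F) = eval (c • v) F := by
  rw [dilate, ← MvPolynomial.coe_aeval_eq_eval, RingHom.coe_coe, MvPolynomial.aeval_bind₁,
    ← MvPolynomial.coe_aeval_eq_eval, RingHom.coe_coe]
  congr 2
  ext i
  simp

/-- Elements of the ideal need not be homogeneous. Stability under dilation is what makes the
conditions stated at the representative `x.rep` independent of that choice. -/
theorem dilate_mem_idealOf {n : ℕ} {X : Set (RP n)} {F : MvPolynomial (Fin (n + 1)) ℝ}
    (hF : F ∈ idealOf X) {c : ℝ} (hc : c ≠ 0) : dilate c F ∈ idealOf X := by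
  intro v hv
  have := eval_dilate c F v
  rw [MvPolynomial.aeval_eq_eval, this]
  exact mem_idealOf.1 hF _ (smul_mem_cone hv hc)

theorem mem_cone_zariskiClosure {n : ℕ} {X : Set (RP n)} {v : Fin (n + 1) → ℝ} (hv : v ≠ 0) :
    v ∈ cone (zariskiClosure X) ↔ ∀ F ∈ idealOf X, eval v F = 0 := by
  rw [mem_cone_iff hv]
  obtain ⟨c, hc, hr⟩ := exists_mk_rep_eq_smul v hv
  constructor
  · intro h F hF
    have := h _ (dilate_mem_idealOf hF (inv_ne_zero hc))
    rwa [eval_dilate, hr, smul_smul, inv_mul_cancel₀ hc, one_smul] at this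
  · intro h F hF
    rw [hr, ← eval_dilate]
    exact h _ (dilate_mem_idealOf hF hc)

theorem subset_zariskiClosure {n : ℕ} (X : Set (RP n)) : X ⊆ zariskiClosure X := by
  intro x hx F hF
  exact mem_idealOf.1 hF _ (rep_mem_cone.2 hx)

theorem idealOf_anti {n : ℕ} {X Y : Set (RP n)} (h : X ⊆ Y) : idealOf Y ≤ idealOf X :=
  fun _ hF v hv => hF v (cone_mono h hv)

theorem zariskiClosure_mono {n : ℕ} {X Y : Set (RP n)} (h : X ⊆ Y) :
    zariskiClosure X ⊆ zariskiClosure Y :=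
  fun _ hx F hF => hx F (idealOf_anti h hF)

theorem idealOf_zariskiClosure {n : ℕ} (X : Set (RP n)) : idealOf (zariskiClosure X) = idealOf X :=
  le_antisymm (idealOf_anti (subset_zariskiClosure X)) fun F hF v hv => by
    rw [MvPolynomial.aeval_eq_eval]
    exact (mem_cone_zariskiClosure hv.1).1 hv F hF

theorem zariskiClosure_idem {n : ℕ} (X : Set (RP n)) :
    zariskiClosure (zariskiClosure X) = zariskiClosure X := by
  unfold zariskiClosure
  exact congrArg (fun I : Ideal _ => {x : RP n | ∀ F ∈ I, eval x.rep F = 0})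
    (idealOf_zariskiClosure X)

theorem isClosed_of_cone {n : ℕ} {X : Set (RP n)}
    (h : ∀ v : Fin (n + 1) → ℝ, v ≠ 0 → v ∉ cone X → ∀ᶠ w in 𝓝 v, w ∉ cone X) : IsClosed X := by
  rw [← isOpen_compl_iff, isOpen_iff_mem_nhds]
  intro x hx
  have hx' : x.rep ∉ cone X := fun h => hx (rep_mem_cone.1 h)
  have : ∀ᶠ y in 𝓝 (Projectivization.mk ℝ x.rep x.rep_nonzero), y ∈ Xᶜ := by
    rw [eventually_nhds_mk]
    filter_upwards [h _ x.rep_nonzero hx'] with w hw h0 hmem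
    exact hw ((mem_cone_iff h0).2 hmem)
  rwa [Projectivization.mk_rep] at this

theorem isClosed_zariskiClosure {n : ℕ} (X : Set (RP n)) : IsClosed (zariskiClosure X) := by
  refine isClosed_of_cone fun v hv hmem => ?_
  rw [mem_cone_zariskiClosure hv] at hmem
  push Not at hmem
  obtain ⟨F, hF, hne⟩ := hmem
  have : ContinuousAt (fun w => eval w F) v := (MvPolynomial.continuous_eval F).continuousAt
  filter_upwards [this.eventually_ne hne] with w hw hw'
  exact hw ((mem_cone_zariskiClosure hw'.1).1 hw' F hF)

theorem zariskiClosure_eq_of_dense {n : ℕ} {X Y : Set (RP n)} (h : X ⊆ Y) (hd : Y ⊆ closure X) :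
    zariskiClosure Y = zariskiClosure X := by
  refine Set.Subset.antisymm ?_ (zariskiClosure_mono h)
  have : Y ⊆ zariskiClosure X :=
    hd.trans ((isClosed_zariskiClosure X).closure_subset_iff.2 (subset_zariskiClosure X))
  exact (zariskiClosure_mono this).trans (zariskiClosure_idem X).subset

/-! ### Regular functions -/

theorem eval_smul_of_isHomogeneous {σ : Type*} {F : MvPolynomial σ ℝ} {d : ℕ}
    (hF : F.IsHomogeneous d) (c : ℝ) (v : σ → ℝ) : eval (c • v) F = c ^ d * eval v F := by
  rw [eval_eq, eval_eq, Finset.mul_sum]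
  refine Finset.sum_congr rfl fun m hm => ?_
  have hd : m.degree = d := by
    by_contra h
    exact (mem_support_iff.1 hm) (hF.coeff_eq_zero h)
  have : ∏ i ∈ m.support, (c • v) i ^ m i = c ^ d * ∏ i ∈ m.support, v i ^ m i := by
    simp only [Pi.smul_apply, smul_eq_mul, mul_pow, Finset.prod_mul_distrib,
      Finset.prod_pow_eq_pow_sum]
    rw [← hd, Finsupp.degree_apply]
  rw [this]
  ring

/-- The polynomial `∑ xᵢ²`. -/
noncomputable def nsqPoly (k : ℕ) : MvPolynomial (Fin k) ℝ := ∑ i, X i ^ 2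

@[simp] theorem eval_nsqPoly {k : ℕ} (v : Fin k → ℝ) : eval v (nsqPoly k) = nsq v := by
  simp [nsqPoly, nsq]

theorem isHomogeneous_nsqPoly (k : ℕ) : (nsqPoly k).IsHomogeneous 2 :=
  IsHomogeneous.sum _ _ _ fun i _ => isHomogeneous_X_pow i 2

section

variable {n : ℕ} {V : Set (RP n)}

theorem isRegularFunctionOn_const (c : ℝ) : IsRegularFunctionOn V fun _ => c := fun _ _ =>
  ⟨0, C c, 1, isHomogeneous_C _ _, isHomogeneous_one _ _, by simp, fun y _ _ => by simp⟩

theorem IsRegularFunctionOn.add {f g : RP n → ℝ} (hf : IsRegularFunctionOn V f)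
    (hg : IsRegularFunctionOn V g) : IsRegularFunctionOn V fun x => f x + g x := by
  intro x hx
  obtain ⟨d, P, Q, hP, hQ, h0, h⟩ := hf x hx
  obtain ⟨d', P', Q', hP', hQ', h0', h'⟩ := hg x hx
  refine ⟨d + d', P * Q' + Q * P', Q * Q', (hP.mul hQ').add (hQ.mul hP'), hQ.mul hQ', ?_, ?_⟩
  · simpa using ⟨h0, h0'⟩
  · intro y hy hne
    simp only [map_mul, mul_ne_zero_iff] at hne
    beta_reduce
    rw [h y hy hne.1, h' y hy hne.2]
    have := hne.1
    have := hne.2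
    simp only [map_mul, map_add]
    field_simp

theorem IsRegularFunctionOn.mul {f g : RP n → ℝ} (hf : IsRegularFunctionOn V f)
    (hg : IsRegularFunctionOn V g) : IsRegularFunctionOn V fun x => f x * g x := by
  intro x hx
  obtain ⟨d, P, Q, hP, hQ, h0, h⟩ := hf x hx
  obtain ⟨d', P', Q', hP', hQ', h0', h'⟩ := hg x hx
  refine ⟨d + d', P * P', Q * Q', hP.mul hP', hQ.mul hQ', ?_, ?_⟩
  · simpa using ⟨h0, h0'⟩
  · intro y hy hne
    simp only [map_mul, mul_ne_zero_iff] at hne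
    beta_reduce
    rw [h y hy hne.1, h' y hy hne.2]
    simp only [map_mul]
    rw [div_mul_div_comm]

theorem IsRegularFunctionOn.sub {f g : RP n → ℝ} (hf : IsRegularFunctionOn V f)
    (hg : IsRegularFunctionOn V g) : IsRegularFunctionOn V fun x => f x - g x := by
  have := hf.add ((isRegularFunctionOn_const (-1)).mul hg)
  simpa [sub_eq_add_neg] using this

/-- The denominator `∑ F k * F k` is nonzero wherever the local expression of the map is defined. A
regular map thus becomes a family of regular functions, to which global denominators apply. -/
theorem IsRegularMapOn.regular_emb {m : ℕ} {f : RP n → RP m} (hf : IsRegularMapOn V f)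
    (i j : Fin (m + 1)) : IsRegularFunctionOn V fun x => emb (f x) i j := by
  intro x hx
  obtain ⟨d, F, hF, h0, h⟩ := hf x hx
  have hev : ∀ y : RP n, eval y.rep (∑ k, F k * F k) = nsq fun k => eval y.rep (F k) := by
    intro y
    simp [nsq, sq]
  refine ⟨d + d, F i * F j, ∑ k, F k * F k, (hF i).mul (hF j),
    IsHomogeneous.sum _ _ _ fun k _ => (hF k).mul (hF k), ?_, ?_⟩
  · rw [hev]
    exact (nsq_pos h0).ne'
  · intro y hy hne
    rw [hev] at hne ⊢
    have hne' : (fun k => eval y.rep (F k)) ≠ 0 := by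
      intro h
      rw [h] at hne
      simp [nsq] at hne
    beta_reduce
    rw [h y hy hne', emb_mk, map_mul]

theorem isRegularFunctionOn_emb (i j : Fin (n + 1)) : IsRegularFunctionOn V fun x => emb x i j := by
  intro x _
  refine ⟨2, X i * X j, nsqPoly _, (isHomogeneous_X _ i).mul (isHomogeneous_X _ j),
    isHomogeneous_nsqPoly _, ?_, ?_⟩
  · simpa using (nsq_pos x.rep_nonzero).ne'
  · intro y _ _
    simp [emb]

/-- A regular function on a compact set is globally a quotient of homogeneous polynomials with
positive denominator. -/
theorem IsRegularFunctionOn.exists_global {f : RP n → ℝ} (hf : IsRegularFunctionOn V f)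
    (hV : IsCompact V) : ∃ (d : ℕ) (A B : MvPolynomial (Fin (n + 1)) ℝ), A.IsHomogeneous d ∧
      B.IsHomogeneous d ∧ ∀ v ∈ cone V, 0 < eval v B ∧
        ∀ h : v ≠ 0, f (Projectivization.mk ℝ v h) = eval v A / eval v B := by
  obtain ⟨d, A, B, hA, hB, -, hfAB, hpos⟩ : ∃ (d : ℕ) (A B : MvPolynomial (Fin (n + 1)) ℝ),
      A.IsHomogeneous (2 * d) ∧ B.IsHomogeneous (2 * d) ∧ (∀ v, 0 ≤ eval v B) ∧
      (∀ y ∈ V, f y * eval y.rep B = eval y.rep A) ∧ ∀ y ∈ V, 0 < eval y.rep B := by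
    -- A local quotient `P / Q` is rewritten as `P * Q / Q ^ 2`: the identity `f * B = A` then holds
    -- on all of `V`, also where `Q` vanishes. Numerators and nonnegative denominators can therefore
    -- be added over a finite cover, after equalizing degrees with powers of `nsqPoly`. The even
    -- degree keeps the sign of `B` independent of the representative.
    refine hV.induction_on (p := fun s => ∃ (d : ℕ) (A B : MvPolynomial (Fin (n + 1)) ℝ),
      A.IsHomogeneous (2 * d) ∧ B.IsHomogeneous (2 * d) ∧ (∀ v, 0 ≤ eval v B) ∧
      (∀ y ∈ V, f y * eval y.rep B = eval y.rep A) ∧ ∀ y ∈ s, 0 < eval y.rep B) ?_ ?_ ?_ ?_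
    · exact ⟨0, 0, 0, isHomogeneous_zero _ _ _, isHomogeneous_zero _ _ _, by simp, by simp,
        by simp⟩
    · rintro s t hst ⟨d, A, B, h1, h2, h3, h4, h5⟩
      exact ⟨d, A, B, h1, h2, h3, h4, fun y hy => h5 y (hst hy)⟩
    · rintro s t ⟨d, A, B, h1, h2, h3, h4, h5⟩ ⟨d', A', B', h1', h2', h3', h4', h5'⟩
      have hN : ∀ k : ℕ, (nsqPoly (n + 1) ^ k).IsHomogeneous (2 * k) :=
        fun k => (isHomogeneous_nsqPoly _).pow k
      refine ⟨d + d', A * nsqPoly _ ^ d' + nsqPoly _ ^ d * A',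
        B * nsqPoly _ ^ d' + nsqPoly _ ^ d * B', ?_, ?_, ?_, ?_, ?_⟩
      · rw [mul_add]
        exact (h1.mul (hN d')).add ((hN d).mul h1')
      · rw [mul_add]
        exact (h2.mul (hN d')).add ((hN d).mul h2')
      · intro v
        have h6 := h3 v
        have h7 := h3' v
        have h8 : 0 ≤ nsq v := Finset.sum_nonneg fun i _ => sq_nonneg _
        simp only [map_add, map_mul, map_pow, eval_nsqPoly]
        positivity
      · intro y hy
        simp only [map_add, map_mul, map_pow, ← h4 y hy, ← h4' y hy]
        ring
      · intro y hy
        have h6 := h3 y.rep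
        have h7 := h3' y.rep
        have h8 := nsq_pos y.rep_nonzero
        simp only [map_add, map_mul, map_pow, eval_nsqPoly]
        rcases hy with hy | hy
        · have := h5 y hy
          positivity
        · have := h5' y hy
          positivity
    · intro x hx
      obtain ⟨d, P, Q, hP, hQ, h0, h⟩ := hf x hx
      refine ⟨{y | eval y.rep Q ≠ 0}, ?_, d, P * Q, Q * Q, ?_, ?_, ?_, ?_, ?_⟩
      · refine mem_nhdsWithin_of_mem_nhds ?_
        have : ∀ᶠ y in 𝓝 (Projectivization.mk ℝ x.rep x.rep_nonzero), eval y.rep Q ≠ 0 := by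
          rw [eventually_nhds_mk]
          have hc : ContinuousAt (fun w => eval w Q) x.rep :=
            (MvPolynomial.continuous_eval Q).continuousAt
          filter_upwards [hc.eventually_ne h0] with w hw hw0
          obtain ⟨c, hc, hr⟩ := exists_mk_rep_eq_smul w hw0
          rw [hr, eval_smul_of_isHomogeneous hQ]
          exact mul_ne_zero (pow_ne_zero _ hc) hw
        rwa [Projectivization.mk_rep] at this
      · rw [two_mul]
        exact hP.mul hQ
      · rw [two_mul]
        exact hQ.mul hQ
      · intro v
        rw [map_mul]
        exact mul_self_nonneg _
      · intro y hy
        rw [map_mul, map_mul]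
        by_cases h1 : eval y.rep Q = 0
        · simp [h1]
        · rw [h y hy h1]
          field_simp
      · intro y hy
        rw [map_mul]
        exact mul_self_pos.2 hy
  refine ⟨2 * d, A, B, hA, hB, fun v hv => ?_⟩
  have hv0 := ne_zero_of_mem_cone hv
  have hm := mk_mem_of_mem_cone hv hv0
  obtain ⟨c, hc, hr⟩ := exists_mk_rep_eq_smul v hv0
  have h1 := hfAB _ hm
  have h2 := hpos _ hm
  rw [hr, eval_smul_of_isHomogeneous hB] at h1 h2
  rw [eval_smul_of_isHomogeneous hA] at h1
  have hc2 : 0 < c ^ (2 * d) := by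
    rw [pow_mul]
    positivity
  have h3 : 0 < eval v B := pos_of_mul_pos_right h2 hc2.le
  refine ⟨h3, fun h => ?_⟩
  rw [eq_div_iff h3.ne']
  exact mul_left_cancel₀ hc2.ne' (by linarith)

/-- Finitely many regular functions on a compact set have a common denominator. -/
theorem exists_global_family {ι : Type*} [Fintype ι] {f : ι → RP n → ℝ}
    (hf : ∀ a, IsRegularFunctionOn V (f a)) (hV : IsCompact V) :
    ∃ (d : ℕ) (A : ι → MvPolynomial (Fin (n + 1)) ℝ) (B : MvPolynomial (Fin (n + 1)) ℝ),
      (∀ a, (A a).IsHomogeneous d) ∧ B.IsHomogeneous d ∧ ∀ v ∈ cone V, 0 < eval v B ∧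
        ∀ a, ∀ h : v ≠ 0, f a (Projectivization.mk ℝ v h) = eval v (A a) / eval v B := by
  classical
  choose d A B hA hB h using fun a => (hf a).exists_global hV
  refine ⟨∑ a, d a, fun a => A a * ∏ b ∈ Finset.univ.erase a, B b, ∏ a, B a, fun a => ?_,
    IsHomogeneous.prod _ _ _ fun a _ => hB a, fun v hv => ⟨?_, fun a h0 => ?_⟩⟩
  · rw [← Finset.add_sum_erase _ _ (Finset.mem_univ a)]
    exact (hA a).mul (IsHomogeneous.prod _ _ _ fun a _ => hB a)
  · rw [map_prod]
    exact Finset.prod_pos fun a _ => (h a v hv).1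
  · rw [← Finset.mul_prod_erase _ _ (Finset.mem_univ a), (h a v hv).2 h0, map_mul, map_mul,
      mul_div_mul_right]
    rw [map_prod]
    exact Finset.prod_ne_zero_iff.2 fun b _ => (h b v hv).1.ne'

theorem IsRegularFunctionOn.continuousOn {f : RP n → ℝ} (hf : IsRegularFunctionOn V f) :
    ContinuousOn f V := by
  intro x hx
  obtain ⟨d, P, Q, hP, hQ, h0, h⟩ := hf x hx
  have key : Tendsto f (𝓝 x ⊓ 𝓟 V) (𝓝 (f x)) := by
    rw [tendsto_iff_eventually]
    intro p hp
    rw [eventually_inf_principal]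
    have : ∀ᶠ y in 𝓝 (Projectivization.mk ℝ x.rep x.rep_nonzero), y ∈ V → p (f y) := by
      rw [eventually_nhds_mk]
      have hc : ContinuousAt (fun w => eval w P / eval w Q) x.rep :=
        (MvPolynomial.continuous_eval P).continuousAt.div
          (MvPolynomial.continuous_eval Q).continuousAt h0
      have hc' : ContinuousAt (fun w => eval w Q) x.rep :=
        (MvPolynomial.continuous_eval Q).continuousAt
      rw [h x hx h0] at hp
      filter_upwards [hc.eventually hp, hc'.eventually_ne h0] with w hw1 hw2 hw0 hwV
      obtain ⟨c, hc, hr⟩ := exists_mk_rep_eq_smul w hw0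
      have hQ' : eval (Projectivization.mk ℝ w hw0).rep Q = c ^ d * eval w Q := by
        rw [hr, eval_smul_of_isHomogeneous hQ]
      have hP' : eval (Projectivization.mk ℝ w hw0).rep P = c ^ d * eval w P := by
        rw [hr, eval_smul_of_isHomogeneous hP]
      rw [h _ hwV (by rw [hQ']; exact mul_ne_zero (pow_ne_zero _ hc) hw2), hQ', hP',
        mul_div_mul_left _ _ (pow_ne_zero _ hc)]
      exact hw1
    rwa [Projectivization.mk_rep] at this
  exact key

theorem isEmbedding_emb : Topology.IsEmbedding (emb (n := n)) :=
  (continuous_emb.isClosedEmbedding emb_injective).isEmbedding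

theorem IsRegularMapOn.continuousOn {m : ℕ} {f : RP n → RP m} (hf : IsRegularMapOn V f) :
    ContinuousOn f V := by
  rw [isEmbedding_emb.continuousOn_iff]
  exact continuousOn_pi.2 fun i => continuousOn_pi.2 fun j => (hf.regular_emb i j).continuousOn

end

/-! ### Even and odd functions of an involution -/

section

variable {n : ℕ}

/-- The even functions `e + e ∘ σ` of the matrix entries `e`. -/
noncomputable def evenPart (σ : RP n → RP n) (x : RP n) (a : Fin (n + 1) × Fin (n + 1)) : ℝ :=
  emb x a.1 a.2 + emb (σ x) a.1 a.2

/-- The odd functions `e - e ∘ σ` of the matrix entries `e`. -/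
noncomputable def oddPart (σ : RP n → RP n) (x : RP n) (a : Fin (n + 1) × Fin (n + 1)) : ℝ :=
  emb x a.1 a.2 - emb (σ x) a.1 a.2

variable {V : Set (RP n)} {σ : RP n → RP n}

theorem isRegularFunctionOn_evenPart (hσ : IsRegularMapOn V σ) (a : Fin (n + 1) × Fin (n + 1)) :
    IsRegularFunctionOn V fun x => evenPart σ x a :=
  (isRegularFunctionOn_emb _ _).add (hσ.regular_emb _ _)

theorem isRegularFunctionOn_oddPart (hσ : IsRegularMapOn V σ) (a : Fin (n + 1) × Fin (n + 1)) :
    IsRegularFunctionOn V fun x => oddPart σ x a :=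
  (isRegularFunctionOn_emb _ _).sub (hσ.regular_emb _ _)

theorem evenPart_apply {x : RP n} (h : σ (σ x) = x) (a : Fin (n + 1) × Fin (n + 1)) :
    evenPart σ (σ x) a = evenPart σ x a := by
  simp only [evenPart, h]
  ring

theorem oddPart_apply {x : RP n} (h : σ (σ x) = x) (a : Fin (n + 1) × Fin (n + 1)) :
    oddPart σ (σ x) a = -oddPart σ x a := by
  simp only [oddPart, h]
  ring

theorem emb_eq_half (σ : RP n → RP n) (x : RP n) (a : Fin (n + 1) × Fin (n + 1)) :
    emb x a.1 a.2 = (evenPart σ x a + oddPart σ x a) / 2 := by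
  simp only [evenPart, oddPart]
  ring

theorem emb_apply_eq_half (σ : RP n → RP n) (x : RP n) (a : Fin (n + 1) × Fin (n + 1)) :
    emb (σ x) a.1 a.2 = (evenPart σ x a + -oddPart σ x a) / 2 := by
  simp only [evenPart, oddPart]
  ring

theorem eq_of_emb_eq {m : ℕ} {x y : RP m} (h : ∀ a : Fin (m + 1) × Fin (m + 1),
    emb x a.1 a.2 = emb y a.1 a.2) : x = y :=
  emb_injective (by ext i j; exact h (i, j))

theorem oddPart_eq_zero_iff {x : RP n} : oddPart σ x = 0 ↔ σ x = x := by
  constructor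
  · intro h
    refine eq_of_emb_eq fun a => ?_
    have := congrFun h a
    simp only [oddPart, Pi.zero_apply] at this
    linarith
  · intro h
    ext a
    simp [oddPart, h]

/-- The invariants `e + e ∘ σ` and the products of two odd functions. -/
noncomputable def invariantVec (σ : RP n → RP n) (x : RP n) :
    (Fin (n + 1) × Fin (n + 1)) ⊕
      ((Fin (n + 1) × Fin (n + 1)) × (Fin (n + 1) × Fin (n + 1))) → ℝ :=
  Sum.elim (evenPart σ x) fun c => oddPart σ x c.1 * oddPart σ x c.2

theorem invariantVec_apply {x : RP n} (h : σ (σ x) = x) :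
    invariantVec σ (σ x) = invariantVec σ x := by
  ext (a | c)
  · exact evenPart_apply h a
  · simp only [invariantVec, Sum.elim_inr, oddPart_apply h]
    ring

theorem isRegularFunctionOn_invariantVec (hσ : IsRegularMapOn V σ) (c) :
    IsRegularFunctionOn V fun x => invariantVec σ x c := by
  rcases c with a | c
  · exact isRegularFunctionOn_evenPart hσ a
  · exact (isRegularFunctionOn_oddPart hσ _).mul (isRegularFunctionOn_oddPart hσ _)

/-- The rank-one matrix of products determines the vector up to sign, as is seen on the row of a
nonzero entry. Since `σ` negates the odd vector, this sign is exactly the ambiguity of an orbit. -/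
theorem eq_or_eq_neg_of_mul_eq_mul {ι : Type*} {d d' : ι → ℝ}
    (h : ∀ a b, d a * d b = d' a * d' b) : d' = d ∨ d' = -d := by
  by_cases h0 : d = 0
  · left
    ext a
    have := h a a
    simp only [h0, Pi.zero_apply, mul_zero] at this ⊢
    exact mul_self_eq_zero.1 this.symm
  · obtain ⟨a, ha⟩ := Function.ne_iff.1 h0
    have ha : d a ≠ 0 := ha
    rcases mul_self_eq_mul_self_iff.1 (h a a) with h1 | h1
    · left
      ext b
      have := h a b
      rw [← h1] at this
      exact (mul_left_cancel₀ ha this).symm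
    · right
      ext b
      have h2 : d' a = -d a := by linarith
      have := h a b
      rw [h2] at this
      refine mul_left_cancel₀ ha ?_
      simp only [Pi.neg_apply]
      linarith

theorem invariantVec_eq_iff {x y : RP n} (h : σ (σ x) = x) :
    invariantVec σ x = invariantVec σ y ↔ y = x ∨ y = σ x := by
  constructor
  · intro hxy
    have h1 : ∀ a, evenPart σ x a = evenPart σ y a := fun a => congrFun hxy (Sum.inl a)
    have h2 : ∀ a b, oddPart σ x a * oddPart σ x b = oddPart σ y a * oddPart σ y b :=
      fun a b => congrFun hxy (Sum.inr (a, b))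
    rcases eq_or_eq_neg_of_mul_eq_mul h2 with h3 | h3
    · left
      refine eq_of_emb_eq fun a => ?_
      rw [emb_eq_half σ x, emb_eq_half σ y, h1, h3]
    · right
      refine eq_of_emb_eq fun a => ?_
      rw [emb_apply_eq_half σ x, emb_eq_half σ y, h1, h3]
      rfl
  · rintro (rfl | rfl)
    · rfl
    · exact (invariantVec_apply h).symm

/-! ### Existence of the quotient -/

/-- The even and odd parts of a polynomial in `(s + d) / 2`. -/
theorem exists_even_odd {ι : Type*} [Fintype ι] (F : MvPolynomial ι ℝ) :
    ∃ (H : MvPolynomial (ι ⊕ (ι × ι)) ℝ) (K : ι → MvPolynomial (ι ⊕ (ι × ι)) ℝ),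
      ∀ s d : ι → ℝ, eval (fun a => (s a + d a) / 2) F =
        eval (Sum.elim s fun c => d c.1 * d c.2) H +
          ∑ a, d a * eval (Sum.elim s fun c => d c.1 * d c.2) (K a) := by
  classical
  induction F using MvPolynomial.induction_on with
  | C c => exact ⟨C c, 0, by simp⟩
  | add p q hp hq =>
    obtain ⟨H, K, h⟩ := hp
    obtain ⟨H', K', h'⟩ := hq
    refine ⟨H + H', K + K', fun s d => ?_⟩
    simp only [map_add, h, h', Pi.add_apply, mul_add, Finset.sum_add_distrib]
    ring
  | mul_X p b hp =>
    obtain ⟨H, K, h⟩ := hp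
    -- After multiplication by `(s b + d b) / 2`, the product of `d b` with the odd part is even and
    -- is expressed by the variables `Sum.inr (a, b)`. The product of `d b` with the even part
    -- contributes `H` to the odd coefficient at `b`.
    refine ⟨C (1 / 2) * (H * X (Sum.inl b) + ∑ a, X (Sum.inr (a, b)) * K a),
      fun a => C (1 / 2) * (K a * X (Sum.inl b) + if a = b then H else 0), fun s d => ?_⟩
    simp only [map_mul, h, map_add, eval_C, eval_X, map_sum, Sum.elim_inl, Sum.elim_inr]
    have h1 : ∀ z : ι ⊕ (ι × ι) → ℝ, ∑ a, d a * (1 / 2 * (eval z (K a) * s b +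
        eval z (if a = b then H else 0))) =
        1 / 2 * s b * ∑ a, d a * eval z (K a) + 1 / 2 * d b * eval z H := by
      intro z
      have h2 : ∀ a, d a * (1 / 2 * (eval z (K a) * s b + eval z (if a = b then H else 0))) =
          1 / 2 * s b * (d a * eval z (K a)) +
            (if a = b then 1 / 2 * d b * eval z H else 0) := by
        intro a
        split_ifs with hab
        · subst hab; ring
        · simp; ring
      simp only [h2, Finset.sum_add_distrib, Finset.mul_sum]
      simp
    have h3 : ∀ z : ι ⊕ (ι × ι) → ℝ, ∑ a, d a * d b * eval z (K a) =
        d b * ∑ a, d a * eval z (K a) := by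
      intro z
      rw [Finset.mul_sum]
      exact Finset.sum_congr rfl fun a _ => by ring
    rw [h1, h3]
    ring

/-- Replacing `d` by `-d` exchanges a point with its image and cancels the odd part. The sum over an
orbit of a polynomial in the matrix entries is thus a polynomial in the invariants. -/
theorem exists_even {ι : Type*} [Fintype ι] (F : MvPolynomial ι ℝ) :
    ∃ H : MvPolynomial (ι ⊕ (ι × ι)) ℝ, ∀ s d : ι → ℝ,
      eval (fun a => (s a + d a) / 2) F + eval (fun a => (s a + -d a) / 2) F =
        eval (Sum.elim s fun c => d c.1 * d c.2) H := by
  obtain ⟨H, K, h⟩ := exists_even_odd F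
  refine ⟨C 2 * H, fun s d => ?_⟩
  have h1 := h s fun a => -d a
  simp only [neg_mul, mul_neg, neg_neg, Finset.sum_neg_distrib] at h1
  rw [h, h1, map_mul, eval_C]
  ring

/-- Homogenization of a polynomial. -/
theorem exists_homogenization {ι : Type*} {m : ℕ} (e : ι ≃ Fin m) (Q : MvPolynomial ι ℝ) :
    ∃ P : MvPolynomial (Fin (m + 1)) ℝ, P.IsHomogeneous Q.totalDegree ∧
      ∀ u : Fin (m + 1) → ℝ, u 0 = 1 → eval u P = eval (fun a => u (e a).succ) Q := by
  refine ⟨∑ j ∈ Finset.range (Q.totalDegree + 1),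
    X 0 ^ (Q.totalDegree - j) * rename (fun a => (e a).succ) (homogeneousComponent j Q), ?_, ?_⟩
  · refine IsHomogeneous.sum _ _ _ fun j hj => ?_
    have h1 := (isHomogeneous_X_pow (R := ℝ) (0 : Fin (m + 1)) (Q.totalDegree - j)).mul
      ((homogeneousComponent_isHomogeneous j Q).rename_isHomogeneous (f := fun a => (e a).succ))
    rwa [Nat.sub_add_cancel (by simpa [Nat.lt_succ_iff] using hj)] at h1
  · intro u hu
    conv_rhs => rw [← sum_homogeneousComponent Q]
    simp only [map_sum, map_mul, map_pow, eval_X, hu, one_pow, one_mul, eval_rename]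
    rfl

/-- The sum over `i` of the polynomials `A` in the `i`-th row of a matrix. -/
noncomputable def rowSum (A : MvPolynomial (Fin (n + 1)) ℝ) :
    MvPolynomial (Fin (n + 1) × Fin (n + 1)) ℝ :=
  ∑ i, rename (fun j => (i, j)) A

/-- Row `i` of the matrix of `x` is the multiple of `x.rep` by `x.rep i / nsq x.rep`, and
homogeneity extracts the power of this scalar. The common factor cancels in quotients of the same
degree. -/
theorem eval_rowSum {A : MvPolynomial (Fin (n + 1)) ℝ} {d : ℕ} (hA : A.IsHomogeneous d)
    (x : RP n) : eval (fun a => emb x a.1 a.2) (rowSum A) =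
      (∑ i, (x.rep i / nsq x.rep) ^ d) * eval x.rep A := by
  rw [rowSum, map_sum, Finset.sum_mul]
  refine Finset.sum_congr rfl fun i _ => ?_
  rw [eval_rename, ← eval_smul_of_isHomogeneous hA, ← emb_row]
  rfl

/-- A regular function on a compact set is a quotient of polynomials in the matrix entries. -/
theorem IsRegularFunctionOn.exists_affine {f : RP n → ℝ} (hf : IsRegularFunctionOn V f)
    (hV : IsCompact V) : ∃ A B : MvPolynomial (Fin (n + 1) × Fin (n + 1)) ℝ, ∀ x ∈ V,
      0 < eval (fun a => emb x a.1 a.2) B ∧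
      f x * eval (fun a => emb x a.1 a.2) B = eval (fun a => emb x a.1 a.2) A := by
  obtain ⟨d, A, B, hA, hB, h⟩ := hf.exists_global hV
  -- The additional factor `B` makes the degree even, so that the sum of powers from `eval_rowSum`
  -- is positive.
  refine ⟨rowSum (A * B), rowSum (B * B), fun x hx => ?_⟩
  obtain ⟨h1, h2⟩ := h x.rep (rep_mem_cone.2 hx)
  have h2 := h2 x.rep_nonzero
  rw [Projectivization.mk_rep] at h2
  rw [eval_rowSum (hA.mul hB), eval_rowSum (hB.mul hB), map_mul, map_mul, h2]
  constructor
  · refine mul_pos ?_ (mul_pos h1 h1)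
    obtain ⟨i, hi⟩ := Function.ne_iff.1 x.rep_nonzero
    have hi : x.rep i ≠ 0 := hi
    have hn := nsq_pos x.rep_nonzero
    refine Finset.sum_pos' (fun j _ => ?_) ⟨i, Finset.mem_univ i, ?_⟩
    · rw [pow_add]
      exact mul_self_nonneg _
    · rw [pow_add]
      exact mul_self_pos.2 (pow_ne_zero _ (div_ne_zero hi hn.ne'))
  · field_simp

/-- The quotient map sends `x` to the point with homogeneous coordinates `1` and the entries of
`invariantVec σ x`. The leading `1` allows a vector to be recovered from its class, so the fibres
are those of `invariantVec`. -/
theorem exists_isQuotientMap (hV : IsCompact V) (hσ : IsRegularMapOn V σ)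
    (hmaps : Set.MapsTo σ V V) (hinv : ∀ x ∈ V, σ (σ x) = x) :
    ∃ (m : ℕ) (p : RP n → RP m), IsQuotientMap V σ p := by
  classical
  obtain ⟨m, ⟨e⟩⟩ := Finite.exists_equiv_fin ((Fin (n + 1) × Fin (n + 1)) ⊕
      ((Fin (n + 1) × Fin (n + 1)) × (Fin (n + 1) × Fin (n + 1))))
  let c : RP n → Fin (m + 1) → ℝ := fun x =>
    Fin.cons 1 fun l => invariantVec σ x (e.symm l)
  have hc0 : ∀ x, c x 0 = 1 := fun x => rfl
  have hcs : ∀ x a, c x (e a).succ = invariantVec σ x a := by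
    intro x a
    simp [c]
  have hcne : ∀ x, c x ≠ 0 := fun x h => by
    have := congrFun h 0
    rw [hc0] at this
    exact one_ne_zero this
  have hceq : ∀ x y, c x = c y ↔ invariantVec σ x = invariantVec σ y := by
    intro x y
    constructor
    · intro h
      ext a
      rw [← hcs, ← hcs, h]
    · intro h
      simp only [c, h]
  refine ⟨m, fun x => Projectivization.mk ℝ (c x) (hcne x), ?_, ?_, ?_⟩
  · have hreg : ∀ k, IsRegularFunctionOn V fun x => c x k := by
      intro k
      refine Fin.cases ?_ (fun l => ?_) k
      · exact isRegularFunctionOn_const 1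
      · simpa [c] using isRegularFunctionOn_invariantVec hσ (e.symm l)
    obtain ⟨d, A, B, hA, hB, h⟩ := exists_global_family hreg hV
    have key : ∀ y ∈ V, (fun k => eval y.rep (A k)) = eval y.rep B • c y := by
      intro y hy
      obtain ⟨h1, h2⟩ := h y.rep (rep_mem_cone.2 hy)
      ext k
      have h3 := h2 k y.rep_nonzero
      rw [Projectivization.mk_rep] at h3
      rw [Pi.smul_apply, smul_eq_mul, h3]
      field_simp
    intro x hx
    have hpos := (h x.rep (rep_mem_cone.2 hx)).1
    refine ⟨d, A, hA, ?_, ?_⟩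
    · rw [key x hx]
      exact smul_ne_zero hpos.ne' (hcne x)
    · intro y hy hne
      have hpos := (h y.rep (rep_mem_cone.2 hy)).1
      have := mk_smul (c y) (hcne y) hpos.ne'
      simp only [key y hy]
      exact this.symm
  · intro x hx y hy
    rw [← invariantVec_eq_iff (hinv x hx), ← hceq]
    constructor
    · intro h
      have hm := minors_of_mk_eq_mk (hcne x) (hcne y) h
      ext k
      have := hm k 0
      rw [hc0, hc0] at this
      linarith
    · intro h
      simp only [h]
  · intro f hf hfσ
    obtain ⟨A, B, hAB⟩ := hf.exists_affine hV
    obtain ⟨HA, hHA⟩ := exists_even A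
    obtain ⟨HB, hHB⟩ := exists_even B
    obtain ⟨PA, hPA, hPA'⟩ := exists_homogenization e HA
    obtain ⟨PB, hPB, hPB'⟩ := exists_homogenization e HB
    have hsum : ∀ F : MvPolynomial (Fin (n + 1) × Fin (n + 1)) ℝ, ∀ H,
        (∀ s d : Fin (n + 1) × Fin (n + 1) → ℝ,
          eval (fun a => (s a + d a) / 2) F + eval (fun a => (s a + -d a) / 2) F =
          eval (Sum.elim s fun c => d c.1 * d c.2) H) → ∀ x, eval (invariantVec σ x) H =
        eval (fun a => emb x a.1 a.2) F + eval (fun a => emb (σ x) a.1 a.2) F := by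
      intro F H hH x
      rw [invariantVec, ← hH]
      congr 3
      · ext a; exact (emb_eq_half σ x a).symm
      · ext a; exact (emb_apply_eq_half σ x a).symm
    -- The identity `f * B = A` at `x` and at `σ x` is added. Both denominators are positive, so
    -- their sum cannot vanish.
    have hval : ∀ x ∈ V, 0 < eval (c x) PB ∧ f x * eval (c x) PB = eval (c x) PA := by
      intro x hx
      rw [hPB' _ (hc0 x), hPA' _ (hc0 x)]
      simp only [hcs]
      have h1 := hsum A HA hHA x
      have h2 := hsum B HB hHB x
      have h3 := hAB x hx
      have h4 := hAB _ (hmaps hx)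
      rw [hfσ x hx] at h4
      refine ⟨?_, ?_⟩
      · exact h2 ▸ add_pos h3.1 h4.1
      · calc f x * eval (invariantVec σ x) HB = _ := by rw [h2, mul_add, h3.2, h4.2]
          _ = eval (invariantVec σ x) HA := h1.symm
    -- The two homogenizations may have different degrees. Powers of `X 0`, whose value on `c x` is
    -- `1`, equalize them.
    have hP : (PA * X 0 ^ HB.totalDegree).IsHomogeneous (HA.totalDegree + HB.totalDegree) :=
      hPA.mul (isHomogeneous_X_pow _ _)
    have hQ : (PB * X 0 ^ HA.totalDegree).IsHomogeneous (HA.totalDegree + HB.totalDegree) := by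
      rw [add_comm HA.totalDegree]
      exact hPB.mul (isHomogeneous_X_pow _ _)
    have hQne : ∀ x ∈ V, ∃ b : ℝ, b ≠ 0 ∧
        eval (Projectivization.mk ℝ (c x) (hcne x)).rep (PA * X 0 ^ HB.totalDegree) =
          b * eval (c x) PA ∧
        eval (Projectivization.mk ℝ (c x) (hcne x)).rep (PB * X 0 ^ HA.totalDegree) =
          b * eval (c x) PB := by
      intro x hx
      obtain ⟨b, hb, hr⟩ := exists_mk_rep_eq_smul (c x) (hcne x)
      refine ⟨b ^ (HA.totalDegree + HB.totalDegree), pow_ne_zero _ hb, ?_, ?_⟩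
      · rw [hr, eval_smul_of_isHomogeneous hP]
        simp [hc0]
      · rw [hr, eval_smul_of_isHomogeneous hQ]
        simp [hc0]
    refine ⟨fun y => eval y.rep (PA * X 0 ^ HB.totalDegree) /
      eval y.rep (PB * X 0 ^ HA.totalDegree), ?_, ?_⟩
    · rintro _ ⟨x, hx, rfl⟩
      refine ⟨_, _, _, hP, hQ, ?_, fun y _ _ => rfl⟩
      obtain ⟨b, hb, -, h2⟩ := hQne x hx
      rw [h2]
      exact mul_ne_zero hb (hval x hx).1.ne'
    · intro x hx
      obtain ⟨b, hb, h1, h2⟩ := hQne x hx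
      beta_reduce
      rw [h1, h2, ← (hval x hx).2]
      have := (hval x hx).1.ne'
      field_simp

end

/-! ### Semi-algebraic sets -/

section

variable {N M : ℕ}

theorem IsSemialgebraic.union {A B : Set (Fin N → ℝ)} (hA : IsSemialgebraic A)
    (hB : IsSemialgebraic B) : IsSemialgebraic (A ∪ B) := by
  have := ((hA.compl A).inter _ _ (hB.compl B)).compl
  rwa [← Set.compl_union, compl_compl] at this

theorem isSemialgebraic_univ : IsSemialgebraic (Set.univ : Set (Fin N → ℝ)) := by
  have := IsSemialgebraic.pos (1 : MvPolynomial (Fin N) ℝ)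
  simpa using this

theorem isSemialgebraic_empty : IsSemialgebraic (∅ : Set (Fin N → ℝ)) := by
  have := isSemialgebraic_univ.compl (Set.univ : Set (Fin N → ℝ))
  simpa using this

theorem IsSemialgebraic.diff {A B : Set (Fin N → ℝ)} (hA : IsSemialgebraic A)
    (hB : IsSemialgebraic B) : IsSemialgebraic (A \ B) :=
  hA.inter _ _ (hB.compl B)

theorem IsSemialgebraic.iInter {ι : Type*} [Finite ι] {A : ι → Set (Fin N → ℝ)}
    (hA : ∀ i, IsSemialgebraic (A i)) : IsSemialgebraic (⋂ i, A i) := by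
  classical
  have := Fintype.ofFinite ι
  have : ∀ s : Finset ι, IsSemialgebraic (⋂ i ∈ s, A i) := by
    intro s
    induction s using Finset.induction_on with
    | empty => simpa using isSemialgebraic_univ
    | insert a s _ ih =>
      rw [Finset.set_biInter_insert]
      exact (hA a).inter _ _ ih
  simpa using this Finset.univ

theorem IsSemialgebraic.iUnion {ι : Type*} [Finite ι] {A : ι → Set (Fin N → ℝ)}
    (hA : ∀ i, IsSemialgebraic (A i)) : IsSemialgebraic (⋃ i, A i) := by
  have := (IsSemialgebraic.iInter fun i => (hA i).compl).compl
  rwa [← Set.compl_iUnion, compl_compl] at this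

theorem isSemialgebraic_eq_zero (f : MvPolynomial (Fin N) ℝ) :
    IsSemialgebraic {v | eval v f = 0} := by
  have := ((IsSemialgebraic.pos f).union (IsSemialgebraic.pos (-f))).compl
  convert! this using 1
  ext v
  simp only [Set.mem_ofPred_eq, Set.mem_compl_iff, Set.mem_union, map_neg, not_or, not_lt,
    Left.neg_nonpos_iff]
  exact ⟨fun h => ⟨h.le, h.ge⟩, fun h => le_antisymm h.1 h.2⟩

theorem isSemialgebraic_ne_zero (k : ℕ) : IsSemialgebraic {v : Fin k → ℝ | v ≠ 0} := by
  have := IsSemialgebraic.pos (nsqPoly k)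
  convert! this using 1
  ext v
  simp only [Set.mem_ofPred_eq, eval_nsqPoly]
  refine ⟨nsq_pos, fun h h0 => ?_⟩
  rw [h0] at h
  simp [nsq] at h

/-- Membership in a semi-algebraic set is decided by the signs of finitely many polynomials. -/
theorem IsSemialgebraic.exists_signs {A : Set (Fin N → ℝ)} (hA : IsSemialgebraic A) :
    ∃ Φ : Finset (MvPolynomial (Fin N) ℝ), ∀ v w : Fin N → ℝ,
      (∀ φ ∈ Φ, SignType.sign (eval v φ) = SignType.sign (eval w φ)) → (v ∈ A ↔ w ∈ A) := by
  classical
  induction hA with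
  | pos f =>
    refine ⟨{f}, fun v w h => ?_⟩
    have := h f (Finset.mem_singleton_self f)
    simp only [Set.mem_ofPred_eq]
    rw [← sign_eq_one_iff, this, sign_eq_one_iff]
  | compl A _ ih =>
    obtain ⟨Φ, h⟩ := ih
    exact ⟨Φ, fun v w hvw => not_congr (h v w hvw)⟩
  | inter A B _ _ ihA ihB =>
    obtain ⟨Φ, h⟩ := ihA
    obtain ⟨Ψ, h'⟩ := ihB
    refine ⟨Φ ∪ Ψ, fun v w hvw => and_congr ?_ ?_⟩
    · exact h v w fun φ hφ => hvw φ (Finset.mem_union_left _ hφ)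
    · exact h' v w fun φ hφ => hvw φ (Finset.mem_union_right _ hφ)

/-! ### Elimination of one square root -/

/-- The functions `Q₀ + Q₁ √g`, where `g > 0`. -/
def IsQuadratic (g : MvPolynomial (Fin M) ℝ) (f : (Fin M → ℝ) → ℝ) : Prop :=
  ∃ Q₀ Q₁ : MvPolynomial (Fin M) ℝ, ∀ u, 0 < eval u g →
    f u = eval u Q₀ + eval u Q₁ * √(eval u g)

variable {g : MvPolynomial (Fin M) ℝ}

theorem isQuadratic_eval (F : MvPolynomial (Fin M) ℝ) : IsQuadratic g fun u => eval u F :=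
  ⟨F, 0, by simp⟩

theorem isQuadratic_sqrt : IsQuadratic g fun u => √(eval u g) :=
  ⟨0, 1, by simp⟩

theorem IsQuadratic.add {f f' : (Fin M → ℝ) → ℝ} (hf : IsQuadratic g f) (hf' : IsQuadratic g f') :
    IsQuadratic g fun u => f u + f' u := by
  obtain ⟨P, Q, h⟩ := hf
  obtain ⟨P', Q', h'⟩ := hf'
  refine ⟨P + P', Q + Q', fun u hu => ?_⟩
  beta_reduce
  rw [h u hu, h' u hu]
  simp only [map_add]
  ring

theorem IsQuadratic.mul {f f' : (Fin M → ℝ) → ℝ} (hf : IsQuadratic g f) (hf' : IsQuadratic g f') :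
    IsQuadratic g fun u => f u * f' u := by
  obtain ⟨P, Q, h⟩ := hf
  obtain ⟨P', Q', h'⟩ := hf'
  refine ⟨P * P' + Q * Q' * g, P * Q' + Q * P', fun u hu => ?_⟩
  beta_reduce
  rw [h u hu, h' u hu]
  have := Real.mul_self_sqrt hu.le
  simp only [map_add, map_mul]
  linear_combination eval u Q * eval u Q' * this

theorem IsQuadratic.neg {f : (Fin M → ℝ) → ℝ} (hf : IsQuadratic g f) :
    IsQuadratic g fun u => -f u := by
  simpa using (isQuadratic_eval (C (-1))).mul hf

theorem IsQuadratic.sub {f f' : (Fin M → ℝ) → ℝ} (hf : IsQuadratic g f) (hf' : IsQuadratic g f') :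
    IsQuadratic g fun u => f u - f' u := by
  simpa [sub_eq_add_neg] using hf.add hf'.neg

theorem isQuadratic_comp {w : (Fin M → ℝ) → Fin N → ℝ} (hw : ∀ j, IsQuadratic g fun u => w u j)
    (F : MvPolynomial (Fin N) ℝ) : IsQuadratic g fun u => eval (w u) F := by
  induction F using MvPolynomial.induction_on with
  | C c => simpa using isQuadratic_eval (g := g) (C c)
  | add p q hp hq => simpa using hp.add hq
  | mul_X p b hp => simpa using hp.mul (hw b)

/-- The product with the conjugate `a - b * √g` is `a ^ 2 - b ^ 2 * g`, which is free of the root.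
Its sign together with those of `a` and `b` decides the sign of `a + b * √g`, so root conditions
become polynomial ones. -/
theorem add_mul_sqrt_pos_iff {a b g : ℝ} (hg : 0 < g) :
    0 < a + b * √g ↔ (0 < a ∧ 0 < b) ∨ (0 < a ∧ 0 < a ^ 2 - b ^ 2 * g) ∨
      (0 < b ∧ 0 < b ^ 2 * g - a ^ 2) := by
  have hs := Real.sqrt_pos.2 hg
  have hsq : √g * √g = g := Real.mul_self_sqrt hg.le
  set s := √g
  have h1 : a ^ 2 - b ^ 2 * g = (a + b * s) * (a - b * s) := by rw [← hsq]; ring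
  have h2 : b ^ 2 * g - a ^ 2 = (a + b * s) * (b * s - a) := by rw [← hsq]; ring
  constructor
  · intro h
    rcases lt_trichotomy 0 a with ha | ha | ha
    · rcases lt_trichotomy 0 b with hb | hb | hb
      · exact Or.inl ⟨ha, hb⟩
      · refine Or.inr (Or.inl ⟨ha, ?_⟩)
        rw [← hb]
        have : 0 < a ^ 2 := by positivity
        linarith
      · refine Or.inr (Or.inl ⟨ha, ?_⟩)
        rw [h1]
        have : b * s < 0 := mul_neg_of_neg_of_pos hb hs
        exact mul_pos h (by linarith)
    · have hb : 0 < b := by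
        rw [← ha, zero_add] at h
        exact pos_of_mul_pos_left h hs.le
      refine Or.inr (Or.inr ⟨hb, ?_⟩)
      rw [← ha]
      have : 0 < b ^ 2 * g := by positivity
      linarith
    · have hb : 0 < b := by
        refine pos_of_mul_pos_left (b := s) ?_ hs.le
        linarith
      refine Or.inr (Or.inr ⟨hb, ?_⟩)
      rw [h2]
      exact mul_pos h (by linarith)
  · rintro (⟨ha, hb⟩ | ⟨ha, h⟩ | ⟨hb, h⟩)
    · positivity
    · rw [h1] at h
      by_contra hn
      have h3 : 0 < a - b * s := by nlinarith
      nlinarith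
    · rw [h2] at h
      have : 0 < b * s := mul_pos hb hs
      by_contra hn
      have h3 : b * s - a < 0 := by nlinarith
      nlinarith

theorem IsQuadratic.isSemialgebraic_pos {f : (Fin M → ℝ) → ℝ} (hf : IsQuadratic g f) :
    IsSemialgebraic {u | 0 < eval u g ∧ 0 < f u} := by
  obtain ⟨P, Q, h⟩ := hf
  have h1 := IsSemialgebraic.pos P
  have h2 := IsSemialgebraic.pos Q
  have h3 := IsSemialgebraic.pos (P ^ 2 - Q ^ 2 * g)
  have h4 := IsSemialgebraic.pos (Q ^ 2 * g - P ^ 2)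
  have := (IsSemialgebraic.pos g).inter _ _
    ((h1.inter _ _ h2).union ((h1.inter _ _ h3).union (h2.inter _ _ h4)))
  convert! this using 1
  ext u
  simp only [Set.mem_ofPred_eq, Set.mem_inter_iff, Set.mem_union, map_sub, map_mul, map_pow]
  refine and_congr_right fun hu => ?_
  rw [h u hu, add_mul_sqrt_pos_iff hu]

theorem IsQuadratic.isSemialgebraic_eq_zero {f : (Fin M → ℝ) → ℝ} (hf : IsQuadratic g f) :
    IsSemialgebraic {u | 0 < eval u g ∧ f u = 0} := by
  have := (IsSemialgebraic.pos g).diff (hf.isSemialgebraic_pos.union hf.neg.isSemialgebraic_pos)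
  convert! this using 1
  ext u
  simp only [Set.mem_ofPred_eq, Set.mem_sdiff, Set.mem_union, not_or, not_and, not_lt,
    Left.neg_nonpos_iff]
  refine and_congr_right fun hu => ?_
  exact ⟨fun h => ⟨fun _ => h.le, fun _ => h.ge⟩, fun h => le_antisymm (h.1 hu) (h.2 hu)⟩

theorem IsSemialgebraic.preimage_quadratic {A : Set (Fin N → ℝ)} (hA : IsSemialgebraic A)
    {w : (Fin M → ℝ) → Fin N → ℝ} (hw : ∀ j, IsQuadratic g fun u => w u j) :
    IsSemialgebraic {u | 0 < eval u g ∧ w u ∈ A} := by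
  induction hA with
  | pos f => exact (isQuadratic_comp hw f).isSemialgebraic_pos
  | compl A _ ih =>
    convert! (IsSemialgebraic.pos g).diff ih using 1
    ext u
    simp only [Set.mem_ofPred_eq, Set.mem_sdiff, Set.mem_compl_iff, not_and]
    tauto
  | inter A B _ _ ihA ihB =>
    convert! ihA.inter _ _ ihB using 1
    ext u
    simp only [Set.mem_ofPred_eq, Set.mem_inter_iff]
    tauto

end

/-! ### Images under the quotient map are semi-algebraic -/

section

variable {n m : ℕ} {V X : Set (RP n)} {σ : RP n → RP n} {p : RP n → RP m}

theorem IsRegularMapOn.exists_global (hp : IsRegularMapOn V p) (hV : IsCompact V) :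
    ∃ (PA : Fin (m + 1) × Fin (m + 1) → MvPolynomial (Fin (n + 1)) ℝ)
      (PB : MvPolynomial (Fin (n + 1)) ℝ), ∀ v ∈ cone V, 0 < eval v PB ∧ ∀ a, ∀ h : v ≠ 0,
        emb (p (Projectivization.mk ℝ v h)) a.1 a.2 = eval v (PA a) / eval v PB := by
  obtain ⟨d, A, B, -, -, h⟩ := exists_global_family
    (f := fun (a : Fin (m + 1) × Fin (m + 1)) x => emb (p x) a.1 a.2)
    (fun a => hp.regular_emb a.1 a.2) hV
  exact ⟨A, B, h⟩

/-- The invariants of `σ` as rational functions on the quotient. -/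
theorem IsQuotientMap.exists_invariants (hp : IsQuotientMap V σ p) (hV : IsCompact V)
    (hσ : IsRegularMapOn V σ) (hinv : ∀ x ∈ V, σ (σ x) = x) :
    ∃ (A : (Fin (n + 1) × Fin (n + 1)) ⊕ ((Fin (n + 1) × Fin (n + 1)) ×
        (Fin (n + 1) × Fin (n + 1))) → MvPolynomial (Fin (m + 1)) ℝ)
      (B : MvPolynomial (Fin (m + 1)) ℝ), ∀ x ∈ V, ∀ u, ∀ h : u ≠ 0,
        p x = Projectivization.mk ℝ u h → 0 < eval u B ∧
          ∀ c, eval u (A c) = invariantVec σ x c * eval u B := by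
  choose g hg hgp using fun c => hp.invariants (fun x => invariantVec σ x c)
    (isRegularFunctionOn_invariantVec hσ c)
    (fun x hx => congrFun (invariantVec_apply (hinv x hx)) c)
  have hpV : IsCompact (p '' V) := hV.image_of_continuousOn hp.regular.continuousOn
  obtain ⟨d, A, B, -, -, h⟩ := exists_global_family hg hpV
  refine ⟨A, B, fun x hx u hu hpx => ?_⟩
  have hmem : u ∈ cone (p '' V) := (mem_cone_iff hu).2 ⟨x, hx, hpx⟩
  obtain ⟨h1, h2⟩ := h u hmem
  refine ⟨h1, fun c => ?_⟩
  rw [hgp c x hx, hpx, h2 c hu]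
  field_simp

/-- Here `w u` is a candidate preimage of the class of `u`. The last condition says that `p` sends
it back to that class, in terms of projection matrices with denominators cleared. -/
theorem isSemialgebraic_cone_image_piece {X : Set (RP n)} (hX : IsSemialgebraic (cone X))
    {g : MvPolynomial (Fin (m + 1)) ℝ} {w : (Fin (m + 1) → ℝ) → Fin (n + 1) → ℝ}
    (hw : ∀ j, IsQuadratic g fun u => w u j)
    (PA : Fin (m + 1) × Fin (m + 1) → MvPolynomial (Fin (n + 1)) ℝ)
    (PB : MvPolynomial (Fin (n + 1)) ℝ) :
    IsSemialgebraic {u | u ≠ 0 ∧ 0 < eval u g ∧ w u ∈ cone X ∧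
      ∀ a : Fin (m + 1) × Fin (m + 1),
        u a.1 * u a.2 * eval (w u) PB - nsq u * eval (w u) (PA a) = 0} := by
  have h1 := (isSemialgebraic_ne_zero (m + 1)).inter _ _ (hX.preimage_quadratic hw)
  have h2 : ∀ a : Fin (m + 1) × Fin (m + 1), IsSemialgebraic {u | 0 < eval u g ∧
      u a.1 * u a.2 * eval (w u) PB - nsq u * eval (w u) (PA a) = 0} := by
    intro a
    refine IsQuadratic.isSemialgebraic_eq_zero ?_
    have h3 := (isQuadratic_eval (g := g) (MvPolynomial.X a.1 * MvPolynomial.X a.2)).mul (isQuadratic_comp hw PB)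
    have h4 := (isQuadratic_eval (g := g) (nsqPoly _)).mul (isQuadratic_comp hw (PA a))
    simpa using h3.sub h4
  convert! h1.inter _ _ (IsSemialgebraic.iInter h2) using 1
  ext u
  simp only [Set.mem_ofPred_eq, Set.mem_inter_iff, Set.mem_iInter]
  constructor
  · rintro ⟨h0, hg, hw, h⟩
    exact ⟨⟨h0, hg, hw⟩, fun a => ⟨hg, h a⟩⟩
  · rintro ⟨⟨h0, hg, hw⟩, h⟩
    exact ⟨h0, hg, hw, fun a => (h a).2⟩

theorem eq_of_mul_eq_mul_emb {u : Fin (m + 1) → ℝ} (hu : u ≠ 0) {y : RP m} {b : ℝ} (hb : b ≠ 0)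
    {A : Fin (m + 1) × Fin (m + 1) → ℝ} (hy : ∀ a, emb y a.1 a.2 = A a / b)
    (h : ∀ a : Fin (m + 1) × Fin (m + 1), u a.1 * u a.2 * b - nsq u * A a = 0) :
    y = Projectivization.mk ℝ u hu := by
  refine eq_of_emb_eq fun a => ?_
  have h1 := nsq_pos hu
  rw [hy, emb_mk, div_eq_div_iff hb h1.ne']
  linarith [h a]

theorem mul_eq_mul_emb {u : Fin (m + 1) → ℝ} (hu : u ≠ 0) {b : ℝ} (hb : b ≠ 0)
    {A : Fin (m + 1) × Fin (m + 1) → ℝ}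
    (hy : ∀ a, emb (Projectivization.mk ℝ u hu) a.1 a.2 = A a / b)
    (a : Fin (m + 1) × Fin (m + 1)) : u a.1 * u a.2 * b - nsq u * A a = 0 := by
  have h1 := nsq_pos hu
  have := hy a
  rw [emb_mk, div_eq_div_iff h1.ne' hb] at this
  linarith

/-- The two preimages under the quotient map in terms of the invariants, up to a scalar. -/
theorem lift_eq {x : RP n} {b : ℝ} (hb : 0 < b)
    {A : (Fin (n + 1) × Fin (n + 1)) ⊕ ((Fin (n + 1) × Fin (n + 1)) ×
        (Fin (n + 1) × Fin (n + 1))) → ℝ} (hA : ∀ c, A c = invariantVec σ x c * b)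
    {k : Fin (n + 1) × Fin (n + 1)} (hk : oddPart σ x k ≠ 0) (a : Fin (n + 1) × Fin (n + 1)) :
    A (Sum.inr (k, k)) * A (Sum.inl a) + SignType.sign (oddPart σ x k) *
      (A (Sum.inr (k, a)) * √(A (Sum.inr (k, k)) * b)) =
      2 * b ^ 2 * oddPart σ x k ^ 2 * emb x a.1 a.2 := by
  -- The radicand is `(b * oddPart σ x k) ^ 2`. The sign of the odd function then selects which of
  -- the two points of the orbit is reconstructed.
  have h1 : √(A (Sum.inr (k, k)) * b) = b * |oddPart σ x k| := by
    rw [hA, Real.sqrt_eq_iff_mul_self_eq (by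
      simp only [invariantVec, Sum.elim_inr]
      have := mul_self_nonneg (oddPart σ x k)
      positivity) (by positivity)]
    simp only [invariantVec, Sum.elim_inr]
    rw [mul_mul_mul_comm, abs_mul_abs_self]
    ring
  have h2 : (SignType.sign (oddPart σ x k) : ℝ) * |oddPart σ x k| = oddPart σ x k := sign_mul_abs _
  rw [h1, emb_eq_half σ x]
  simp only [hA, invariantVec, Sum.elim_inr, Sum.elim_inl]
  linear_combination (oddPart σ x k * oddPart σ x a * b * b) * h2

/-- The projection is eliminated explicitly: up to a scalar, some preimage is polynomial in `u` when
the orbit is a fixed point, and otherwise polynomial up to one square root. -/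
theorem IsQuotientMap.isSemialgebraic_image (hp : IsQuotientMap V σ p) (hV : IsCompact V)
    (hσ : IsRegularMapOn V σ) (hinv : ∀ x ∈ V, σ (σ x) = x) (hmaps : Set.MapsTo σ V V)
    (hXV : X ⊆ V) (hXσ : Set.MapsTo σ X X)
    (hX : IsSemialgebraic (cone X)) : IsSemialgebraic (cone (p '' X)) := by
  obtain ⟨PA, PB, hP⟩ := hp.regular.exists_global hV
  obtain ⟨A, B, hAB⟩ := hp.exists_invariants hV hσ hinv
  let S (g : MvPolynomial (Fin (m + 1)) ℝ) (w : (Fin (m + 1) → ℝ) → Fin (n + 1) → ℝ) :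
      Set (Fin (m + 1) → ℝ) := {u | u ≠ 0 ∧ 0 < eval u g ∧ w u ∈ cone X ∧
      ∀ a : Fin (m + 1) × Fin (m + 1),
        u a.1 * u a.2 * eval (w u) PB - nsq u * eval (w u) (PA a) = 0}
  let w₁ (i : Fin (n + 1)) (u : Fin (m + 1) → ℝ) (j : Fin (n + 1)) : ℝ :=
    eval u (A (Sum.inl (i, j)))
  let g₂ (k : Fin (n + 1) × Fin (n + 1)) : MvPolynomial (Fin (m + 1)) ℝ := A (Sum.inr (k, k)) * B
  let w₂ (k : Fin (n + 1) × Fin (n + 1)) (i : Fin (n + 1)) (u : Fin (m + 1) → ℝ)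
      (j : Fin (n + 1)) : ℝ := eval u (A (Sum.inr (k, k)) * A (Sum.inl (i, j))) +
        eval u (A (Sum.inr (k, (i, j)))) * √(eval u (g₂ k))
  -- Each piece is contained in the image because its definition verifies the candidate. Conversely,
  -- for a point of the image one of the finitely many candidates is a nonzero multiple of a row of
  -- the matrix of a preimage in `X`.
  have hS : cone (p '' X) = (⋃ i, S 1 (w₁ i)) ∪ ⋃ k, ⋃ i, S (g₂ k) (w₂ k i) := by
    apply Set.Subset.antisymm
    · intro u hu
      have hu0 := ne_zero_of_mem_cone hu
      have hmem : ∀ g w, 0 < eval u g → ∀ y ∈ X, p y = Projectivization.mk ℝ u hu0 →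
          ∀ i, emb y i i ≠ 0 → (∃ c : ℝ, c ≠ 0 ∧ w u = c • emb y i) → u ∈ S g w := by
        rintro g w hg y hy hpy i hi ⟨c, hc, hw⟩
        have hcone : w u ∈ cone X := by
          rw [hw]
          refine smul_mem_cone ?_ hc
          exact (mem_cone_iff (emb_row_ne_zero hi)).2 (by rwa [mk_emb_row])
        refine ⟨hu0, hg, hcone, ?_⟩
        obtain ⟨h1, h2⟩ := hP _ (cone_mono hXV hcone)
        refine mul_eq_mul_emb hu0 h1.ne' fun a => ?_
        rw [← h2 a (ne_zero_of_mem_cone hcone), ← hpy]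
        congr 2
        simp only [hw, mk_smul _ (emb_row_ne_zero hi) hc, mk_emb_row]
      obtain ⟨x, hx, hpx⟩ := mk_mem_of_mem_cone hu hu0
      obtain ⟨hB, hA⟩ := hAB x (hXV hx) u hu0 hpx
      by_cases hodd : oddPart σ x = 0
      · left
        obtain ⟨i, hi⟩ := exists_emb_pos x
        refine Set.mem_iUnion.2 ⟨i, hmem _ _ (by simp) x hx hpx i hi.ne' ⟨2 * eval u B, ?_, ?_⟩⟩
        · positivity
        · ext j
          simp only [w₁, hA, invariantVec, Sum.elim_inl, Pi.smul_apply, smul_eq_mul]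
          have := emb_eq_half σ x (i, j)
          rw [hodd] at this
          simp only [Pi.zero_apply] at this
          rw [this]
          ring
      · right
        obtain ⟨k, hk⟩ := Function.ne_iff.1 hodd
        have hk : oddPart σ x k ≠ 0 := hk
        -- The candidates `w₂` use the positive root. Since `X` is stable under `σ`, the preimage
        -- can be replaced by its image, which has the opposite odd functions.
        wlog hpos : 0 < oddPart σ x k generalizing x
        · refine this (σ x) (hXσ hx) ?_ ?_ ?_ ?_ ?_ ?_
          · rw [← hpx]
            exact ((hp.fibres x (hXV hx) _ (hmaps (hXV hx))).2 (Or.inr rfl)).symm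
          · intro c
            rw [hA, invariantVec_apply (hinv x (hXV hx))]
          · intro h
            have := congrFun h k
            rw [oddPart_apply (hinv x (hXV hx)), Pi.zero_apply, neg_eq_zero] at this
            exact hk this
          · rw [oddPart_apply (hinv x (hXV hx))]
            exact neg_ne_zero.2 hk
          · rw [oddPart_apply (hinv x (hXV hx))]
            exact neg_ne_zero.2 hk
          · rw [oddPart_apply (hinv x (hXV hx))]
            exact neg_pos.2 (lt_of_le_of_ne (not_lt.1 hpos) hk)
        obtain ⟨i, hi⟩ := exists_emb_pos x
        refine Set.mem_iUnion.2 ⟨k, Set.mem_iUnion.2 ⟨i, hmem _ _ ?_ x hx hpx i hi.ne'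
          ⟨2 * eval u B ^ 2 * oddPart σ x k ^ 2, ?_, ?_⟩⟩⟩
        · simp only [g₂, map_mul, hA, invariantVec, Sum.elim_inr]
          positivity
        · positivity
        · ext j
          have := lift_eq hB hA hk (i, j)
          rw [sign_pos hpos] at this
          simp only [w₂, g₂, map_mul, Pi.smul_apply, smul_eq_mul]
          rw [← this]
          simp
    · have hsound : ∀ g w, S g w ⊆ cone (p '' X) := by
        rintro g w u ⟨hu0, -, hw, h⟩
        obtain ⟨h1, h2⟩ := hP _ (cone_mono hXV hw)
        have hw0 := ne_zero_of_mem_cone hw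
        refine (mem_cone_iff hu0).2 ⟨_, mk_mem_of_mem_cone hw hw0, ?_⟩
        exact eq_of_mul_eq_mul_emb hu0 h1.ne' (fun a => h2 a hw0) h
      exact Set.union_subset (Set.iUnion_subset fun i => hsound _ _)
        (Set.iUnion_subset fun k => Set.iUnion_subset fun i => hsound _ _)
  rw [hS]
  refine IsSemialgebraic.union (IsSemialgebraic.iUnion fun i => ?_)
    (IsSemialgebraic.iUnion fun k => IsSemialgebraic.iUnion fun i => ?_)
  · exact isSemialgebraic_cone_image_piece hX (fun j => isQuadratic_eval _) PA PB
  · exact isSemialgebraic_cone_image_piece hX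
      (fun j => (isQuadratic_eval _).add ((isQuadratic_eval _).mul isQuadratic_sqrt)) PA PB

end

/-! ### Germs of analytic arcs -/

section

variable {n : ℕ}

theorem analyticAt_eval {k : ℕ} {E : Type*} [NormedAddCommGroup E] [NormedSpace ℝ E]
    {g : E → Fin k → ℝ} {t : E} (hg : AnalyticAt ℝ g t) (F : MvPolynomial (Fin k) ℝ) :
    AnalyticAt ℝ (fun t => eval (g t) F) t := by
  have := AnalyticAt.aeval_mvPolynomial (𝕜 := ℝ) (f := g) (fun i => analyticAt_pi_iff.1 hg i) F
  simpa [MvPolynomial.aeval_eq_eval] using this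

theorem eventually_pos_or_left_of_analyticAt {f : ℝ → ℝ} (hf : AnalyticAt ℝ f 0) :
    (∀ᶠ t in 𝓝[<] (0 : ℝ), 0 < f t) ∨ ∀ᶠ t in 𝓝[<] (0 : ℝ), ¬ 0 < f t := by
  by_cases h0 : ∀ᶠ t in 𝓝 (0 : ℝ), f t = 0
  · right
    filter_upwards [h0.filter_mono nhdsWithin_le_nhds] with t ht
    simp [ht]
  · obtain ⟨k, h, hh, h1, h2⟩ := hf.exists_eventuallyEq_pow_smul_nonzero_iff.2 h0
    have hneg : ∀ᶠ t in 𝓝[<] (0 : ℝ), t < 0 := self_mem_nhdsWithin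
    have h2 := h2.filter_mono (nhdsWithin_le_nhds (s := Set.Iio (0 : ℝ)))
    simp only [sub_zero, smul_eq_mul] at h2
    have hpow : (∀ᶠ t in 𝓝[<] (0 : ℝ), 0 < t ^ k) ∨ ∀ᶠ t in 𝓝[<] (0 : ℝ), t ^ k < 0 := by
      rcases Nat.even_or_odd k with hk | hk
      · left
        filter_upwards [hneg] with t ht
        exact hk.pow_pos ht.ne
      · right
        filter_upwards [hneg] with t ht
        exact hk.pow_neg ht
    rcases lt_or_gt_of_ne h1 with hlt | hgt
    · have h3 := (hh.continuousAt.eventually_lt continuousAt_const hlt).filter_mono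
        (nhdsWithin_le_nhds (s := Set.Iio (0 : ℝ)))
      rcases hpow with hp | hp
      · right
        filter_upwards [h2, h3, hp] with t e1 e2 e3
        rw [e1]
        exact (mul_neg_of_pos_of_neg e3 e2).not_gt
      · left
        filter_upwards [h2, h3, hp] with t e1 e2 e3
        rw [e1]
        exact mul_pos_of_neg_of_neg e3 e2
    · have h3 := (continuousAt_const.eventually_lt hh.continuousAt hgt).filter_mono
        (nhdsWithin_le_nhds (s := Set.Iio (0 : ℝ)))
      rcases hpow with hp | hp
      · left
        filter_upwards [h2, h3, hp] with t e1 e2 e3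
        rw [e1]
        exact mul_pos e3 e2
      · right
        filter_upwards [h2, h3, hp] with t e1 e2 e3
        rw [e1]
        exact (mul_neg_of_neg_of_pos e3 e2).not_gt

/-- An analytic arc is eventually inside or eventually outside of a semi-algebraic set. -/
theorem IsSemialgebraic.eventually_mem_or {N : ℕ} {A : Set (Fin N → ℝ)} (hA : IsSemialgebraic A)
    {g : ℝ → Fin N → ℝ} (hg : AnalyticAt ℝ g 0) :
    (∀ᶠ t in 𝓝[<] (0 : ℝ), g t ∈ A) ∨ ∀ᶠ t in 𝓝[<] (0 : ℝ), g t ∉ A := by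
  induction hA with
  | pos f => exact eventually_pos_or_left_of_analyticAt (analyticAt_eval hg f)
  | compl A _ ih =>
    rcases ih with h | h
    · right
      filter_upwards [h] with t ht
      simpa using ht
    · left
      exact h
  | inter A B _ _ ihA ihB =>
    rcases ihA with h | h
    · rcases ihB with h' | h'
      · left
        filter_upwards [h, h'] with t h1 h2
        exact ⟨h1, h2⟩
      · right
        filter_upwards [h'] with t h2 h3
        exact h2 h3.2
    · right
      filter_upwards [h] with t h2 h3
      exact h2 h3.1

/-- The condition of arc-symmetry for germs of arcs in homogeneous coordinates. -/
def GermClosed (X : Set (RP n)) : Prop :=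
  ∀ g : ℝ → Fin (n + 1) → ℝ, AnalyticAt ℝ g 0 → g 0 ≠ 0 → (∀ᶠ t in 𝓝[<] (0 : ℝ), g t ∈ cone X) →
    ∀ᶠ t in 𝓝[>] (0 : ℝ), g t ∈ cone X

theorem exists_Ioo_of_eventually {P : ℝ → Prop} (h : ∀ᶠ t in 𝓝 (0 : ℝ), P t) :
    ∃ ε > 0, ∀ t ∈ Set.Ioo (-ε) ε, P t := by
  obtain ⟨ε, hε, h⟩ := Metric.eventually_nhds_iff.1 h
  refine ⟨ε, hε, fun t ht => h ?_⟩
  rw [Real.dist_eq, sub_zero, abs_lt]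
  exact ht

/-- A germ is analytic with nonzero values on some interval of radius `ε`. Rescaling by `ε` turns it
into an arc on the whole interval required by the definition. -/
theorem IsArcSymmetric.germClosed {X : Set (RP n)} (hX : IsArcSymmetric X) : GermClosed X := by
  intro g hg h0 hleft
  have hev : ∀ᶠ t in 𝓝 (0 : ℝ), AnalyticAt ℝ g t ∧ g t ≠ 0 ∧ (t < 0 → g t ∈ cone X) :=
    hg.eventually_analyticAt.and ((hg.continuousAt.eventually_ne h0).and
      (eventually_nhdsWithin_iff.1 hleft))
  obtain ⟨ε, hε, h⟩ := exists_Ioo_of_eventually hev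
  have hscale : ∀ t ∈ Set.Ioo (-1 : ℝ) 1, ε * t ∈ Set.Ioo (-ε) ε := by
    intro t ht
    constructor <;> nlinarith [ht.1, ht.2]
  classical
  let γ : ℝ → RP n := fun t => if h : g (ε * t) ≠ 0 then Projectivization.mk ℝ _ h else
    Projectivization.mk ℝ (g 0) h0
  have hγ : ∀ t ∈ Set.Ioo (-1 : ℝ) 1, ∃ h : g (ε * t) ≠ 0, γ t = Projectivization.mk ℝ _ h := by
    intro t ht
    have hne := (h _ (hscale t ht)).2.1
    exact ⟨hne, dif_pos hne⟩
  have harc : IsAnalyticArc γ := by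
    intro t ht
    refine ⟨fun s => g (ε * s), ?_, ?_⟩
    · have h1 := (h _ (hscale t ht)).1
      exact h1.comp (f := fun s => ε * s) (analyticAt_const.mul analyticAt_id)
    · filter_upwards [isOpen_Ioo.mem_nhds ht] with s hs using hγ s hs
  obtain ⟨δ, hδ, hδX⟩ := hX.arc γ harc fun t ht => by
    obtain ⟨h1, h2⟩ := hγ t ⟨ht.1, ht.2.trans one_pos⟩
    rw [h2, ← mem_cone_iff]
    exact (h _ (hscale t ⟨ht.1, ht.2.trans one_pos⟩)).2.2 (mul_neg_of_pos_of_neg hε ht.2)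
  have : Set.Ioo 0 (ε * min δ 1) ∈ 𝓝[>] (0 : ℝ) := Ioo_mem_nhdsGT (by positivity)
  filter_upwards [this] with t ht
  have ht' : t = ε * (t / ε) := by field_simp
  have h1 : 0 < t / ε := div_pos ht.1 hε
  have h2 : t / ε < min δ 1 := by
    rw [div_lt_iff₀ hε, mul_comm]
    exact ht.2
  obtain ⟨h3, h4⟩ := hγ (t / ε) ⟨by linarith, h2.trans_le (min_le_right _ _)⟩
  have h5 := hδX (t / ε) ⟨h1, h2.trans_le (min_le_left _ _)⟩
  rw [h4, ← mem_cone_iff, ← ht'] at h5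
  exact h5

theorem IsArcSymmetric.of_germClosed {X : Set (RP n)} (hX : IsSemialgebraic (cone X))
    (h : GermClosed X) : IsArcSymmetric X := by
  refine ⟨hX, fun γ hγ hleft => ?_⟩
  obtain ⟨g, hg, hev⟩ := hγ 0 (by simp)
  obtain ⟨h0, -⟩ := hev.self_of_nhds
  have h1 : ∀ᶠ t in 𝓝[<] (0 : ℝ), g t ∈ cone X := by
    have : Set.Ioo (-1 : ℝ) 0 ∈ 𝓝[<] (0 : ℝ) := Ioo_mem_nhdsLT (by norm_num)
    filter_upwards [this, hev.filter_mono nhdsWithin_le_nhds] with t ht ht'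
    obtain ⟨h2, h3⟩ := ht'
    rw [mem_cone_iff h2, ← h3]
    exact hleft t ht
  have h2 : ∀ᶠ t in 𝓝[>] (0 : ℝ), γ t ∈ X := by
    filter_upwards [h g hg h0 h1, hev.filter_mono nhdsWithin_le_nhds] with t ht ht'
    obtain ⟨h2, h3⟩ := ht'
    rw [h3]
    exact mk_mem_of_mem_cone ht h2
  obtain ⟨ε, hε, h3⟩ := (mem_nhdsGT_iff_exists_Ioo_subset' (one_pos)).1 h2
  exact ⟨ε, hε, h3⟩

theorem cone_union (X Y : Set (RP n)) : cone (X ∪ Y) = cone X ∪ cone Y := by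
  ext v
  by_cases hv : v = 0
  · subst hv
    exact ⟨fun h => (h.1 rfl).elim, fun h => h.elim (fun h => (h.1 rfl).elim)
      fun h => (h.1 rfl).elim⟩
  · rw [Set.mem_union, mem_cone_iff hv, mem_cone_iff hv, mem_cone_iff hv]
    rfl

theorem cone_inter (X Y : Set (RP n)) : cone (X ∩ Y) = cone X ∩ cone Y := by
  ext v
  exact ⟨fun h => ⟨⟨h.1, h.2.1⟩, ⟨h.1, h.2.2⟩⟩, fun h => ⟨h.1.1, h.1.2, h.2.2⟩⟩

theorem cone_empty : cone (∅ : Set (RP n)) = ∅ := by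
  ext v
  exact ⟨fun h => h.2.elim, fun h => h.elim⟩

theorem isArcSymmetric_empty : IsArcSymmetric (∅ : Set (RP n)) := by
  refine .of_germClosed (by rw [cone_empty]; exact isSemialgebraic_empty) fun g _ _ h => ?_
  obtain ⟨t, ht⟩ := h.exists
  rw [cone_empty] at ht
  exact ht.elim

theorem IsArcSymmetric.inter {X Y : Set (RP n)} (hX : IsArcSymmetric X) (hY : IsArcSymmetric Y) :
    IsArcSymmetric (X ∩ Y) := by
  refine .of_germClosed ?_ fun g hg h0 h => ?_
  · rw [cone_inter]
    exact hX.semialgebraic.inter _ _ hY.semialgebraic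
  · rw [cone_inter] at h ⊢
    exact (hX.germClosed g hg h0 (h.mono fun t ht => ht.1)).and
      (hY.germClosed g hg h0 (h.mono fun t ht => ht.2))

/-- The left half of an arc in the union could a priori alternate between the two sets. An analytic
germ is eventually inside or eventually outside a semi-algebraic set, so a single one of them
contains it. -/
theorem IsArcSymmetric.union {X Y : Set (RP n)} (hX : IsArcSymmetric X) (hY : IsArcSymmetric Y) :
    IsArcSymmetric (X ∪ Y) := by
  refine .of_germClosed ?_ fun g hg h0 h => ?_
  · rw [cone_union]
    exact hX.semialgebraic.union hY.semialgebraic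
  · rw [cone_union] at h ⊢
    rcases hX.semialgebraic.eventually_mem_or hg with h1 | h1
    · exact (hX.germClosed g hg h0 h1).mono fun t ht => Or.inl ht
    · have h2 : ∀ᶠ t in 𝓝[<] (0 : ℝ), g t ∈ cone Y := by
        filter_upwards [h, h1] with t ht ht'
        exact ht.resolve_left ht'
      exact (hY.germClosed g hg h0 h2).mono fun t ht => Or.inr ht

/-! ### Irreducible components -/

theorem IsClosedArcSymmetricIn.subset {Y X : Set (RP n)} (h : IsClosedArcSymmetricIn Y X) :
    Y ⊆ X := by
  obtain ⟨-, K, -, rfl⟩ := h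
  exact Set.inter_subset_left

theorem IsClosedArcSymmetricIn.union {Y Z X : Set (RP n)} (hY : IsClosedArcSymmetricIn Y X)
    (hZ : IsClosedArcSymmetricIn Z X) : IsClosedArcSymmetricIn (Y ∪ Z) X := by
  refine ⟨hY.1.union hZ.1, ?_⟩
  obtain ⟨-, K, hK, rfl⟩ := hY
  obtain ⟨-, L, hL, rfl⟩ := hZ
  exact ⟨K ∪ L, hK.union hL, (Set.inter_union_distrib_left _ _ _).symm⟩

theorem isClosedArcSymmetricIn_sUnion {X : Set (RP n)} {S : Set (Set (RP n))} (hS : S.Finite)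
    (h : ∀ C ∈ S, IsClosedArcSymmetricIn C X) : IsClosedArcSymmetricIn (⋃₀ S) X := by
  induction S, hS using Set.Finite.induction_on with
  | empty =>
    rw [Set.sUnion_empty]
    exact ⟨isArcSymmetric_empty, ∅, isClosed_empty, by simp⟩
  | insert _ _ ih =>
    rw [Set.sUnion_insert]
    exact (h _ (Set.mem_insert _ _)).union (ih fun C hC => h C (Set.mem_insert_of_mem _ hC))

theorem IsClosedArcSymmetricIn.inter_of_subset {Y D X : Set (RP n)}
    (hY : IsClosedArcSymmetricIn Y X) (hD : IsArcSymmetric D) (hDX : D ⊆ X) :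
    IsClosedArcSymmetricIn (D ∩ Y) D := by
  refine ⟨hD.inter hY.1, ?_⟩
  obtain ⟨-, K, hK, rfl⟩ := hY
  exact ⟨K, hK, by rw [← Set.inter_assoc, Set.inter_eq_left.2 hDX]⟩

theorem IsIrreducibleArcSymmetric.subset_of_subset_sUnion {D X : Set (RP n)}
    (hD : IsIrreducibleArcSymmetric D) (hDX : D ⊆ X) {S : Set (Set (RP n))} (hS : S.Finite)
    (h : ∀ C ∈ S, IsClosedArcSymmetricIn C X) (hsub : D ⊆ ⋃₀ S) : ∃ C ∈ S, D ⊆ C := by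
  induction S, hS using Set.Finite.induction_on with
  | empty =>
    obtain ⟨x, hx⟩ := hD.nonempty
    simpa using hsub hx
  | @insert C S _ hSfin ih =>
    have h1 := (h C (Set.mem_insert _ _)).inter_of_subset hD.arcSymmetric hDX
    have h2 := (isClosedArcSymmetricIn_sUnion hSfin fun C hC =>
      h C (Set.mem_insert_of_mem _ hC)).inter_of_subset hD.arcSymmetric hDX
    rw [Set.sUnion_insert] at hsub
    rcases hD.irreducible _ _ h1 h2
      (by rw [← Set.inter_union_distrib_left, Set.inter_eq_left.2 hsub]) with h3 | h3
    · exact ⟨C, Set.mem_insert _ _, Set.inter_eq_left.1 h3⟩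
    · obtain ⟨C', hC', h4⟩ := ih (fun C hC => h C (Set.mem_insert_of_mem _ hC))
        (Set.inter_eq_left.1 h3)
      exact ⟨C', Set.mem_insert_of_mem _ hC', h4⟩

/-- The pieces of a nonsingular arc-symmetric set are its irreducible components. -/
theorem isIrreducibleComponent_iff_mem {X : Set (RP n)} {S : Set (Set (RP n))} (hS : S.Finite)
    (hdisj : S.PairwiseDisjoint id) (hU : ⋃₀ S = X)
    (h : ∀ C ∈ S, IsNonsingularIrreducible C ∧ IsClosedArcSymmetricIn C X) {C : Set (RP n)} :
    IsIrreducibleComponent C X ↔ C ∈ S := by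
  have key : ∀ D, IsIrreducibleArcSymmetric D → IsClosedArcSymmetricIn D X → ∃ C ∈ S, D ⊆ C :=
    fun D hD hDX => hD.subset_of_subset_sUnion hDX.subset hS (fun C hC => (h C hC).2)
      (hU ▸ hDX.subset)
  constructor
  · rintro ⟨⟨h1, h2⟩, hmax⟩
    obtain ⟨C', hC', hsub⟩ := key C h1 h2
    have := hmax ⟨(h C' hC').1.1, (h C' hC').2⟩ hsub
    rwa [Set.Subset.antisymm hsub this]
  · intro hC
    refine ⟨⟨(h C hC).1.1, (h C hC).2⟩, ?_⟩
    rintro D ⟨h1, h2⟩ hCD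
    obtain ⟨C', hC', hsub⟩ := key D h1 h2
    obtain ⟨x, hx⟩ := (h C hC).1.1.nonempty
    have : C = C' := by
      by_contra hne
      exact Set.disjoint_left.1 (hdisj hC hC' hne) hx (hsub (hCD hx))
    rw [this]
    exact hsub

theorem IsClosedArcSymmetricIn.isCompact {Y X : Set (RP n)} (h : IsClosedArcSymmetricIn Y X)
    (hX : IsCompact X) : IsCompact Y := by
  obtain ⟨-, K, hK, rfl⟩ := h
  exact hX.inter_right hK

/-- The union of the finitely many other pieces is compact and does not contain `x`, so every piece
is open in `X`. -/
theorem eventually_mem_component {X : Set (RP n)} (hX : IsCompact X) {S : Set (Set (RP n))}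
    (hS : S.Finite) (hdisj : S.PairwiseDisjoint id) (hU : ⋃₀ S = X)
    (h : ∀ C ∈ S, IsClosedArcSymmetricIn C X) {C : Set (RP n)} (hC : C ∈ S) {x : RP n}
    (hx : x ∈ C) : ∀ᶠ y in 𝓝 x, y ∈ X → y ∈ C := by
  have h1 : IsClosed (⋃₀ (S \ {C})) :=
    ((isClosedArcSymmetricIn_sUnion (hS.subset Set.sdiff_subset)
      fun C hC => h C hC.1).isCompact hX).isClosed
  have h2 : x ∉ ⋃₀ (S \ {C}) := by
    rintro ⟨C', ⟨hC', hne⟩, hx'⟩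
    exact Set.disjoint_left.1 (hdisj hC hC' fun h => hne h.symm) hx hx'
  filter_upwards [h1.isOpen_compl.mem_nhds h2] with y hy hyX
  rw [← hU] at hyX
  obtain ⟨C', hC', hy'⟩ := hyX
  by_contra hyC
  refine hy ⟨C', ⟨hC', fun h => hyC ?_⟩, hy'⟩
  rw [← (h : C' = C)]
  exact hy'

end

/-! ### Lifting arcs from the quotient -/

section

variable {n m : ℕ}

theorem mem_cone_of_isClosed {Y : Set (RP n)} (hY : IsClosed Y) {l : Filter ℝ} [l.NeBot]
    {g : ℝ → Fin (n + 1) → ℝ} {v : Fin (n + 1) → ℝ} (hv : v ≠ 0) (hg : Tendsto g l (𝓝 v))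
    (h : ∀ᶠ t in l, g t ∈ cone Y) : v ∈ cone Y := by
  by_contra hn
  rw [mem_cone_iff hv] at hn
  have h1 : ∀ᶠ y in 𝓝 (Projectivization.mk ℝ v hv), y ∉ Y := hY.isOpen_compl.mem_nhds hn
  rw [eventually_nhds_mk] at h1
  obtain ⟨t, ht, ht'⟩ := (h.and (hg.eventually h1)).exists
  exact ht' (ne_zero_of_mem_cone ht) (mk_mem_of_mem_cone ht _)

theorem eventually_zero_of_left {f : ℝ → ℝ} (hf : AnalyticAt ℝ f 0)
    (h : ∀ᶠ t in 𝓝[<] (0 : ℝ), f t = 0) : ∀ᶠ t in 𝓝 (0 : ℝ), f t = 0 :=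
  hf.frequently_zero_iff_eventually_zero.1
    (h.frequently.filter_mono (nhdsWithin_mono _ fun _ ht => ne_of_lt ht))

theorem analyticAt_sqrt {f : ℝ → ℝ} {t : ℝ} (hf : AnalyticAt ℝ f t) (h : 0 < f t) :
    AnalyticAt ℝ (fun s => √(f s)) t := by
  have h1 : AnalyticAt ℝ (fun x : ℝ => √x) (f t) := by
    exact (Real.contDiffAt_sqrt (n := ⊤) h.ne').analyticAt
  exact h1.comp hf

theorem analyticAt_nsq {k : ℕ} {g : ℝ → Fin k → ℝ} {t : ℝ} (hg : AnalyticAt ℝ g t) :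
    AnalyticAt ℝ (fun s => nsq (g s)) t := by
  simpa using analyticAt_eval hg (nsqPoly k)

variable {V X X' : Set (RP n)} {σ : RP n → RP n} {p : RP n → RP m}

/-- Preimages under the quotient map of points close to `p x` can be chosen close to `x`. -/
theorem IsQuotientMap.eventually_exists_lift (hp : IsQuotientMap V σ p)
    (hσ : IsRegularMapOn V σ) (hinv : ∀ x ∈ V, σ (σ x) = x) (hmaps : Set.MapsTo σ V V)
    (hX'V : X' ⊆ V) (hX' : IsCompact X') (hXX' : X ⊆ X') (hXσ : Set.MapsTo σ X X)
    {G : ℝ → Fin (m + 1) → ℝ} {l : Filter ℝ} {u : Fin (m + 1) → ℝ} (hu : u ≠ 0)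
    (hG : Tendsto G l (𝓝 u)) (hl : ∀ᶠ t in l, G t ∈ cone (p '' X)) {x : RP n} (hx : x ∈ X')
    (hpx : p x = Projectivization.mk ℝ u hu) {P : RP n → Prop} (hP : ∀ᶠ y in 𝓝 x, P y) :
    ∀ᶠ t in l, ∃ y ∈ X, P y ∧ ∃ h : G t ≠ 0, p y = Projectivization.mk ℝ (G t) h := by
  obtain ⟨U, hUP, hUo, hxU⟩ := mem_nhds_iff.1 hP
  -- The points `y` of `X'` for which neither `y` nor `σ y` lies in `U` form a compact set. Its
  -- image is closed and misses `p x`, so over points close to `p x` every orbit in `X` meets `U`.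
  have hK : IsClosed (X' ∩ σ ⁻¹' Uᶜ) :=
    (hσ.continuousOn.mono hX'V).preimage_isClosed_of_isClosed hX'.isClosed hUo.isClosed_compl
  have hK' : IsCompact (X' ∩ σ ⁻¹' Uᶜ ∩ Uᶜ) :=
    (hX'.of_isClosed_subset hK Set.inter_subset_left).inter_right hUo.isClosed_compl
  have hpK : IsClosed (p '' (X' ∩ σ ⁻¹' Uᶜ ∩ Uᶜ)) :=
    (hK'.image_of_continuousOn (hp.regular.continuousOn.mono fun y hy => hX'V hy.1.1)).isClosed
  have hn : Projectivization.mk ℝ u hu ∉ p '' (X' ∩ σ ⁻¹' Uᶜ ∩ Uᶜ) := by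
    rintro ⟨y, ⟨⟨hy, h1⟩, h2⟩, hpy⟩
    rw [← hpx] at hpy
    rcases (hp.fibres x (hX'V hx) y (hX'V hy)).1 hpy.symm with rfl | rfl
    · exact h2 hxU
    · refine h1 ?_
      rw [hinv x (hX'V hx)]
      exact hxU
  have hev : ∀ᶠ y in 𝓝 (Projectivization.mk ℝ u hu), y ∉ p '' (X' ∩ σ ⁻¹' Uᶜ ∩ Uᶜ) :=
    hpK.isOpen_compl.mem_nhds hn
  rw [eventually_nhds_mk] at hev
  filter_upwards [hG.eventually hev, hl] with t h1 h2
  have hGt := ne_zero_of_mem_cone h2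
  obtain ⟨y, hy, hpy⟩ := mk_mem_of_mem_cone h2 hGt
  by_cases hyU : y ∈ U
  · exact ⟨y, hy, hUP hyU, hGt, hpy⟩
  · have hyV := hX'V (hXX' hy)
    refine ⟨σ y, hXσ hy, hUP ?_, hGt, ?_⟩
    · by_contra hσU
      exact h1 hGt ⟨y, ⟨⟨hXX' hy, hσU⟩, hyU⟩, hpy⟩
    · rw [← hpy]
      exact ((hp.fibres y hyV _ (hmaps hyV)).2 (Or.inr rfl)).symm

/-- If the involution is locally trivial around its fixed points, the quotient is
arc-symmetric. -/
theorem IsQuotientMap.isArcSymmetric_image (hp : IsQuotientMap V σ p) (hV : IsCompact V)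
    (hσ : IsRegularMapOn V σ) (hinv : ∀ x ∈ V, σ (σ x) = x) (hmaps : Set.MapsTo σ V V)
    (hX'V : X' ⊆ V) (hX' : IsCompact X') (hXX' : X ⊆ X') (hXσ : Set.MapsTo σ X X)
    (hX : IsArcSymmetric X)
    (hfix : ∀ x ∈ X', σ x = x → ∀ᶠ y in 𝓝 x, y ∈ X' → σ y = y) :
    IsArcSymmetric (p '' X) := by
  refine .of_germClosed (hp.isSemialgebraic_image hV hσ hinv hmaps (hXX'.trans hX'V) hXσ
    hX.semialgebraic) fun G hG hG0 hleft => ?_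
  obtain ⟨PA, PB, hP⟩ := hp.regular.exists_global hV
  obtain ⟨A, B, hAB⟩ := hp.exists_invariants hV hσ hinv
  have hGl : Tendsto G (𝓝[<] 0) (𝓝 (G 0)) := hG.continuousAt.tendsto.mono_left nhdsWithin_le_nhds
  have hpX' : IsClosed (p '' X') :=
    (hX'.image_of_continuousOn (hp.regular.continuousOn.mono hX'V)).isClosed
  -- The limit of the arc has a preimage in the compact set `X'`. It need not belong to `X`.
  obtain ⟨x, hx, hpx⟩ := mk_mem_of_mem_cone (mem_cone_of_isClosed hpX' hG0 hGl
    (hleft.mono fun t ht => cone_mono (Set.image_mono hXX') ht)) hG0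
  obtain ⟨i, hi⟩ := exists_emb_pos x
  have hcont : ∀ᶠ y in 𝓝 x, emb y i i ≠ 0 := by
    have : Continuous fun y : RP n => emb y i i :=
      (continuous_apply i).comp ((continuous_apply i).comp continuous_emb)
    exact this.continuousAt.eventually_ne hi.ne'
  obtain ⟨w, hw, hw0, hwleft⟩ : ∃ w : ℝ → Fin (n + 1) → ℝ, AnalyticAt ℝ w 0 ∧ w 0 ≠ 0 ∧
      ∀ᶠ t in 𝓝[<] (0 : ℝ), ∃ y ∈ X, (∃ h : G t ≠ 0, p y = Projectivization.mk ℝ (G t) h) ∧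
        emb y i i ≠ 0 ∧ ∃ c : ℝ, c ≠ 0 ∧ w t = c • emb y i := by
    obtain ⟨hB0, hA0⟩ := hAB x (hX'V hx) _ hG0 hpx
    by_cases hodd : oddPart σ x = 0
    · have key : ∀ y u, σ y = y → (∀ c, eval u (A c) = invariantVec σ y c * eval u B) →
          (fun j => eval u (A (Sum.inl (i, j)))) = (2 * eval u B) • emb y i := by
        intro y u hy hA
        ext j
        simp only [hA, invariantVec, Sum.elim_inl, evenPart, hy, Pi.smul_apply, smul_eq_mul]
        ring
      have hσx := oddPart_eq_zero_iff.1 hodd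
      refine ⟨fun t j => eval (G t) (A (Sum.inl (i, j))),
        analyticAt_pi_iff.2 fun j => analyticAt_eval hG _, ?_, ?_⟩
      · beta_reduce
        rw [key x _ hσx hA0]
        exact smul_ne_zero (by positivity) (emb_row_ne_zero hi.ne')
      · filter_upwards [hp.eventually_exists_lift hσ hinv hmaps hX'V hX' hXX' hXσ hG0 hGl hleft hx
          hpx (hcont.and (hfix x hx hσx))] with t ht
        obtain ⟨y, hy, ⟨hy1, hy2⟩, h, hpy⟩ := ht
        obtain ⟨hB, hA⟩ := hAB y (hX'V (hXX' hy)) _ h hpy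
        exact ⟨y, hy, ⟨h, hpy⟩, hy1, 2 * eval (G t) B, by positivity,
          key y _ (hy2 (hXX' hy)) hA⟩
    -- Some odd function is nonzero at `x`, so the radicand is positive at `0` and the root is
    -- analytic. The sign of this odd function is constant near `x` and selects the preimage close
    -- to `x`.
    · obtain ⟨k, hk⟩ := Function.ne_iff.1 hodd
      have hk : oddPart σ x k ≠ 0 := hk
      have hsign : ∀ᶠ y in 𝓝 x, y ∈ V →
          SignType.sign (oddPart σ y k) = SignType.sign (oddPart σ x k) := by
        have hc := (isRegularFunctionOn_oddPart hσ k).continuousOn x (hX'V hx)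
        rw [← eventually_inf_principal]
        rcases lt_or_gt_of_ne hk with hlt | hgt
        · filter_upwards [hc.eventually (eventually_lt_nhds hlt)] with y hy
          rw [sign_neg hy, sign_neg hlt]
        · filter_upwards [hc.eventually (eventually_gt_nhds hgt)] with y hy
          rw [sign_pos hy, sign_pos hgt]
      have key : ∀ y u, SignType.sign (oddPart σ y k) = SignType.sign (oddPart σ x k) →
          0 < eval u B → (∀ c, eval u (A c) = invariantVec σ y c * eval u B) →
          oddPart σ y k ≠ 0 ∧ (fun j => eval u (A (Sum.inr (k, k))) * eval u (A (Sum.inl (i, j))) +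
            SignType.sign (oddPart σ x k) * (eval u (A (Sum.inr (k, (i, j)))) *
            √(eval u (A (Sum.inr (k, k))) * eval u B))) =
            (2 * eval u B ^ 2 * oddPart σ y k ^ 2) • emb y i := by
        intro y u hs hB hA
        have hyk : oddPart σ y k ≠ 0 := by
          rw [← sign_ne_zero, hs, sign_ne_zero]
          exact hk
        refine ⟨hyk, ?_⟩
        ext j
        rw [← hs]
        exact lift_eq hB (A := fun c => eval u (A c)) hA hyk (i, j)
      refine ⟨fun t j => eval (G t) (A (Sum.inr (k, k))) * eval (G t) (A (Sum.inl (i, j))) +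
            SignType.sign (oddPart σ x k) * (eval (G t) (A (Sum.inr (k, (i, j)))) *
            √(eval (G t) (A (Sum.inr (k, k))) * eval (G t) B)), ?_, ?_, ?_⟩
      · refine analyticAt_pi_iff.2 fun j => ?_
        refine ((analyticAt_eval hG _).mul (analyticAt_eval hG _)).add
          (analyticAt_const.mul ((analyticAt_eval hG _).mul (analyticAt_sqrt
            ((analyticAt_eval hG _).mul (analyticAt_eval hG _)) ?_)))
        simp only [hA0, invariantVec, Sum.elim_inr]
        have := mul_self_pos.2 hk
        positivity
      · beta_reduce
        rw [(key x _ rfl hB0 hA0).2]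
        exact smul_ne_zero (by positivity) (emb_row_ne_zero hi.ne')
      · filter_upwards [hp.eventually_exists_lift hσ hinv hmaps hX'V hX' hXX' hXσ hG0 hGl hleft hx
          hpx (hcont.and hsign)] with t ht
        obtain ⟨y, hy, ⟨hy1, hy2⟩, h, hpy⟩ := ht
        obtain ⟨hB, hA⟩ := hAB y (hX'V (hXX' hy)) _ h hpy
        obtain ⟨h1, h2⟩ := key y _ (hy2 (hX'V (hXX' hy))) hB hA
        exact ⟨y, hy, ⟨h, hpy⟩, hy1, _, by positivity, h2⟩
  have hwX : ∀ᶠ t in 𝓝[<] (0 : ℝ), w t ∈ cone X ∧ ∀ a : Fin (m + 1) × Fin (m + 1),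
      G t a.1 * G t a.2 * eval (w t) PB - nsq (G t) * eval (w t) (PA a) = 0 := by
    filter_upwards [hwleft] with t ht
    obtain ⟨y, hy, ⟨h, hpy⟩, hy1, c, hc, hwt⟩ := ht
    have hmk : ∀ h : w t ≠ 0, Projectivization.mk ℝ (w t) h = y := by
      intro h
      simp only [hwt, mk_smul _ (emb_row_ne_zero hy1) hc, mk_emb_row]
    have hcone : w t ∈ cone X := by
      have hne : w t ≠ 0 := by
        rw [hwt]
        exact smul_ne_zero hc (emb_row_ne_zero hy1)
      rw [mem_cone_iff hne, hmk]
      exact hy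
    refine ⟨hcone, ?_⟩
    obtain ⟨h1, h2⟩ := hP _ (cone_mono (hXX'.trans hX'V) hcone)
    refine mul_eq_mul_emb h h1.ne' fun a => ?_
    rw [← h2 a (ne_zero_of_mem_cone hcone), ← hpy, hmk]
  have hright := hX.germClosed w hw hw0 (hwX.mono fun t ht => ht.1)
  -- That `p` maps the lifted arc to `G` is an identity of analytic functions which holds for `t <
  -- 0`, so it also holds for `t > 0`.
  have hzero : ∀ a : Fin (m + 1) × Fin (m + 1), ∀ᶠ t in 𝓝 (0 : ℝ),
      G t a.1 * G t a.2 * eval (w t) PB - nsq (G t) * eval (w t) (PA a) = 0 := by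
    intro a
    refine eventually_zero_of_left ?_ (hwX.mono fun t ht => ht.2 a)
    exact (((analyticAt_pi_iff.1 hG a.1).mul (analyticAt_pi_iff.1 hG a.2)).mul
      (analyticAt_eval hw _)).sub ((analyticAt_nsq hG).mul (analyticAt_eval hw _))
  have hzero' := (eventually_all.2 hzero).filter_mono (nhdsWithin_le_nhds (s := Set.Ioi (0 : ℝ)))
  have hne := (hG.continuousAt.eventually_ne hG0).filter_mono
    (nhdsWithin_le_nhds (s := Set.Ioi (0 : ℝ)))
  filter_upwards [hright, hzero', hne] with t h1 h2 h3
  have hw0 := ne_zero_of_mem_cone h1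
  obtain ⟨h4, h5⟩ := hP _ (cone_mono (hXX'.trans hX'V) h1)
  refine (mem_cone_iff h3).2 ⟨_, mk_mem_of_mem_cone h1 hw0, ?_⟩
  exact eq_of_mul_eq_mul_emb h3 h4.ne' (fun a => h5 a hw0) h2

end

/-! ### Local charts of real algebraic sets -/

section

variable {N : ℕ}

/-- The gradient of a polynomial. -/
noncomputable def grad (F : MvPolynomial (Fin N) ℝ) (v : Fin N → ℝ) : Fin N → ℝ :=
  fun i => eval v (pderiv i F)

theorem hasFDerivAt_eval (F : MvPolynomial (Fin N) ℝ) (v : Fin N → ℝ) :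
    HasFDerivAt (fun v => eval v F)
      (∑ i, grad F v i • ContinuousLinearMap.proj (R := ℝ) (φ := fun _ : Fin N => ℝ) i) v := by
  classical
  induction F using MvPolynomial.induction_on with
  | C c =>
    simp only [eval_C, grad, pderiv_C, map_zero, zero_smul, Finset.sum_const_zero]
    exact hasFDerivAt_const c v
  | add p q hp hq =>
    convert! hp.add hq using 1
    · ext; simp
    · simp [grad, add_smul, Finset.sum_add_distrib]
  | mul_X p b hp =>
    have h1 : HasFDerivAt (fun v : Fin N → ℝ => v b)
        (ContinuousLinearMap.proj (R := ℝ) (φ := fun _ : Fin N => ℝ) b) v :=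
      (ContinuousLinearMap.proj (R := ℝ) (φ := fun _ : Fin N => ℝ) b).hasFDerivAt
    convert! hp.mul h1 using 1
    · ext; simp
    · ext w
      simp only [grad, Derivation.leibniz, pderiv_X, smul_eq_mul, map_add, map_mul, eval_X,
        sum_apply, add_apply,
        smul_apply, ContinuousLinearMap.proj_apply, Finset.mul_sum, add_mul,
        Finset.sum_add_distrib]
      congr 1
      · rw [Finset.sum_eq_single b]
        · simp
        · intro i _ hi
          simp [hi.symm]
        · simp
      · exact Finset.sum_congr rfl fun i _ => by ring

theorem fderiv_eval_apply (F : MvPolynomial (Fin N) ℝ) (v w : Fin N → ℝ) :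
    fderiv ℝ (fun v => eval v F) v w = grad F v ⬝ᵥ w := by
  rw [(hasFDerivAt_eval F v).fderiv]
  simp [dotProduct]

theorem analyticAt_eval_id (F : MvPolynomial (Fin N) ℝ) (v : Fin N → ℝ) :
    AnalyticAt ℝ (fun v => eval v F) v :=
  analyticAt_eval analyticAt_id F

/-- The analytic inverse function theorem for a system of functions. -/
theorem exists_analytic_inverse {β : Type*} [Fintype β] (hβ : Fintype.card β = N)
    {Φ : β → (Fin N → ℝ) → ℝ} {v₀ : Fin N → ℝ} (hΦ : ∀ j, AnalyticAt ℝ (Φ j) v₀)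
    (hker : ∀ w, (∀ j, fderiv ℝ (Φ j) v₀ w = 0) → w = 0) :
    ∃ Θ : (β → ℝ) → Fin N → ℝ, AnalyticAt ℝ Θ (fun j => Φ j v₀) ∧ Θ (fun j => Φ j v₀) = v₀ ∧
      (∀ᶠ v in 𝓝 v₀, Θ (fun j => Φ j v) = v) ∧
      ∀ᶠ y in 𝓝 (fun j => Φ j v₀), (fun j => Φ j (Θ y)) = y := by
  let Ψ : (Fin N → ℝ) → β → ℝ := fun v j => Φ j v
  have hΨ : AnalyticAt ℝ Ψ v₀ := analyticAt_pi_iff.2 hΦ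
  have hfd : ∀ w j, fderiv ℝ Ψ v₀ w j = fderiv ℝ (Φ j) v₀ w := by
    intro w j
    rw [fderiv_pi fun j => (hΦ j).differentiableAt]
    rfl
  have hinj : Function.Injective (fderiv ℝ Ψ v₀ : (Fin N → ℝ) →ₗ[ℝ] β → ℝ) := by
    rw [injective_iff_map_eq_zero]
    intro w hw
    refine hker w fun j => ?_
    rw [← hfd]
    exact congrFun hw j
  let e : (Fin N → ℝ) ≃L[ℝ] (β → ℝ) :=
    (LinearEquiv.ofInjectiveOfFinrankEq _ hinj (by simp [hβ])).toContinuousLinearEquiv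
  have he : (e : (Fin N → ℝ) →L[ℝ] β → ℝ) = fderiv ℝ Ψ v₀ := by
    ext1
    rfl
  have hd : HasFDerivAt Ψ (e : (Fin N → ℝ) →L[ℝ] β → ℝ) v₀ := by
    rw [he]
    exact hΨ.differentiableAt.hasFDerivAt
  have hc : ContDiffAt ℝ ⊤ Ψ v₀ := hΨ.contDiffAt
  have hs := hc.hasStrictFDerivAt' hd (by simp)
  exact ⟨hc.localInverse hd (by simp), (hc.to_localInverse hd (by simp)).analyticAt,
    hs.localInverse_apply_image, hs.eventually_left_inverse, hs.eventually_right_inverse⟩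

/-- The extension is made on indices and not on vectors, because each added vector has to remember
the coordinate function of which it is the differential. -/
theorem exists_basis_extension {E α ι : Type*} [AddCommGroup E] [Module ℝ E] {f : α → E}
    (hf : LinearIndependent ℝ f) (g : ι → E)
    (hspan : Submodule.span ℝ (Set.range f ∪ Set.range g) = ⊤) :
    ∃ κ : Set ι, LinearIndependent ℝ (Sum.elim f fun k : κ => g k) ∧
      Submodule.span ℝ (Set.range (Sum.elim f fun k : κ => g k)) = ⊤ := by
  have h1 : LinearIndepOn ℝ (Sum.elim f g) (Set.range Sum.inl) := by
    rw [linearIndepOn_range_iff Sum.inl_injective]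
    simpa using hf
  obtain ⟨b, -, hb1, hb2, hb3⟩ := exists_linearIndepOn_extension h1 (Set.subset_univ _)
  let φ : α ⊕ (Sum.inr ⁻¹' b : Set ι) → b := fun s => match s with
    | Sum.inl a => ⟨Sum.inl a, hb1 ⟨a, rfl⟩⟩
    | Sum.inr k => ⟨Sum.inr k.1, k.2⟩
  have hφ : Function.Injective φ := by
    rintro (a | k) (a' | k') h
    · simpa [φ] using h
    · simp [φ] at h
    · simp [φ] at h
    · simpa [φ, Subtype.ext_iff] using h
  have hφe : (fun x : b => Sum.elim f g x) ∘ φ =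
      Sum.elim f fun k : (Sum.inr ⁻¹' b : Set ι) => g k := by
    ext (a | k) <;> rfl
  refine ⟨Sum.inr ⁻¹' b, ?_, ?_⟩
  · rw [← hφe]
    exact LinearIndependent.comp hb3 φ hφ
  · rw [eq_top_iff, ← hspan, Submodule.span_le]
    have h3 : Sum.elim f g '' b ⊆
        Set.range (Sum.elim f fun k : (Sum.inr ⁻¹' b : Set ι) => g k) := by
      rintro _ ⟨a | k, hab, rfl⟩
      · exact ⟨Sum.inl a, rfl⟩
      · exact ⟨Sum.inr ⟨k, hab⟩, rfl⟩
    rw [Set.image_univ, Set.Sum.elim_range] at hb2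
    exact hb2.trans (Submodule.span_mono h3)

theorem span_eq_top_of_dotProduct {E : Set (Fin N → ℝ)}
    (h : ∀ w, (∀ e ∈ E, e ⬝ᵥ w = 0) → w = 0) : Submodule.span ℝ E = ⊤ := by
  by_contra hne
  obtain ⟨f, hf, hfE⟩ := Submodule.exists_le_ker_of_lt_top _ (lt_top_iff_ne_top.2 hne)
  have hrepr : ∀ e, f e = e ⬝ᵥ fun i => f (Pi.single i 1) := by
    intro e
    conv_lhs => rw [← Finset.univ_sum_single e]
    rw [map_sum]
    refine Finset.sum_congr rfl fun i _ => ?_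
    have : Pi.single i (e i) = e i • (Pi.single i 1 : Fin N → ℝ) := by
      rw [← Pi.single_smul, smul_eq_mul, mul_one]
    rw [this, map_smul, smul_eq_mul]
  have h0 := h (fun i => f (Pi.single i 1)) fun e he => by
    rw [← hrepr]
    exact hfE (Submodule.subset_span he)
  refine hf (LinearMap.ext fun e => ?_)
  rw [hrepr, h0]
  simp

theorem eq_zero_of_span_eq_top {E : Set (Fin N → ℝ)} (h : Submodule.span ℝ E = ⊤)
    {w : Fin N → ℝ} (hw : ∀ e ∈ E, e ⬝ᵥ w = 0) : w = 0 := by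
  have : ∀ e ∈ Submodule.span ℝ E, e ⬝ᵥ w = 0 := by
    intro e he
    induction he using Submodule.span_induction with
    | mem x hx => exact hw x hx
    | zero => simp
    | add x y _ _ hx hy => rw [add_dotProduct, hx, hy, add_zero]
    | smul a x _ hx => rw [smul_dotProduct, hx, smul_zero]
  exact dotProduct_self_eq_zero.1 (this w (h ▸ Submodule.mem_top))

end

/-! ### Tangent derivations and the growth of generators of an ideal -/

section

variable {N : ℕ}

/-- The Jacobian matrix of `f` (indexed by `α`) and of the coordinates in `κ`. -/
noncomputable def jacobianMatrix {α : Type*} {κ : Set (Fin N)} (f : α → MvPolynomial (Fin N) ℝ)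
    (e : Fin N ≃ α ⊕ κ) : Matrix (Fin N) (Fin N) (MvPolynomial (Fin N) ℝ) :=
  Matrix.of fun a => Sum.elim (fun j i => pderiv i (f j))
    (fun k => Pi.single k.1 1) (e a)

/-- Polynomials of the ideal expressing that the gradient of `g` is a combination of the
gradients of the polynomials `f`. -/
noncomputable def tangentDerivation {α : Type*} {κ : Set (Fin N)}
    (f : α → MvPolynomial (Fin N) ℝ) (e : Fin N ≃ α ⊕ κ) (g : MvPolynomial (Fin N) ℝ) (k : κ) :
    MvPolynomial (Fin N) ℝ :=
  (jacobianMatrix f e).det *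
    ∑ i, pderiv i g * (jacobianMatrix f e).adjugate i (e.symm (Sum.inr k))

variable {α : Type*} {κ : Set (Fin N)} {f : α → MvPolynomial (Fin N) ℝ} {e : Fin N ≃ α ⊕ κ}

theorem eval_jacobianMatrix_inl (v : Fin N → ℝ) (j : α) :
    (jacobianMatrix f e).map (eval v) (e.symm (Sum.inl j)) = grad (f j) v := by
  ext i
  simp [jacobianMatrix, grad]

theorem eval_jacobianMatrix_inr (v w : Fin N → ℝ) (k : κ) :
    (jacobianMatrix f e).map (eval v) (e.symm (Sum.inr k)) ⬝ᵥ w = w k := by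
  classical
  have : (jacobianMatrix f e).map (eval v) (e.symm (Sum.inr k)) = Pi.single k.1 1 := by
    ext i
    simp only [jacobianMatrix, Matrix.map_apply, Matrix.of_apply, Equiv.apply_symm_apply,
      Sum.elim_inr, Pi.single_apply]
    split_ifs <;> simp
  rw [this, single_dotProduct, one_mul]

theorem eval_adjugate (v : Fin N → ℝ) (i a : Fin N) :
    eval v ((jacobianMatrix f e).adjugate i a) =
      ((jacobianMatrix f e).map (eval v)).adjugate i a := by
  have := RingHom.map_adjugate (eval v) (jacobianMatrix f e)
  exact congrFun (congrFun this i) a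

theorem eval_det (v : Fin N → ℝ) :
    eval v (jacobianMatrix f e).det = ((jacobianMatrix f e).map (eval v)).det :=
  RingHom.map_det (eval v) _

theorem eval_tangentDerivation (v : Fin N → ℝ) (g : MvPolynomial (Fin N) ℝ) (k : κ) :
    eval v (tangentDerivation f e g k) = ((jacobianMatrix f e).map (eval v)).det *
      ∑ i, grad g v i * ((jacobianMatrix f e).map (eval v)).adjugate i (e.symm (Sum.inr k)) := by
  simp only [tangentDerivation, map_mul, map_sum, eval_det, eval_adjugate, grad]

/-- A column of the adjugate with index in `κ` is orthogonal to the rows of the gradients of `f`, by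
the off-diagonal entries of `J * adjugate J`. The factor `det` in `tangentDerivation` handles the
points where the gradients may become dependent. -/
theorem eval_tangentDerivation_eq_zero [Fintype α] {v : Fin N → ℝ} {g : MvPolynomial (Fin N) ℝ}
    (hg : ((jacobianMatrix f e).map (eval v)).det ≠ 0 →
      grad g v ∈ Submodule.span ℝ (Set.range fun j => grad (f j) v)) (k : κ) :
    eval v (tangentDerivation f e g k) = 0 := by
  classical
  rw [eval_tangentDerivation]
  by_cases hdet : ((jacobianMatrix f e).map (eval v)).det = 0
  · rw [hdet, zero_mul]
  · obtain ⟨c, hc⟩ := (Submodule.mem_span_range_iff_exists_fun ℝ).1 (hg hdet)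
    set J := (jacobianMatrix f e).map (eval v) with hJ
    have h1 : ∀ j, ∑ i, grad (f j) v i * J.adjugate i (e.symm (Sum.inr k)) = 0 := by
      intro j
      have h2 : (J * J.adjugate) (e.symm (Sum.inl j)) (e.symm (Sum.inr k)) = 0 := by
        rw [Matrix.mul_adjugate]
        simp
      rw [Matrix.mul_apply] at h2
      rw [← h2]
      refine Finset.sum_congr rfl fun i _ => ?_
      rw [hJ, eval_jacobianMatrix_inl]
    have h3 : ∑ i, grad g v i * J.adjugate i (e.symm (Sum.inr k)) =
        ∑ j, c j * ∑ i, grad (f j) v i * J.adjugate i (e.symm (Sum.inr k)) := by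
      simp only [← hc, Finset.sum_apply, Pi.smul_apply, smul_eq_mul, Finset.sum_mul,
        Finset.mul_sum]
      rw [Finset.sum_comm]
      exact Finset.sum_congr rfl fun j _ => Finset.sum_congr rfl fun i _ => by ring
    rw [h3]
    simp [h1]

/-- The derivative of `g` along a vector tangent to `{f = 0}`. -/
theorem det_sq_mul_dotProduct [Fintype α] [Fintype κ] {v w : Fin N → ℝ}
    (hw : ∀ j, grad (f j) v ⬝ᵥ w = 0) (g : MvPolynomial (Fin N) ℝ) :
    ((jacobianMatrix f e).map (eval v)).det ^ 2 * (grad g v ⬝ᵥ w) =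
      ∑ k : κ, eval v (tangentDerivation f e g k) * w k := by
  classical
  simp only [eval_tangentDerivation]
  set J := (jacobianMatrix f e).map (eval v) with hJ
  -- This is Cramer's rule: `J` sends a vector tangent to `{f = 0}` to zero in the entries from `α`
  -- and to the coordinates of `w` in the entries from `κ`.
  have h1 : ∀ i, J.det * w i = ∑ k : κ, J.adjugate i (e.symm (Sum.inr k)) * w k := by
    intro i
    have h2 : J.adjugate.mulVec (J.mulVec w) = J.det • w := by
      rw [Matrix.mulVec_mulVec, Matrix.adjugate_mul, Matrix.smul_mulVec, Matrix.one_mulVec]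
    have h3 := congrFun h2 i
    rw [Pi.smul_apply, smul_eq_mul] at h3
    rw [← h3]
    change ∑ a, J.adjugate i a * (J.mulVec w) a = _
    rw [← Equiv.sum_comp e.symm, Fintype.sum_sum_type]
    have h4 : ∀ j, J.mulVec w (e.symm (Sum.inl j)) = 0 := by
      intro j
      rw [← hw j, ← eval_jacobianMatrix_inl (f := f) (e := e)]
      rfl
    have h5 : ∀ k : κ, J.mulVec w (e.symm (Sum.inr k)) = w k := by
      intro k
      rw [← eval_jacobianMatrix_inr (f := f) (e := e) v w k]
      rfl
    simp only [h4, h5, mul_zero, Finset.sum_const_zero, zero_add]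
  have h6 : J.det ^ 2 * (grad g v ⬝ᵥ w) = J.det * ∑ i, grad g v i * (J.det * w i) := by
    rw [dotProduct, sq, mul_assoc, Finset.mul_sum]
    congr 1
    exact Finset.sum_congr rfl fun i _ => by ring
  rw [h6]
  simp only [h1, Finset.mul_sum, Finset.sum_mul]
  rw [Finset.sum_comm]
  exact Finset.sum_congr rfl fun k _ => Finset.sum_congr rfl fun i _ => by ring

/-- Near a point, an element of the ideal generated by a finite set is bounded by the
generators. -/
theorem exists_bound_of_mem_span {S : Finset (MvPolynomial (Fin N) ℝ)}
    {h : MvPolynomial (Fin N) ℝ} (hh : h ∈ Ideal.span (S : Set (MvPolynomial (Fin N) ℝ)))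
    (v₀ : Fin N → ℝ) :
    ∃ K : ℝ, 0 ≤ K ∧ ∀ᶠ v in 𝓝 v₀, |eval v h| ≤ K * ‖fun g : S => eval v g.1‖ := by
  induction hh using Submodule.span_induction with
  | mem x hx =>
    refine ⟨1, zero_le_one, Eventually.of_forall fun v => ?_⟩
    rw [one_mul]
    exact norm_le_pi_norm (fun g : S => eval v g.1) ⟨x, hx⟩
  | zero => exact ⟨0, le_rfl, by simp⟩
  | add x y _ _ hx hy =>
    obtain ⟨K, hK, h1⟩ := hx
    obtain ⟨L, hL, h2⟩ := hy
    refine ⟨K + L, add_nonneg hK hL, ?_⟩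
    filter_upwards [h1, h2] with v h3 h4
    rw [map_add, add_mul]
    exact (abs_add_le _ _).trans (add_le_add h3 h4)
  | smul a x _ hx =>
    obtain ⟨K, hK, h1⟩ := hx
    have hc : ContinuousAt (fun v => |eval v a|) v₀ :=
      (MvPolynomial.continuous_eval a).abs.continuousAt
    refine ⟨(|eval v₀ a| + 1) * K, by positivity, ?_⟩
    filter_upwards [h1, hc.eventually_lt continuousAt_const (lt_add_one _)] with v h3 h4
    rw [smul_eq_mul, map_mul, abs_mul, mul_assoc]
    exact mul_le_mul h4.le h3 (abs_nonneg _) (by positivity)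

/-- The set of gradients at `v` of the elements of an ideal. -/
def gradSet (I : Ideal (MvPolynomial (Fin N) ℝ)) (v : Fin N → ℝ) : Set (Fin N → ℝ) :=
  {w | ∃ F ∈ I, w = grad F v}

/-- Maximality of the rank forces the gradients of `f` to span all gradients of the ideal at the
points of `Z` where the determinant is nonzero. The polynomials `tangentDerivation` therefore vanish
on `Z` and belong to `I`. As combinations of the generators they are bounded by them near `v₀`, and
they express the derivatives of the generators along tangent vectors. -/
theorem eventually_norm_deriv_le {I : Ideal (MvPolynomial (Fin N) ℝ)} {Z : Set (Fin N → ℝ)}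
    (hI : ∀ F, F ∈ I ↔ ∀ v ∈ Z, eval v F = 0) {v₀ : Fin N → ℝ}
    (hrank : ∀ v ∈ Z, Module.finrank ℝ (Submodule.span ℝ (gradSet I v)) ≤
      Module.finrank ℝ (Submodule.span ℝ (gradSet I v₀)))
    [Fintype α] [Fintype κ] (hfI : ∀ j, f j ∈ I)
    (hcard : Fintype.card α = Module.finrank ℝ (Submodule.span ℝ (gradSet I v₀)))
    (hdet : ((jacobianMatrix f e).map (eval v₀)).det ≠ 0)
    {S : Finset (MvPolynomial (Fin N) ℝ)} (hS : Ideal.span (S : Set (MvPolynomial (Fin N) ℝ)) = I) :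
    ∃ K : ℝ, 0 ≤ K ∧ ∀ᶠ v in 𝓝 v₀, ∀ w, (∀ j, grad (f j) v ⬝ᵥ w = 0) →
      ∀ g : S, |grad g.1 v ⬝ᵥ w| ≤ K * ‖w‖ * ‖fun g : S => eval v g.1‖ := by
  classical
  have hmem : ∀ g ∈ I, ∀ k : κ, tangentDerivation f e g k ∈ I := by
    intro g hg k
    rw [hI]
    intro v hv
    refine eval_tangentDerivation_eq_zero (fun hd => ?_) k
    have hli : LinearIndependent ℝ fun j => grad (f j) v := by
      have h1 : LinearIndependent ℝ ((jacobianMatrix f e).map (eval v)).row :=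
        Matrix.linearIndependent_rows_of_det_ne_zero hd
      have h2 := h1.comp (fun j => e.symm (Sum.inl j))
        (e.symm.injective.comp Sum.inl_injective)
      convert! h2 using 1
      ext1 j
      exact (eval_jacobianMatrix_inl v j).symm
    have hle : Submodule.span ℝ (Set.range fun j => grad (f j) v) ≤
        Submodule.span ℝ (gradSet I v) := by
      refine Submodule.span_mono ?_
      rintro _ ⟨j, rfl⟩
      exact ⟨f j, hfI j, rfl⟩
    have heq := Submodule.eq_of_le_of_finrank_le hle (by
      rw [finrank_span_eq_card hli, hcard]
      exact hrank v hv)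
    rw [heq]
    exact Submodule.subset_span ⟨g, hg, rfl⟩
  have hb : ∀ (g : S) (k : κ), ∃ K : ℝ, 0 ≤ K ∧ ∀ᶠ v in 𝓝 v₀,
      |eval v (tangentDerivation f e g.1 k)| ≤ K * ‖fun g : S => eval v g.1‖ := by
    intro g k
    refine exists_bound_of_mem_span ?_ v₀
    rw [hS]
    exact hmem _ (hS ▸ Ideal.subset_span g.2) k
  choose K hK hKb using hb
  have hdetc : ContinuousAt (fun v => ((jacobianMatrix f e).map (eval v)).det ^ 2) v₀ := by
    simp only [← eval_det]
    exact ((MvPolynomial.continuous_eval _).pow 2).continuousAt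
  set c := ((jacobianMatrix f e).map (eval v₀)).det ^ 2 with hc
  have hc0 : 0 < c := by positivity
  refine ⟨(c / 2)⁻¹ * ∑ g : S, ∑ k : κ, K g k, ?_, ?_⟩
  · have : 0 ≤ ∑ g : S, ∑ k : κ, K g k :=
      Finset.sum_nonneg fun g _ => Finset.sum_nonneg fun k _ => hK g k
    positivity
  · filter_upwards [eventually_all.2 fun g => eventually_all.2 (hKb g),
      hdetc.eventually (eventually_gt_nhds (half_lt_self hc0))] with v h1 h2 w hw g
    have h3 := det_sq_mul_dotProduct (e := e) hw g.1
    set γ := ‖fun g : S => eval v g.1‖ with hγ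
    have hγ0 : 0 ≤ γ := norm_nonneg _
    have h4 : |∑ k : κ, eval v (tangentDerivation f e g.1 k) * w k| ≤
        (∑ g : S, ∑ k : κ, K g k) * ‖w‖ * γ := by
      calc |∑ k : κ, eval v (tangentDerivation f e g.1 k) * w k|
          ≤ ∑ k : κ, |eval v (tangentDerivation f e g.1 k) * w k| :=
            Finset.abs_sum_le_sum_abs _ _
        _ ≤ ∑ k : κ, K g k * ‖w‖ * γ := by
            refine Finset.sum_le_sum fun k _ => ?_
            rw [abs_mul]
            calc _ ≤ (K g k * γ) * ‖w‖ := by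
                  refine mul_le_mul (h1 g k) (norm_le_pi_norm w k) (abs_nonneg _)
                    (mul_nonneg (hK g k) hγ0)
              _ = _ := by ring
        _ = (∑ k : κ, K g k) * ‖w‖ * γ := by rw [Finset.sum_mul, Finset.sum_mul]
        _ ≤ _ := by
            gcongr
            exact Finset.single_le_sum (f := fun g : S => ∑ k : κ, K g k)
              (fun g _ => Finset.sum_nonneg fun k _ => hK g k) (Finset.mem_univ g)
    rw [← h3, abs_mul, abs_of_pos ((half_pos hc0).trans h2)] at h4
    have h5 : c / 2 * |grad g.1 v ⬝ᵥ w| ≤ (∑ g : S, ∑ k : κ, K g k) * ‖w‖ * γ :=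
      (mul_le_mul_of_nonneg_right h2.le (abs_nonneg _)).trans h4
    rw [mul_assoc, mul_assoc, ← div_eq_inv_mul, le_div_iff₀' (half_pos hc0), ← mul_assoc]
    exact h5

end

/-! ### Local equations and charts at points of maximal Jacobian rank -/

section

variable {N : ℕ}

theorem card_eq_of_basis {β : Type*} [Fintype β] {D : β → Fin N → ℝ} (hli : LinearIndependent ℝ D)
    (hsp : Submodule.span ℝ (Set.range D) = ⊤) : Fintype.card β = N := by
  have := Module.finrank_eq_card_basis (Module.Basis.mk hli hsp.ge)
  simpa using this.symm

/-- A tangent curve of `{f = 0}` starting in the zero set of an ideal stays there, if the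
derivatives of the generators of the ideal along the curve are bounded by the generators. -/
theorem eval_eq_zero_of_curve {S : Finset (MvPolynomial (Fin N) ℝ)} {K L : ℝ} (hK : 0 ≤ K)
    {c c' : ℝ → Fin N → ℝ} (hc : ∀ t ∈ Set.Icc (0 : ℝ) 1, HasDerivAt c (c' t) t)
    (hc' : ∀ t ∈ Set.Icc (0 : ℝ) 1, ‖c' t‖ ≤ L)
    (hb : ∀ t ∈ Set.Icc (0 : ℝ) 1, ∀ g : S,
      |grad g.1 (c t) ⬝ᵥ c' t| ≤ K * ‖c' t‖ * ‖fun g : S => eval (c t) g.1‖)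
    (h0 : ∀ g : S, eval (c 0) g.1 = 0) (g : S) : eval (c 1) g.1 = 0 := by
  have hd : ∀ t ∈ Set.Icc (0 : ℝ) 1, HasDerivAt (fun t => fun g : S => eval (c t) g.1)
      (fun g : S => grad g.1 (c t) ⬝ᵥ c' t) t := by
    intro t ht
    rw [hasDerivAt_pi]
    intro g
    have h1 := ((hasFDerivAt_eval g.1 (c t)).comp_hasDerivAt t (hc t ht))
    convert! h1 using 1
    simp [dotProduct]
  have h1 := norm_le_gronwallBound_of_norm_deriv_right_le (a := 0) (b := 1) (δ := 0) (ε := 0)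
    (K := K * L) (f := fun t => fun g : S => eval (c t) g.1)
    (f' := fun t => fun g : S => grad g.1 (c t) ⬝ᵥ c' t)
    (fun t ht => (hd t ht).continuousAt.continuousWithinAt)
    (fun t ht => (hd t ⟨ht.1, ht.2.le⟩).hasDerivWithinAt)
    (by
      have : (fun g : S => eval (c 0) g.1) = 0 := by
        ext g
        exact h0 g
      rw [this, norm_zero])
    (fun t ht => by
      have ht' : t ∈ Set.Icc (0 : ℝ) 1 := ⟨ht.1, ht.2.le⟩
      have hn := norm_nonneg fun g : S => eval (c t) g.1
      have hL : 0 ≤ L := (norm_nonneg _).trans (hc' t ht')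
      rw [add_zero]
      refine (pi_norm_le_iff_of_nonneg (by positivity)).2 fun g => (hb t ht' g).trans ?_
      have := hc' t ht'
      gcongr) 1 ⟨zero_le_one, le_rfl⟩
  -- With zero initial value and no additive error, the Gronwall bound is zero.
  rw [gronwallBound_ε0_δ0] at h1
  exact congrFun (norm_le_zero_iff.1 h1) g

/-- Around a point where the rank of the Jacobian matrix is maximal, a real algebraic set is
defined by polynomials with linearly independent gradients. -/
theorem exists_regular_system {I : Ideal (MvPolynomial (Fin N) ℝ)} {Z : Set (Fin N → ℝ)}
    (hI : ∀ F, F ∈ I ↔ ∀ v ∈ Z, eval v F = 0) {v₀ : Fin N → ℝ} (hv₀ : v₀ ∈ Z)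
    (hrank : ∀ v ∈ Z, Module.finrank ℝ (Submodule.span ℝ (gradSet I v)) ≤
      Module.finrank ℝ (Submodule.span ℝ (gradSet I v₀))) :
    ∃ (α : Type) (_ : Fintype α) (f : α → MvPolynomial (Fin N) ℝ), (∀ j, f j ∈ I) ∧
      LinearIndependent ℝ (fun j => grad (f j) v₀) ∧
      ∀ᶠ v in 𝓝 v₀, (∀ j, eval v (f j) = 0) → ∀ F ∈ I, eval v F = 0 := by
  classical
  obtain ⟨α, a, -, hspan, hli⟩ := exists_linearIndependent' ℝ fun F : I => grad F.1 v₀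
  let f : α → MvPolynomial (Fin N) ℝ := fun j => (a j).1
  have hli : LinearIndependent ℝ fun j => grad (f j) v₀ := hli
  have hfin : Finite α := hli.finite
  have : Fintype α := Fintype.ofFinite α
  have hfI : ∀ j, f j ∈ I := fun j => (a j).2
  have hcard : Fintype.card α = Module.finrank ℝ (Submodule.span ℝ (gradSet I v₀)) := by
    rw [← finrank_span_eq_card hli]
    have h1 : Set.range (fun F : I => grad F.1 v₀) = gradSet I v₀ := by
      ext w
      simp only [Set.mem_range, gradSet, Set.mem_ofPred_eq, Subtype.exists, exists_prop]
      exact exists_congr fun F => and_congr_right fun _ => eq_comm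
    rw [← h1, ← hspan]
    rfl
  obtain ⟨κ, hκ1, hκ2⟩ := exists_basis_extension hli (fun i : Fin N => (Pi.single i 1 : Fin N → ℝ))
    (span_eq_top_of_dotProduct fun w hw => by
      ext i
      have := hw (Pi.single i 1) (Or.inr ⟨i, rfl⟩)
      rwa [single_dotProduct, one_mul] at this)
  have : Fintype κ := Fintype.ofFinite κ
  have hβ := card_eq_of_basis hκ1 hκ2
  let e : Fin N ≃ α ⊕ κ := (Fintype.equivFinOfCardEq hβ).symm
  have hdet : ((jacobianMatrix f e).map (eval v₀)).det ≠ 0 := by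
    have h1 : ((jacobianMatrix f e).map (eval v₀)).row =
        (Sum.elim (fun j => grad (f j) v₀) fun k : κ => (Pi.single k.1 1 : Fin N → ℝ)) ∘ e := by
      ext b i
      rw [Function.comp_apply]
      rcases hb : e b with j | k
      · have : b = e.symm (Sum.inl j) := by rw [← hb, Equiv.symm_apply_apply]
        rw [this]
        exact congrFun (eval_jacobianMatrix_inl v₀ j) i
      · simp only [Matrix.row, jacobianMatrix, Matrix.map_apply, Matrix.of_apply, hb, Sum.elim_inr,
          Pi.single_apply]
        split_ifs <;> simp
    have h2 : LinearIndependent ℝ ((jacobianMatrix f e).map (eval v₀)).row := by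
      rw [h1]
      exact hκ1.comp e e.injective
    rw [Matrix.linearIndependent_rows_iff_isUnit, Matrix.isUnit_iff_isUnit_det] at h2
    exact h2.ne_zero
  obtain ⟨S, hS⟩ := (inferInstance : IsNoetherianRing (MvPolynomial (Fin N) ℝ)).noetherian I
  obtain ⟨K, hK, hbound⟩ := eventually_norm_deriv_le hI hrank hfI hcard hdet hS
  let Φ : α ⊕ κ → (Fin N → ℝ) → ℝ := Sum.elim (fun j v => eval v (f j)) fun k v => v k
  have hΦ : ∀ j v, AnalyticAt ℝ (Φ j) v := by
    rintro (j | k) v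
    · exact analyticAt_eval_id _ _
    · exact analyticAt_pi_iff.1 analyticAt_id k.1
  have hfd : ∀ (j : α ⊕ κ) w, fderiv ℝ (Φ j) v₀ w =
      (Sum.elim (fun j => grad (f j) v₀) (fun k : κ => (Pi.single k.1 1 : Fin N → ℝ)) j) ⬝ᵥ w := by
    rintro (j | k) w
    · exact fderiv_eval_apply _ _ _
    · have : HasFDerivAt (fun v : Fin N → ℝ => v k)
        (ContinuousLinearMap.proj (R := ℝ) (φ := fun _ : Fin N => ℝ) k.1) v₀ :=
        (ContinuousLinearMap.proj (R := ℝ) (φ := fun _ : Fin N => ℝ) k.1).hasFDerivAt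
      simp only [Φ, Sum.elim_inr]
      rw [this.fderiv, single_dotProduct, one_mul]
      rfl
  obtain ⟨Θ, hΘ, hΘ0, hleft, hright⟩ := exists_analytic_inverse hβ (fun j => hΦ j v₀)
    (fun w hw => eq_zero_of_span_eq_top hκ2 (by
      rintro _ ⟨j, rfl⟩
      rw [← hfd]
      exact hw j))
  refine ⟨α, inferInstance, f, hfI, hli, ?_⟩
  set y₀ : α ⊕ κ → ℝ := fun j => Φ j v₀ with hy₀
  have hnice : ∀ᶠ y in 𝓝 y₀, AnalyticAt ℝ Θ y ∧ (fun j => Φ j (Θ y)) = y ∧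
      ‖fderiv ℝ Θ y‖ < ‖fderiv ℝ Θ y₀‖ + 1 ∧
      ∀ w, (∀ j, grad (f j) (Θ y) ⬝ᵥ w = 0) →
        ∀ g : S, |grad g.1 (Θ y) ⬝ᵥ w| ≤ K * ‖w‖ * ‖fun g : S => eval (Θ y) g.1‖ := by
    have h1 : ContinuousAt (fun y => ‖fderiv ℝ Θ y‖) y₀ := hΘ.fderiv.continuousAt.norm
    have h2 : Tendsto Θ (𝓝 y₀) (𝓝 v₀) := by
      have := hΘ.continuousAt.tendsto
      rwa [hΘ0] at this
    filter_upwards [hΘ.eventually_analyticAt, hright,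
      h1.eventually_lt continuousAt_const (lt_add_one _), h2.eventually hbound] with y e1 e2 e3 e4
    exact ⟨e1, e2, e3, e4⟩
  obtain ⟨δ, hδ, hball⟩ := Metric.eventually_nhds_iff_ball.1 hnice
  have hΨc : ContinuousAt (fun v => fun j => Φ j v) v₀ :=
    (analyticAt_pi_iff.2 fun j => hΦ j v₀).continuousAt
  filter_upwards [hleft, hΨc.eventually (Metric.ball_mem_nhds _ hδ)] with v hv1 hv2 hfv
  have hsuff : ∀ g : S, eval v g.1 = 0 := by
    intro g
    set y : α ⊕ κ → ℝ := fun j => Φ j v with hy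
    -- The segment from `y₀` to `y` has constant zero entries in `α`. Its image under `Θ` is a curve
    -- in `{f = 0}` from `v₀`, where the generators vanish, to `v`. The Gronwall estimate carries
    -- their vanishing along it.
    let q : ℝ → α ⊕ κ → ℝ := fun t => y₀ + t • (y - y₀)
    have hq : ∀ t ∈ Set.Icc (0 : ℝ) 1, q t ∈ Metric.ball y₀ δ := by
      intro t ht
      have h1 : ‖t • (y - y₀)‖ ≤ ‖y - y₀‖ := by
        rw [norm_smul, Real.norm_of_nonneg ht.1]
        exact mul_le_of_le_one_left (norm_nonneg _) ht.2
      have hv2 : ‖y - y₀‖ < δ := by rwa [← dist_eq_norm]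
      rw [mem_ball_iff_norm]
      simp only [q, add_sub_cancel_left]
      exact h1.trans_lt hv2
    have hqd : ∀ t, HasDerivAt q (y - y₀) t := by
      intro t
      have := ((hasDerivAt_id t).smul_const (y - y₀)).const_add y₀
      rwa [one_smul] at this
    have hcd : ∀ t ∈ Set.Icc (0 : ℝ) 1,
        HasDerivAt (fun t => Θ (q t)) (fderiv ℝ Θ (q t) (y - y₀)) t := fun t ht =>
      (hball _ (hq t ht)).1.differentiableAt.hasFDerivAt.comp_hasDerivAt t (hqd t)
    have hf0 : ∀ j, eval v₀ (f j) = 0 := fun j => (hI _).1 (hfI j) v₀ hv₀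
    have hq0 : q 0 = y₀ := by simp [q]
    have hq1 : q 1 = y := by simp [q]
    have htan : ∀ t ∈ Set.Icc (0 : ℝ) 1, ∀ j,
        grad (f j) (Θ (q t)) ⬝ᵥ fderiv ℝ Θ (q t) (y - y₀) = 0 := by
      intro t ht j
      have h1 : HasDerivAt (fun s => eval (Θ (q s)) (f j))
          (grad (f j) (Θ (q t)) ⬝ᵥ fderiv ℝ Θ (q t) (y - y₀)) t := by
        have := (hasFDerivAt_eval (f j) (Θ (q t))).comp_hasDerivAt t (hcd t ht)
        convert! this using 1
        simp [dotProduct]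
      have h2 : (fun s => eval (Θ (q s)) (f j)) =ᶠ[𝓝 t] fun _ => 0 := by
        have h3 : ∀ᶠ s in 𝓝 t, q s ∈ Metric.ball y₀ δ :=
          (hqd t).continuousAt.eventually (Metric.isOpen_ball.mem_nhds (hq t ht))
        filter_upwards [h3] with s hs
        have h4 := congrFun (hball _ hs).2.1 (Sum.inl j)
        have h5 : q s (Sum.inl j) = 0 := by
          simp [q, hy, hy₀, Φ, hf0 j, hfv j]
        rw [h5] at h4
        exact h4
      exact h1.unique ((hasDerivAt_const t (0 : ℝ)).congr_of_eventuallyEq h2)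
    have := eval_eq_zero_of_curve (S := S) hK (c := fun t => Θ (q t)) hcd
      (L := (‖fderiv ℝ Θ y₀‖ + 1) * ‖y - y₀‖)
      (fun t ht => (ContinuousLinearMap.le_opNorm _ _).trans
        (mul_le_mul_of_nonneg_right (hball _ (hq t ht)).2.2.1.le (norm_nonneg _)))
      (fun t ht => (hball _ (hq t ht)).2.2.2 _ (htan t ht))
      (fun g => by
        rw [hq0, hΘ0]
        exact (hI _).1 (hS ▸ Ideal.subset_span g.2) v₀ hv₀) g
    rwa [hq1, hv1] at this
  intro F hF
  rw [← hS] at hF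
  induction hF using Submodule.span_induction with
  | mem x hx => exact hsuff ⟨x, hx⟩
  | zero => simp
  | add x y _ _ hx hy => rw [map_add, hx, hy, add_zero]
  | smul a x _ hx => rw [smul_eq_mul, map_mul, hx, mul_zero]

/-- Around a point where the rank of the Jacobian matrix is maximal, a real algebraic set is
parametrized by some of the functions of any analytic family whose differentials have no common
kernel. -/
theorem exists_chart {I : Ideal (MvPolynomial (Fin N) ℝ)} {Z : Set (Fin N → ℝ)}
    (hI : ∀ F, F ∈ I ↔ ∀ v ∈ Z, eval v F = 0) {v₀ : Fin N → ℝ} (hv₀ : v₀ ∈ Z)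
    (hrank : ∀ v ∈ Z, Module.finrank ℝ (Submodule.span ℝ (gradSet I v)) ≤
      Module.finrank ℝ (Submodule.span ℝ (gradSet I v₀)))
    {ι : Type} {G : ι → (Fin N → ℝ) → ℝ} (hG : ∀ i, AnalyticAt ℝ (G i) v₀)
    (hker : ∀ w, (∀ i, fderiv ℝ (G i) v₀ w = 0) → w = 0) :
    ∃ (κ : Type) (_ : Fintype κ) (c : κ → ι) (Θ : (κ → ℝ) → Fin N → ℝ),
      AnalyticAt ℝ Θ (fun k => G (c k) v₀) ∧ Θ (fun k => G (c k) v₀) = v₀ ∧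
      (∀ᶠ y in 𝓝 (fun k => G (c k) v₀), (∀ F ∈ I, eval (Θ y) F = 0) ∧
        (fun k => G (c k) (Θ y)) = y) ∧
      ∀ᶠ v in 𝓝 v₀, v ∈ Z → Θ (fun k => G (c k) v) = v := by
  classical
  obtain ⟨α, _, f, hfI, hli, hsys⟩ := exists_regular_system hI hv₀ hrank
  let D : ι → Fin N → ℝ := fun i a => fderiv ℝ (G i) v₀ (Pi.single a 1)
  have hD : ∀ i w, fderiv ℝ (G i) v₀ w = D i ⬝ᵥ w := by
    intro i w
    conv_lhs => rw [← Finset.univ_sum_single w]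
    rw [map_sum]
    refine Finset.sum_congr rfl fun a _ => ?_
    have : Pi.single a (w a) = w a • (Pi.single a 1 : Fin N → ℝ) := by
      rw [← Pi.single_smul, smul_eq_mul, mul_one]
    rw [this, map_smul, smul_eq_mul, mul_comm]
  -- The differentials of the family `G` span the dual space, so the gradients of the local
  -- equations can be completed to a basis with some of them. The functions completing the basis are
  -- the chart coordinates.
  obtain ⟨κ, hκ1, hκ2⟩ := exists_basis_extension hli D
    (span_eq_top_of_dotProduct fun w hw => hker w fun i => by
      rw [hD]
      exact hw _ (Or.inr ⟨i, rfl⟩))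
  have hfin : Finite (α ⊕ κ) := hκ1.finite
  have : Finite κ := Finite.of_injective (Sum.inr : κ → α ⊕ κ) Sum.inr_injective
  have : Fintype κ := Fintype.ofFinite κ
  have hβ := card_eq_of_basis hκ1 hκ2
  let Φ : α ⊕ κ → (Fin N → ℝ) → ℝ := Sum.elim (fun j v => eval v (f j)) fun k v => G k.1 v
  have hΦ : ∀ j, AnalyticAt ℝ (Φ j) v₀ := by
    rintro (j | k)
    · exact analyticAt_eval_id _ _
    · exact hG k.1
  obtain ⟨Θ, hΘ, hΘ0, hleft, hright⟩ := exists_analytic_inverse hβ hΦ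
    (fun w hw => eq_zero_of_span_eq_top hκ2 (by
      rintro _ ⟨j | k, rfl⟩
      · exact (fderiv_eval_apply (f j) v₀ w).symm.trans (hw (Sum.inl j))
      · exact (hD k.1 w).symm.trans (hw (Sum.inr k))))
  -- Setting the entries of the local equations to zero restricts the inverse map to the algebraic
  -- set.
  let ext : (κ → ℝ) → α ⊕ κ → ℝ := fun y => Sum.elim (fun _ => 0) y
  have hext : ∀ y, AnalyticAt ℝ ext y := by
    intro y
    refine analyticAt_pi_iff.2 ?_
    rintro (j | k)
    · exact analyticAt_const
    · exact analyticAt_pi_iff.1 analyticAt_id k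
  have hZ : ∀ v ∈ Z, (fun j => Φ j v) = ext fun k => G k.1 v := by
    intro v hv
    ext (j | k)
    · exact (hI _).1 (hfI j) v hv
    · rfl
  have hΘ' : AnalyticAt ℝ Θ (ext fun k => G k.1 v₀) := by
    rw [← hZ v₀ hv₀]
    exact hΘ
  have hΘ0' : Θ (ext fun k => G k.1 v₀) = v₀ := by rw [← hZ v₀ hv₀, hΘ0]
  have hcomp : AnalyticAt ℝ (fun y => Θ (ext y)) (fun k : κ => G k.1 v₀) := hΘ'.comp (hext _)
  refine ⟨κ, inferInstance, Subtype.val, fun y => Θ (ext y), hcomp, hΘ0', ?_, ?_⟩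
  · have h1 : Tendsto ext (𝓝 fun k : κ => G k.1 v₀) (𝓝 fun j => Φ j v₀) := by
      rw [hZ v₀ hv₀]
      exact (hext _).continuousAt.tendsto
    have h2 : Tendsto (fun y => Θ (ext y)) (𝓝 fun k : κ => G k.1 v₀) (𝓝 v₀) := by
      have := hcomp.continuousAt.tendsto
      rwa [hΘ0'] at this
    filter_upwards [h1.eventually hright, h2.eventually hsys] with y e1 e2
    refine ⟨e2 fun j => congrFun e1 (Sum.inl j), ?_⟩
    ext k
    exact congrFun e1 (Sum.inr k)
  · filter_upwards [hleft] with v hv hvZ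
    rw [← hZ v hvZ, hv]

end

section

variable {n : ℕ}

/-! ### Clopen subsets of compact arc-symmetric sets -/

/-- The algebra of continuous functions on `ℙⁿ(ℝ)` with a polynomial numerator and a power of the
norm as denominator. -/
noncomputable def polyAlgebra (n : ℕ) : Subalgebra ℝ C(RP n, ℝ) where
  carrier := {f | ∃ (P : MvPolynomial (Fin (n + 1)) ℝ) (k : ℕ), ∀ v, ∀ h : v ≠ 0,
    f (Projectivization.mk ℝ v h) * nsq v ^ k = eval v P}
  mul_mem' := by
    rintro f g ⟨P, k, hP⟩ ⟨Q, l, hQ⟩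
    refine ⟨P * Q, k + l, fun v h => ?_⟩
    rw [map_mul, ← hP v h, ← hQ v h, ContinuousMap.mul_apply]
    ring
  add_mem' := by
    rintro f g ⟨P, k, hP⟩ ⟨Q, l, hQ⟩
    refine ⟨P * nsqPoly _ ^ l + Q * nsqPoly _ ^ k, k + l, fun v h => ?_⟩
    simp only [map_add, map_mul, map_pow, eval_nsqPoly]
    rw [← hP v h, ← hQ v h, ContinuousMap.add_apply]
    ring
  algebraMap_mem' := fun r => ⟨C r, 0, fun v h => by simp⟩

theorem polyAlgebra_separatesPoints : (polyAlgebra n).SeparatesPoints := by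
  intro x y hxy
  obtain ⟨i, hi⟩ := Function.ne_iff.1 (emb_injective.ne hxy)
  obtain ⟨j, hij⟩ := Function.ne_iff.1 hi
  have hc : Continuous fun x : RP n => emb x i j :=
    (continuous_apply j).comp ((continuous_apply i).comp continuous_emb)
  refine ⟨fun x => emb x i j, ⟨⟨fun x => emb x i j, hc⟩, ?_, rfl⟩, hij⟩
  refine ⟨X i * X j, 1, fun v h => ?_⟩
  have := (nsq_pos h).ne'
  simp only [ContinuousMap.coe_mk, emb_mk, pow_one, map_mul, eval_X]
  field_simp

/-- By Stone–Weierstrass a function separating `E` from `C \ E` is approximated by a quotient of a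
polynomial by a power of the norm. A single polynomial inequality then cuts `E` out of `C`, so `E`
is semi-algebraic. An arc cannot pass from `E` to `C \ E` by continuity. -/
theorem isArcSymmetric_of_clopen {C E : Set (RP n)} (hC : IsArcSymmetric C) (hEC : E ⊆ C)
    (hE : IsClosed E) (hE' : IsClosed (C \ E)) : IsArcSymmetric E := by
  refine .of_germClosed ?_ fun g hg h0 hleft => ?_
  · obtain ⟨f, hf0, hf1, -⟩ := exists_continuous_zero_one_of_isClosed hE' hE
      (Set.disjoint_sdiff_left)
    obtain ⟨⟨g, P, k, hP⟩, hg⟩ :=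
      ContinuousMap.exists_mem_subalgebra_near_continuous_of_separatesPoints (polyAlgebra n)
      polyAlgebra_separatesPoints f f.continuous (1 / 2) (by norm_num)
    have hg : ∀ x, |g x - f x| < 1 / 2 := hg
    have : cone E = cone C ∩ {v | 0 < eval v (P - MvPolynomial.C (1 / 2) * nsqPoly _ ^ k)} := by
      ext v
      by_cases hv : v = 0
      · subst hv
        exact ⟨fun h => (h.1 rfl).elim, fun h => (h.1.1 rfl).elim⟩
      · have h1 : 0 < nsq v ^ k := pow_pos (nsq_pos hv) k
        have h2 : 0 < eval v (P - MvPolynomial.C (1 / 2) * nsqPoly _ ^ k) ↔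
            1 / 2 < g (Projectivization.mk ℝ v hv) := by
          simp only [map_sub, map_mul, eval_C, map_pow, eval_nsqPoly]
          rw [← hP v hv, ← sub_mul, mul_pos_iff_of_pos_right h1, sub_pos]
        rw [Set.mem_inter_iff, mem_cone_iff hv, mem_cone_iff hv, Set.mem_ofPred_eq, h2]
        have h3 := abs_lt.1 (hg (Projectivization.mk ℝ v hv))
        constructor
        · intro h
          refine ⟨hEC h, ?_⟩
          have : f (Projectivization.mk ℝ v hv) = 1 := hf1 h
          linarith [h3.1]
        · rintro ⟨h4, h5⟩
          by_contra h6
          have : f (Projectivization.mk ℝ v hv) = 0 := hf0 ⟨h4, h6⟩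
          linarith [h3.2]
    rw [this]
    exact hC.semialgebraic.inter _ _ (IsSemialgebraic.pos _)
  · have h1 := mem_cone_of_isClosed hE h0
      (hg.continuousAt.tendsto.mono_left (nhdsWithin_le_nhds (s := Set.Iio (0 : ℝ)))) hleft
    have h2 : ∀ᶠ y in 𝓝 (Projectivization.mk ℝ (g 0) h0), y ∉ C \ E :=
      hE'.isOpen_compl.mem_nhds fun h => h.2 (mk_mem_of_mem_cone h1 h0)
    rw [eventually_nhds_mk] at h2
    filter_upwards [hC.germClosed g hg h0 (hleft.mono fun t ht => cone_mono hEC ht),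
      (hg.continuousAt.eventually h2).filter_mono nhdsWithin_le_nhds] with t h3 h4
    have hne := ne_zero_of_mem_cone h3
    rw [mem_cone_iff hne]
    by_contra h5
    exact h4 hne ⟨mk_mem_of_mem_cone h3 hne, h5⟩

/-! ### The ideal of an irreducible arc-symmetric set is prime -/

/-- The points where all the homogeneous components of `F` vanish. -/
def homZero (F : MvPolynomial (Fin (n + 1)) ℝ) : Set (RP n) :=
  {x | ∀ j, eval x.rep (homogeneousComponent j F) = 0}

theorem mem_cone_homZero {F : MvPolynomial (Fin (n + 1)) ℝ} {v : Fin (n + 1) → ℝ} (hv : v ≠ 0) :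
    v ∈ cone (homZero F) ↔ ∀ j, eval v (homogeneousComponent j F) = 0 := by
  rw [mem_cone_iff hv]
  obtain ⟨c, hc, hr⟩ := exists_mk_rep_eq_smul v hv
  refine forall_congr' fun j => ?_
  rw [hr, eval_smul_of_isHomogeneous (homogeneousComponent_isHomogeneous j F)]
  simp [hc]

theorem isClosed_homZero (F : MvPolynomial (Fin (n + 1)) ℝ) : IsClosed (homZero F) := by
  refine isClosed_of_cone fun v hv hmem => ?_
  rw [mem_cone_homZero hv] at hmem
  push Not at hmem
  obtain ⟨j, hne⟩ := hmem
  have : ContinuousAt (fun w => eval w (homogeneousComponent j F)) v :=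
    (MvPolynomial.continuous_eval _).continuousAt
  filter_upwards [this.eventually_ne hne] with w hw hw'
  exact hw ((mem_cone_homZero hw'.1).1 hw' j)

theorem forall_homogeneousComponent_iff {F : MvPolynomial (Fin (n + 1)) ℝ}
    {v : Fin (n + 1) → ℝ} : (∀ j, eval v (homogeneousComponent j F) = 0) ↔
      ∀ j : Fin (F.totalDegree + 1), eval v (homogeneousComponent j.1 F) = 0 := by
  refine ⟨fun h j => h j, fun h j => ?_⟩
  by_cases hj : j < F.totalDegree + 1
  · exact h ⟨j, hj⟩
  · rw [homogeneousComponent_eq_zero _ _ (by omega), map_zero]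

theorem isArcSymmetric_homZero (F : MvPolynomial (Fin (n + 1)) ℝ) : IsArcSymmetric (homZero F) := by
  refine .of_germClosed ?_ fun g hg h0 hleft => ?_
  · have h1 := (isSemialgebraic_ne_zero (n + 1)).inter _ _ (IsSemialgebraic.iInter
      fun j : Fin (F.totalDegree + 1) => isSemialgebraic_eq_zero (homogeneousComponent j.1 F))
    convert! h1 using 1
    ext v
    by_cases hv : v = 0
    · subst hv
      exact ⟨fun h => (h.1 rfl).elim, fun h => (h.1 rfl).elim⟩
    · rw [mem_cone_homZero hv, forall_homogeneousComponent_iff]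
      simp [hv]
  · have h1 : ∀ j : Fin (F.totalDegree + 1), ∀ᶠ t in 𝓝 (0 : ℝ),
        eval (g t) (homogeneousComponent j.1 F) = 0 := by
      intro j
      refine eventually_zero_of_left (analyticAt_eval hg _) ?_
      filter_upwards [hleft] with t ht
      exact (mem_cone_homZero (ne_zero_of_mem_cone ht)).1 ht j
    filter_upwards [(eventually_all.2 h1).filter_mono nhdsWithin_le_nhds,
      (hg.continuousAt.eventually_ne h0).filter_mono nhdsWithin_le_nhds] with t h2 h3
    rw [mem_cone_homZero h3, forall_homogeneousComponent_iff]
    exact h2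

/-- The restriction of a polynomial to a line. -/
theorem exists_linePoly (F : MvPolynomial (Fin (n + 1)) ℝ) (v : Fin (n + 1) → ℝ) :
    ∃ f : Polynomial ℝ, (∀ t : ℝ, f.eval t = eval (t • v) F) ∧
      (f = 0 → ∀ j, eval v (homogeneousComponent j F) = 0) := by
  refine ⟨∑ j ∈ Finset.range (F.totalDegree + 1),
    Polynomial.C (eval v (homogeneousComponent j F)) * Polynomial.X ^ j, ?_, ?_⟩
  · intro t
    conv_rhs => rw [← sum_homogeneousComponent F]
    rw [Polynomial.eval_finsetSum, map_sum]
    refine Finset.sum_congr rfl fun j _ => ?_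
    rw [eval_smul_of_isHomogeneous (homogeneousComponent_isHomogeneous j F), Polynomial.eval_mul, Polynomial.eval_C,
      Polynomial.eval_pow, Polynomial.eval_X, mul_comm]
  · intro h
    rw [forall_homogeneousComponent_iff]
    intro j
    have := congrArg (fun f : Polynomial ℝ => f.coeff j.1) h
    have hj := Nat.lt_succ_iff.1 j.2
    simpa [Polynomial.finsetSum_coeff, Polynomial.coeff_C_mul, Polynomial.coeff_X_pow, hj]
      using this

/-- Restricted to the line through a point of `C`, the product becomes a polynomial in one variable
with infinitely many zeros. One factor is zero, and then all its homogeneous components vanish at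
the point. Hence `C` is covered by its intersections with two sets `homZero`, and irreducibility
applies. -/
theorem IsIrreducibleArcSymmetric.isPrime_idealOf {C : Set (RP n)}
    (hC : IsIrreducibleArcSymmetric C) : (idealOf C).IsPrime := by
  refine ⟨?_, ?_⟩
  · rw [Ideal.ne_top_iff_one, mem_idealOf]
    intro h
    obtain ⟨x, hx⟩ := hC.nonempty
    simpa using h x.rep (rep_mem_cone.2 hx)
  · intro F G hFG
    have hclosed : ∀ F, IsClosedArcSymmetricIn (C ∩ homZero F) C := fun F =>
      ⟨hC.arcSymmetric.inter (isArcSymmetric_homZero F), homZero F, isClosed_homZero F, rfl⟩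
    have hmem : ∀ F, C ∩ homZero F = C → F ∈ idealOf C := by
      intro F h
      rw [mem_idealOf]
      intro v hv
      have h1 : v ∈ cone (homZero F) := cone_mono (Set.inter_eq_left.1 h) hv
      rw [mem_cone_homZero hv.1] at h1
      rw [← sum_homogeneousComponent F, map_sum]
      exact Finset.sum_eq_zero fun j _ => h1 j
    refine (hC.irreducible _ _ (hclosed F) (hclosed G) ?_).imp (hmem F) (hmem G)
    rw [← Set.inter_union_distrib_left]
    refine (Set.inter_eq_left.2 fun x hx => ?_).symm
    obtain ⟨f, hf, hf'⟩ := exists_linePoly F x.rep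
    obtain ⟨g, hg, hg'⟩ := exists_linePoly G x.rep
    have hfg : f * g = 0 := by
      refine Polynomial.eq_zero_of_infinite_isRoot _ (Set.Infinite.mono (s := Set.Ioi (0 : ℝ)) ?_
        (Set.Ioi_infinite 0))
      intro t ht
      have h1 := mem_idealOf.1 hFG _ (smul_mem_cone (rep_mem_cone.2 hx) (ne_of_gt ht))
      rw [map_mul] at h1
      simpa [Polynomial.IsRoot, hf, hg] using h1
    exact (mul_eq_zero.1 hfg).imp hf' hg'

/-- Among the polynomials deciding membership by signs, those in the ideal vanish on the Zariski
closure. The ideal is prime, so the product of the others is nonzero at some point of `C`. Near this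
point their signs are constant and membership does not change. -/
theorem IsIrreducibleArcSymmetric.exists_interior {C : Set (RP n)}
    (hC : IsIrreducibleArcSymmetric C) :
    ∃ x ∈ C, ∀ᶠ y in 𝓝 x, y ∈ zariskiClosure C → y ∈ C := by
  classical
  have hprime := hC.isPrime_idealOf
  obtain ⟨Φ, hΦ⟩ := hC.arcSymmetric.semialgebraic.exists_signs
  have hprod : ∏ φ ∈ Φ.filter (· ∉ idealOf C), φ ∉ idealOf C := by
    rw [hprime.prod_mem_iff]
    rintro ⟨φ, hφ, hmem⟩
    exact (Finset.mem_filter.1 hφ).2 hmem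
  rw [mem_idealOf] at hprod
  push Not at hprod
  obtain ⟨v, hv, hne⟩ := hprod
  rw [map_prod, Finset.prod_ne_zero_iff] at hne
  refine ⟨_, mk_mem_of_mem_cone hv hv.1, ?_⟩
  rw [eventually_nhds_mk]
  have hsign : ∀ φ ∈ Φ.filter (· ∉ idealOf C), ∀ᶠ w in 𝓝 v,
      SignType.sign (eval w φ) = SignType.sign (eval v φ) := by
    intro φ hφ
    have hc : ContinuousAt (fun w => eval w φ) v := (MvPolynomial.continuous_eval φ).continuousAt
    rcases lt_or_gt_of_ne (hne φ hφ) with h | h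
    · filter_upwards [hc.eventually (eventually_lt_nhds h)] with w hw
      rw [sign_neg hw, sign_neg h]
    · filter_upwards [hc.eventually (eventually_gt_nhds h)] with w hw
      rw [sign_pos hw, sign_pos h]
  filter_upwards [(Finset.eventually_all _).2 hsign] with w hw hw0 hwW
  rw [← mem_cone_iff hw0] at hwW ⊢
  refine (hΦ w v fun φ hφ => ?_).2 hv
  by_cases hmem : φ ∈ idealOf C
  · rw [(mem_cone_zariskiClosure hw0).1 hwW φ hmem, mem_idealOf.1 hmem v hv]
  · exact hw φ (Finset.mem_filter.2 ⟨hφ, hmem⟩)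

/-! ### Charts at nonsingular points -/

theorem pderiv_dilate {k : ℕ} (c : ℝ) (F : MvPolynomial (Fin k) ℝ) (i : Fin k) :
    pderiv i (dilate c F) = C c * dilate c (pderiv i F) := by
  classical
  induction F using MvPolynomial.induction_on with
  | C a => simp [dilate]
  | add p q hp hq =>
    simp only [dilate, map_add] at hp hq ⊢
    rw [hp, hq]
    ring
  | mul_X p b hp =>
    simp only [dilate, map_mul, bind₁_X_right, Derivation.leibniz, smul_eq_mul, pderiv_C,
      pderiv_X, map_add] at hp ⊢
    rw [hp]
    by_cases hb : b = i
    · subst hb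
      simp
      ring
    · simp [hb]
      ring

theorem grad_dilate {k : ℕ} (c : ℝ) (F : MvPolynomial (Fin k) ℝ) (v : Fin k → ℝ) :
    grad (dilate c F) v = c • grad F (c • v) := by
  ext i
  simp [grad, pderiv_dilate, eval_dilate]

/-- Dilation of an element of the ideal only rescales gradients, so the ranks at representatives
bound those on the whole cone. This turns nonsingularity into the rank hypothesis of `exists_chart`.
-/
theorem finrank_gradSet_le {V : Set (RP n)} {x : RP n} (hx : x ∈ V) (hns : x ∉ singularLocus V)
    {v : Fin (n + 1) → ℝ} (hv : v ∈ cone V) :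
    Module.finrank ℝ (Submodule.span ℝ (gradSet (idealOf V) v)) ≤
      Module.finrank ℝ (Submodule.span ℝ (gradSet (idealOf V) x.rep)) := by
  have hv0 := ne_zero_of_mem_cone hv
  have hmem := mk_mem_of_mem_cone hv hv0
  have h1 : jacobianRank V (Projectivization.mk ℝ v hv0) ≤ jacobianRank V x := by
    by_contra h
    exact hns ⟨hx, _, hmem, not_le.1 h⟩
  refine le_trans ?_ h1
  refine Submodule.finrank_mono (Submodule.span_le.2 ?_)
  rintro _ ⟨F, hF, rfl⟩
  obtain ⟨c, hc, hr⟩ := exists_mk_rep_eq_smul v hv0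
  have h2 : grad F v = c • grad (dilate c⁻¹ F) (Projectivization.mk ℝ v hv0).rep := by
    rw [grad_dilate, hr, smul_smul, smul_smul, mul_inv_cancel₀ hc, inv_mul_cancel₀ hc, one_smul,
      one_smul]
  rw [h2]
  exact Submodule.smul_mem _ _
    (Submodule.subset_span ⟨_, dilate_mem_idealOf hF (inv_ne_zero hc), rfl⟩)

theorem exists_nonsingular_chart {C : Set (RP n)}
    (hC : Disjoint C (singularLocus (zariskiClosure C))) {x : RP n} (hx : x ∈ C)
    {ι : Type} {G : ι → (Fin (n + 1) → ℝ) → ℝ} (hG : ∀ i, AnalyticAt ℝ (G i) x.rep)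
    (hker : ∀ w, (∀ i, fderiv ℝ (G i) x.rep w = 0) → w = 0) :
    ∃ (κ : Type) (_ : Fintype κ) (c : κ → ι) (Θ : (κ → ℝ) → Fin (n + 1) → ℝ),
      AnalyticAt ℝ Θ (fun k => G (c k) x.rep) ∧ Θ (fun k => G (c k) x.rep) = x.rep ∧
      (∀ᶠ y in 𝓝 (fun k => G (c k) x.rep), Θ y ∈ cone (zariskiClosure C) ∧
        (fun k => G (c k) (Θ y)) = y) ∧
      ∀ᶠ v in 𝓝 x.rep, v ∈ cone (zariskiClosure C) → Θ (fun k => G (c k) v) = v := by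
  have hxW := subset_zariskiClosure C hx
  obtain ⟨κ, _, c, Θ, h1, h2, h3, h4⟩ := exists_chart (I := idealOf (zariskiClosure C))
    (fun F => mem_idealOf) (rep_mem_cone.2 hxW)
    (fun v hv => finrank_gradSet_le hxW (Set.disjoint_left.1 hC hx) hv) hG hker
  refine ⟨κ, inferInstance, c, Θ, h1, h2, ?_, h4⟩
  have hne : ∀ᶠ y in 𝓝 (fun k => G (c k) x.rep), Θ y ≠ 0 :=
    h1.continuousAt.eventually_ne (by rw [h2]; exact x.rep_nonzero)
  filter_upwards [h3, hne] with y h5 h6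
  refine ⟨?_, h5.2⟩
  rw [← zariskiClosure_idem, mem_cone_zariskiClosure h6]
  exact h5.1

/-! ### Analytic continuation in irreducible sets -/

/-- This is a continuity argument. The times up to which the curve stays in `D` form a closed set
because `D` is closed. They extend to the right by `GermClosed`, or by `h0` at the initial time,
where there is no left half to continue from. -/
theorem mem_cone_of_curve {D W : Set (RP n)} (hD : IsClosed D) (hDg : GermClosed D)
    {c : ℝ → Fin (n + 1) → ℝ} (hc : ∀ t ∈ Set.Icc (0 : ℝ) 1, AnalyticAt ℝ c t)
    (hcW : ∀ t ∈ Set.Icc (0 : ℝ) 1, c t ∈ cone W)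
    (h0 : ∀ᶠ v in 𝓝 (c 0), v ∈ cone W → v ∈ cone D) :
    ∀ t ∈ Set.Icc (0 : ℝ) 1, c t ∈ cone D := by
  let s : Set ℝ := {t | ∀ u ∈ Set.Icc 0 t, c u ∈ cone D}
  have hmem0 : c 0 ∈ cone D := h0.self_of_nhds (hcW 0 ⟨le_rfl, zero_le_one⟩)
  have hs : IsClosed (s ∩ Set.Icc 0 1) := by
    refine isClosed_of_closure_subset fun t ht => ?_
    have ht1 : t ∈ Set.Icc (0 : ℝ) 1 :=
      (isClosed_Icc.closure_subset_iff.2 Set.inter_subset_right) ht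
    have hlt : ∀ u, 0 ≤ u → u < t → c u ∈ cone D := by
      intro u hu0 hut
      obtain ⟨t', ht', hts, -⟩ := mem_closure_iff.1 ht (Set.Ioi u) isOpen_Ioi hut
      exact hts u ⟨hu0, le_of_lt ht'⟩
    refine ⟨fun u hu => ?_, ht1⟩
    rcases lt_or_eq_of_le hu.2 with h | h
    · exact hlt u hu.1 h
    · subst h
      rcases lt_or_eq_of_le hu.1 with h' | h'
      · refine mem_cone_of_isClosed hD (ne_zero_of_mem_cone (hcW u ht1))
          ((hc u ht1).continuousAt.tendsto.mono_left (nhdsWithin_le_nhds (s := Set.Iio u))) ?_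
        filter_upwards [Ioo_mem_nhdsLT h'] with t' ht'
        exact hlt t' ht'.1.le ht'.2
      · rw [← h']
        exact hmem0
  have key := hs.Icc_subset_of_forall_exists_gt (s := s) (a := 0) (b := 1)
    (fun u hu => by
      rw [Set.Icc_self, Set.mem_singleton_iff] at hu
      rw [hu]
      exact hmem0) ?_
  · exact fun t ht => key ht t ⟨ht.1, le_rfl⟩
  · rintro t ⟨hts, ht0, ht1⟩ z hz
    have htI : t ∈ Set.Icc (0 : ℝ) 1 := ⟨ht0, ht1.le⟩
    have hright : ∀ᶠ u in 𝓝[>] t, c u ∈ cone D := by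
      rcases lt_or_eq_of_le ht0 with h | h
      · have h1 := hDg (fun τ => c (t + τ)) ?_ ?_ ?_
        · have h2 : Tendsto (fun u => u - t) (𝓝[>] t) (𝓝[>] 0) := by
            refine tendsto_nhdsWithin_iff.2 ⟨?_, ?_⟩
            · have : Tendsto (fun u => u - t) (𝓝 t) (𝓝 (t - t)) :=
                (continuous_id.sub continuous_const).tendsto t
              rw [sub_self] at this
              exact this.mono_left nhdsWithin_le_nhds
            · filter_upwards [self_mem_nhdsWithin] with u hu
              exact sub_pos.2 (Set.mem_Ioi.1 hu)
          simpa using h2.eventually h1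
        · have h3 : AnalyticAt ℝ c (t + 0) := by
            rw [add_zero]
            exact hc t htI
          exact h3.comp (f := fun τ : ℝ => t + τ) (analyticAt_const.add analyticAt_id)
        · rw [add_zero]
          exact ne_zero_of_mem_cone (hcW t htI)
        · filter_upwards [Ioo_mem_nhdsLT (neg_lt_zero.2 h)] with τ hτ
          exact hts _ ⟨by linarith [hτ.1], by linarith [hτ.2]⟩
      · subst h
        filter_upwards [((hc 0 htI).continuousAt.eventually h0).filter_mono nhdsWithin_le_nhds,
          Ioo_mem_nhdsGT (zero_lt_one' ℝ)] with u h1 h2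
        exact h1 (hcW u ⟨h2.1.le, h2.2.le⟩)
    obtain ⟨z', hz', hsub⟩ := (mem_nhdsGT_iff_exists_Ioo_subset' (hz : t < z)).1 hright
    have hz' : t < z' := hz'
    refine ⟨min ((t + z') / 2) z, fun u hu => ?_, lt_min (by linarith) hz, min_le_right _ _⟩
    rcases le_or_gt u t with h | h
    · exact hts u ⟨hu.1, h⟩
    · exact hsub ⟨h, by linarith [hu.2.trans (min_le_left _ _)]⟩

/-- A closed subset of a compact nonsingular irreducible arc-symmetric set `C` that is closed under
continuation of arcs and has interior points in the Zariski closure of `C` is a neighbourhood of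
`C` there. -/
theorem IsNonsingularIrreducible.eventually_mem_of_interior {C D : Set (RP n)}
    (hC : IsNonsingularIrreducible C) (hCc : IsCompact C) (hD : IsClosed D)
    (hDg : GermClosed D) {x₀ : RP n} (hx₀ : x₀ ∈ C)
    (hint : ∀ᶠ y in 𝓝 x₀, y ∈ zariskiClosure C → y ∈ D) {x : RP n} (hx : x ∈ C) :
    ∀ᶠ y in 𝓝 x, y ∈ zariskiClosure C → y ∈ D := by
  set W := zariskiClosure C with hW
  let O : Set (RP n) := {x | ∀ᶠ y in 𝓝 x, y ∈ W → y ∈ D}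
  have hO : IsOpen O := isOpen_setOfPred_eventually_nhds
  have hCW : C ⊆ W := subset_zariskiClosure C
  -- At a limit point `x`, one chart ball contains coordinates of a point of `C ∩ O`. Every nearby
  -- point of `W` is joined to it by the image of a segment, and arc continuation along this curve
  -- keeps it in `D`.
  have hcl : IsClosed (C ∩ O) := by
    refine isClosed_of_closure_subset fun x hx => ?_
    have hxC : x ∈ C := (hCc.isClosed.closure_subset_iff.2 Set.inter_subset_left) hx
    refine ⟨hxC, ?_⟩
    obtain ⟨κ, _, c, Θ, h1, h2, h3, h4⟩ := exists_nonsingular_chart hC.2 hxC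
      (G := fun i v => v i) (fun i => analyticAt_pi_iff.1 analyticAt_id i) (fun w hw => by
        ext i
        have := hw i
        have hd : HasFDerivAt (fun v : Fin (n + 1) → ℝ => v i)
          (ContinuousLinearMap.proj (R := ℝ) (φ := fun _ : Fin (n + 1) => ℝ) i) x.rep :=
          (ContinuousLinearMap.proj (R := ℝ) (φ := fun _ : Fin (n + 1) => ℝ) i).hasFDerivAt
        rw [hd.fderiv] at this
        exact this)
    rw [← hW] at h3 h4
    obtain ⟨δ, hδ, hball⟩ := Metric.eventually_nhds_iff_ball.1 (h1.eventually_analyticAt.and h3)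
    have hcont : ContinuousAt (fun (v : Fin (n + 1) → ℝ) (k : κ) => v (c k)) x.rep :=
      (continuous_pi fun k => continuous_apply (c k)).continuousAt
    have hN : ∀ᶠ v in 𝓝 x.rep, (v ∈ cone W → Θ (fun k => v (c k)) = v) ∧
        (fun k => v (c k)) ∈ Metric.ball (fun k => x.rep (c k)) δ :=
      h4.and (hcont.eventually (Metric.ball_mem_nhds _ hδ))
    have hlift : ∀ᶠ e in 𝓝 x, ∃ v, ∃ h : v ≠ 0, e = Projectivization.mk ℝ v h ∧
        (v ∈ cone W → Θ (fun k => v (c k)) = v) ∧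
        (fun k => v (c k)) ∈ Metric.ball (fun k => x.rep (c k)) δ := by
      have : ∀ᶠ e in 𝓝 (Projectivization.mk ℝ x.rep x.rep_nonzero), ∃ v, ∃ h : v ≠ 0,
          e = Projectivization.mk ℝ v h ∧ (v ∈ cone W → Θ (fun k => v (c k)) = v) ∧
          (fun k => v (c k)) ∈ Metric.ball (fun k => x.rep (c k)) δ := by
        rw [eventually_nhds_mk]
        filter_upwards [hN] with w hw hw0
        exact ⟨w, hw0, rfl, hw⟩
      rwa [Projectivization.mk_rep] at this
    obtain ⟨e, heCO, v₁, hv₁0, rfl, hv₁, hv₁b⟩ :=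
      ((mem_closure_iff_frequently.1 hx).and_eventually hlift).exists
    have hv₁W : v₁ ∈ cone W := (mem_cone_iff hv₁0).2 (hCW heCO.1)
    have hO₁ : ∀ᶠ v in 𝓝 v₁, v ∈ cone W → v ∈ cone D := by
      have : ∀ᶠ y in 𝓝 (Projectivization.mk ℝ v₁ hv₁0), y ∈ W → y ∈ D := heCO.2
      rw [eventually_nhds_mk] at this
      filter_upwards [this] with v hv hvW
      exact ⟨hvW.1, hv hvW.1 hvW.2⟩
    have hgoal : ∀ᶠ y in 𝓝 (Projectivization.mk ℝ x.rep x.rep_nonzero), y ∈ W → y ∈ D := by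
      rw [eventually_nhds_mk]
      filter_upwards [hN] with w ⟨hw1, hw2⟩ hw0 hwW
      have hwW' : w ∈ cone W := (mem_cone_iff hw0).2 hwW
      let q : ℝ → κ → ℝ := fun t => (fun k => v₁ (c k)) + t • ((fun k => w (c k)) -
        fun k => v₁ (c k))
      have hq0 : Θ (q 0) = v₁ := by
        simp only [q, zero_smul, add_zero]
        exact hv₁ hv₁W
      have hq1 : Θ (q 1) = w := by
        simp only [q, one_smul, add_sub_cancel]
        exact hw1 hwW'
      have hq : ∀ t ∈ Set.Icc (0 : ℝ) 1, q t ∈ Metric.ball (fun k => x.rep (c k)) δ :=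
        fun t ht => (convex_ball _ _).add_smul_sub_mem hv₁b hw2 ht
      have hqa : ∀ t, AnalyticAt ℝ q t := fun t =>
        analyticAt_const.add (analyticAt_id.smul analyticAt_const)
      have := mem_cone_of_curve (W := W) hD hDg (c := fun t => Θ (q t))
        (fun t ht => (hball _ (hq t ht)).1.comp (hqa t))
        (fun t ht => (hball _ (hq t ht)).2.1) (by rw [hq0]; exact hO₁) 1 ⟨zero_le_one, le_rfl⟩
      rw [hq1] at this
      exact mk_mem_of_mem_cone this hw0
    rwa [Projectivization.mk_rep] at hgoal
  have hcl' : IsClosed (C \ (C ∩ O)) := by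
    rw [Set.sdiff_self_inter]
    exact hCc.isClosed.sdiff hO
  have hcl'' : IsClosed (C \ (C \ (C ∩ O))) := by
    rw [Set.sdiff_sdiff_cancel_left Set.inter_subset_left]
    exact hcl
  have hE := isArcSymmetric_of_clopen hC.1.arcSymmetric Set.inter_subset_left hcl hcl'
  have hE' := isArcSymmetric_of_clopen hC.1.arcSymmetric Set.sdiff_subset hcl' hcl''
  -- `C ∩ O` is clopen in `C`, so both it and its complement are arc-symmetric. Irreducibility
  -- leaves only one of them, and `x₀` excludes the complement.
  rcases hC.1.irreducible (C ∩ O) (C \ (C ∩ O)) ⟨hE, C ∩ O, hcl, by rw [← Set.inter_assoc,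
      Set.inter_self]⟩ ⟨hE', C \ (C ∩ O), hcl', by rw [Set.inter_eq_right.2 Set.sdiff_subset]⟩
      (Set.union_sdiff_cancel Set.inter_subset_left).symm with h | h
  · exact (h.symm.subset hx).2
  · exact absurd ⟨hx₀, hint⟩ (h.symm.subset hx₀).2

end

/-! ### Even functions, generic points and approach through dense sets -/

/-- An even analytic function is an analytic function of the square. -/
theorem exists_analyticAt_sq {f : ℝ → ℝ} (hf : AnalyticAt ℝ f 0)
    (heven : ∀ᶠ t in 𝓝 (0 : ℝ), f (-t) = f t) :
    ∃ h : ℝ → ℝ, AnalyticAt ℝ h 0 ∧ ∀ᶠ t in 𝓝 (0 : ℝ), f t = h (t ^ 2) := by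
  obtain ⟨p, hp⟩ := hf
  have hsum := hasFPowerSeriesAt_iff.1 hp
  obtain ⟨r, hr0, hr⟩ := ENNReal.lt_iff_exists_nnreal_btwn.1 hp.radius_pos
  have hr0 : 0 < r := by exact_mod_cast hr0
  obtain ⟨K, hK, hbound⟩ := p.norm_mul_pow_le_of_lt_radius hr
  -- The series of `h` consists of the coefficients of even index, and it converges because they are
  -- bounded on the radius `r ^ 2`.
  let q : FormalMultilinearSeries ℝ ℝ ℝ :=
    FormalMultilinearSeries.ofScalars ℝ fun k => p.coeff (2 * k)
  have hq : 0 < q.radius := by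
    refine lt_of_lt_of_le ?_ (q.le_radius_of_bound K (r := r ^ 2) fun k => ?_)
    · exact_mod_cast pow_pos hr0 2
    · rw [FormalMultilinearSeries.ofScalars_norm]
      have h1 := hbound (2 * k)
      rw [FormalMultilinearSeries.norm_apply_eq_norm_coef] at h1
      rw [NNReal.coe_pow, ← pow_mul]
      exact h1
  have hqs := q.hasFPowerSeriesOnBall hq
  refine ⟨q.sum, hqs.analyticAt, ?_⟩
  have hqs' := hasFPowerSeriesAt_iff.1 hqs.hasFPowerSeriesAt
  have hneg : Tendsto (fun t : ℝ => -t) (𝓝 0) (𝓝 0) := by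
    simpa using (continuous_neg (G := ℝ)).tendsto 0
  have hsq : Tendsto (fun t : ℝ => t ^ 2) (𝓝 0) (𝓝 0) := by
    simpa using (continuous_pow (M := ℝ) 2).tendsto 0
  filter_upwards [hsum, hneg.eventually hsum, hsq.eventually hqs', heven] with t h1 h2 h3 h4
  simp only [zero_add, smul_eq_mul] at h1 h2 h3
  rw [h4] at h2
  -- Averaging the series at `t` and at `-t` removes the terms of odd index, without a separate
  -- proof that their coefficients vanish.
  have h5 := (h1.add h2).mul_left (1 / 2)
  have h6 : ∀ k ∉ Set.range fun k : ℕ => 2 * k,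
      1 / 2 * (t ^ k * p.coeff k + (-t) ^ k * p.coeff k) = 0 := by
    intro k hk
    have hodd : Odd k := by
      by_contra h
      obtain ⟨l, hl⟩ := Nat.not_odd_iff_even.1 h
      exact hk ⟨l, by simp only; omega⟩
    rw [hodd.neg_pow]
    ring
  have hinj : Function.Injective fun k : ℕ => 2 * k := fun a b h => by
    simpa using h
  have h7 := (hinj.hasSum_iff h6).2 h5
  have h8 : ((fun k => 1 / 2 * (t ^ k * p.coeff k + (-t) ^ k * p.coeff k)) ∘ fun k : ℕ => 2 * k) =
      fun k => (t ^ 2) ^ k * q.coeff k := by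
    ext k
    have : q.coeff k = p.coeff (2 * k) := by simp [q]
    rw [this, Function.comp_apply, (even_two_mul k).neg_pow, ← pow_mul]
    ring
  rw [h8] at h7
  have := h7.unique h3
  linarith

/-- Finitely many analytic functions on a ball, none of which vanishes identically, do not vanish
at a common point. -/
theorem exists_forall_ne_zero {E : Type*} [NormedAddCommGroup E] [NormedSpace ℝ E] {y₀ : E}
    {δ : ℝ} (hδ : 0 < δ) {ι : Type*} (s : Finset ι) {F : ι → E → ℝ}
    (hF : ∀ j ∈ s, ∀ y ∈ Metric.ball y₀ δ, AnalyticAt ℝ (F j) y)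
    (hne : ∀ j ∈ s, ∃ y ∈ Metric.ball y₀ δ, F j y ≠ 0) :
    ∃ y ∈ Metric.ball y₀ δ, ∀ j ∈ s, F j y ≠ 0 := by
  classical
  induction s using Finset.induction_on with
  | empty => exact ⟨y₀, Metric.mem_ball_self hδ, by simp⟩
  | insert a s _ ih =>
    obtain ⟨y, hy, hys⟩ := ih (fun j hj => hF j (Finset.mem_insert_of_mem hj))
      (fun j hj => hne j (Finset.mem_insert_of_mem hj))
    by_contra hcon
    push Not at hcon
    have h1 : ∀ᶠ z in 𝓝 y, z ∈ Metric.ball y₀ δ ∧ ∀ j ∈ s, F j z ≠ 0 := by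
      have hb : ∀ᶠ z in 𝓝 y, z ∈ Metric.ball y₀ δ := Metric.isOpen_ball.mem_nhds hy
      refine hb.and ?_
      rw [Finset.eventually_all]
      intro j hj
      exact (hF j (Finset.mem_insert_of_mem hj) y hy).continuousAt.eventually_ne (hys j hj)
    -- Near `y` the other functions stay nonzero, so a failure everywhere means that `F a` vanishes
    -- near `y`. The identity theorem then makes it vanish on the whole ball.
    have h2 : F a =ᶠ[𝓝 y] 0 := by
      filter_upwards [h1] with z hz
      obtain ⟨j, hj, hz0⟩ := hcon z hz.1
      rcases Finset.mem_insert.1 hj with rfl | hj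
      · exact hz0
      · exact absurd hz0 (hz.2 j hj)
    have h3 : AnalyticOnNhd ℝ (F a) (Metric.ball y₀ δ) :=
      fun z hz => hF a (Finset.mem_insert_self a s) z hz
    obtain ⟨z, hz, hza⟩ := hne a (Finset.mem_insert_self a s)
    exact hza (h3.eqOn_zero_of_preconnected_of_eventuallyEq_zero
      (convex_ball y₀ δ).isPreconnected hy h2 hz)

theorem exists_mem_cone_of_mem_closure {n : ℕ} {X : Set (RP n)} {w₀ : Fin (n + 1) → ℝ}
    (h0 : w₀ ≠ 0) (hcl : Projectivization.mk ℝ w₀ h0 ∈ closure X)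
    {P : (Fin (n + 1) → ℝ) → Prop} (hP : ∀ᶠ w in 𝓝 w₀, P w) : ∃ w ∈ cone X, P w := by
  have h1 : ∀ᶠ e in 𝓝 (Projectivization.mk ℝ w₀ h0), ∃ w, ∃ h : w ≠ 0,
      e = Projectivization.mk ℝ w h ∧ P w := by
    rw [eventually_nhds_mk]
    filter_upwards [hP] with w hw hw0
    exact ⟨w, hw0, rfl, hw⟩
  obtain ⟨e, he, w, hw0, rfl, hw⟩ :=
    ((mem_closure_iff_frequently.1 hcl).and_eventually h1).exists
  exact ⟨w, (mem_cone_iff hw0).2 he, hw⟩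

/-! ### Fixed points and analytic continuation of triviality -/

section

variable {n : ℕ} {V C : Set (RP n)} {σ : RP n → RP n}

theorem isClosed_fixed (hσ : ContinuousOn σ C) (hC : IsClosed C) :
    IsClosed {x | x ∈ C ∧ σ x = x} := by
  have h1 : ContinuousOn (fun x => (σ x, x)) C := hσ.prodMk continuousOn_id
  exact h1.preimage_isClosed_of_isClosed hC isClosed_diagonal

/-- Along an arc, being fixed is a system of analytic equations, so it continues from the left half
to the right half. -/
theorem germClosed_fixed (hσ : IsRegularMapOn V σ) (hV : IsCompact V) (hCV : C ⊆ V)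
    (hC : GermClosed C) : GermClosed {x | x ∈ C ∧ σ x = x} := by
  intro g hg h0 hleft
  obtain ⟨TA, TB, hT⟩ := hσ.exists_global hV
  have h1 := hC g hg h0 (hleft.mono fun t ht => ⟨ht.1, ht.2.1⟩)
  have h2 : ∀ a : Fin (n + 1) × Fin (n + 1), ∀ᶠ t in 𝓝 (0 : ℝ),
      g t a.1 * g t a.2 * eval (g t) TB - nsq (g t) * eval (g t) (TA a) = 0 := by
    intro a
    refine eventually_zero_of_left ?_ ?_
    · exact (((analyticAt_pi_iff.1 hg a.1).mul (analyticAt_pi_iff.1 hg a.2)).mul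
        (analyticAt_eval hg _)).sub ((analyticAt_nsq hg).mul (analyticAt_eval hg _))
    · filter_upwards [hleft] with t ht
      obtain ⟨h3, h4⟩ := hT (g t) ⟨ht.1, hCV ht.2.1⟩
      refine mul_eq_mul_emb (A := fun a => eval (g t) (TA a)) ht.1 h3.ne' (fun a => ?_) a
      rw [← h4 a ht.1, ht.2.2]
  filter_upwards [h1, (eventually_all.2 h2).filter_mono nhdsWithin_le_nhds] with t ht ht'
  obtain ⟨h3, h4⟩ := hT (g t) (cone_mono hCV ht)
  exact ⟨ht.1, ht.2, eq_of_mul_eq_mul_emb ht.1 h3.ne' (fun a => h4 a ht.1) ht'⟩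

/-- A regular involution that is trivial near a point of a compact nonsingular irreducible
arc-symmetric set is trivial on it. -/
theorem IsNonsingularIrreducible.forall_fixed (hC : IsNonsingularIrreducible C)
    (hCc : IsCompact C) (hσ : IsRegularMapOn V σ) (hV : IsCompact V) (hCV : C ⊆ V) {x₀ : RP n}
    (hx₀ : x₀ ∈ C) (hopen : ∀ᶠ y in 𝓝 x₀, y ∈ zariskiClosure C → y ∈ C)
    (hfix : ∀ᶠ y in 𝓝 x₀, y ∈ zariskiClosure C → σ y = y) : ∀ x ∈ C, σ x = x := by
  intro x hx
  have := hC.eventually_mem_of_interior hCc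
    (isClosed_fixed (hσ.continuousOn.mono hCV) hCc.isClosed)
    (germClosed_fixed hσ hV hCV hC.1.arcSymmetric.germClosed) hx₀
    (by filter_upwards [hopen, hfix] with y h1 h2 hy using ⟨h1 hy, h2 hy⟩) hx
  exact (this.self_of_nhds (subset_zariskiClosure C hx)).2

/-- The continuation principle is applied with `D = C`: such a set is open in its Zariski closure.
-/
theorem IsNonsingularIrreducible.eventually_mem (hC : IsNonsingularIrreducible C)
    (hCc : IsCompact C) {x : RP n} (hx : x ∈ C) :
    ∀ᶠ y in 𝓝 x, y ∈ zariskiClosure C → y ∈ C := by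
  obtain ⟨x₀, hx₀, h⟩ := hC.1.exists_interior
  exact hC.eventually_mem_of_interior hCc hCc.isClosed hC.1.arcSymmetric.germClosed hx₀ h hx

end

/-! ### Quotients that are not arc-symmetric -/

/-- A quotient along which an arc is folded is not arc-symmetric. -/
theorem IsQuotientMap.not_germClosed_of_arc {n m : ℕ} {V X : Set (RP n)} {σ : RP n → RP n}
    {p : RP n → RP m} (hp : IsQuotientMap V σ p) (hV : IsCompact V) (hσ : IsRegularMapOn V σ)
    (hinv : ∀ x ∈ V, σ (σ x) = x) (hmaps : Set.MapsTo σ V V) (hXV : X ⊆ V)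
    {γ : ℝ → Fin (n + 1) → ℝ} (hγ : AnalyticAt ℝ γ 0)
    (hγX : ∀ᶠ t in 𝓝[≠] (0 : ℝ), γ t ∈ cone X)
    (hγσ : ∀ᶠ t in 𝓝 (0 : ℝ), γ t ∈ cone V ∧ ∀ h h',
      σ (Projectivization.mk ℝ (γ t) h) = Projectivization.mk ℝ (γ (-t)) h')
    {z : ℝ} (hz : z ≠ 0) {a : Fin (n + 1) × Fin (n + 1)}
    (hodd : ∀ᶠ t in 𝓝 (0 : ℝ), ∀ h, oddPart σ (Projectivization.mk ℝ (γ t) h) a = t * z) :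
    ¬ GermClosed (p '' X) := by
  intro hgerm
  obtain ⟨PA, PB, hP⟩ := hp.regular.exists_global hV
  obtain ⟨A, B, hAB⟩ := hp.exists_invariants hV hσ hinv
  have hneg : Tendsto (fun t : ℝ => -t) (𝓝 0) (𝓝 0) := by
    simpa using (continuous_neg (G := ℝ)).tendsto 0
  have h0V : γ 0 ∈ cone V := hγσ.self_of_nhds.1
  -- Since `σ` exchanges `γ t` and `γ (-t)`, the matrix entries of `p (γ t)` are even in `t` and
  -- hence analytic in `t ^ 2`.
  have hh : ∀ b : Fin (m + 1) × Fin (m + 1), ∃ h : ℝ → ℝ, AnalyticAt ℝ h 0 ∧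
      ∀ᶠ t in 𝓝 (0 : ℝ), eval (γ t) (PA b) / eval (γ t) PB = h (t ^ 2) := by
    intro b
    refine exists_analyticAt_sq ((analyticAt_eval hγ _).div (analyticAt_eval hγ _)
      (hP _ h0V).1.ne') ?_
    filter_upwards [hγσ, hneg.eventually hγσ] with t h1 h2
    have e1 := ne_zero_of_mem_cone h1.1
    have e2 := ne_zero_of_mem_cone h2.1
    have hm := mk_mem_of_mem_cone h1.1 e1
    rw [← (hP _ h1.1).2 b e1, ← (hP _ h2.1).2 b e2, ← h1.2 e1 e2,
      (hp.fibres _ hm _ (hmaps hm)).2 (Or.inr rfl)]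
  choose h hh1 hh2 using hh
  have hev : ∀ᶠ t in 𝓝 (0 : ℝ), γ t ∈ cone V ∧ ∀ b, ∀ h0,
      h b (t ^ 2) = emb (p (Projectivization.mk ℝ (γ t) h0)) b.1 b.2 := by
    filter_upwards [hγσ, eventually_all.2 hh2] with t h1 h2
    refine ⟨h1.1, fun b h0 => ?_⟩
    rw [← h2 b, (hP _ h1.1).2 b h0]
  obtain ⟨i, hi⟩ := exists_emb_pos (p (Projectivization.mk ℝ (γ 0) h0V.1))
  -- The sign is reversed so that the half `s < 0` is traced by `p (γ √(-s))`. The half `s > 0` is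
  -- the analytic continuation beyond the fold.
  let g : ℝ → Fin (m + 1) → ℝ := fun s j => h (i, j) (-s)
  have hg : AnalyticAt ℝ g 0 := by
    refine analyticAt_pi_iff.2 fun j => ?_
    have h1 : AnalyticAt ℝ (h (i, j)) (-(0 : ℝ)) := by
      rw [neg_zero]
      exact hh1 _
    exact h1.fun_comp_of_eq analyticAt_id.neg rfl
  have hgt : ∀ᶠ t in 𝓝 (0 : ℝ), γ t ∈ cone V ∧
      ∀ h0, g (-t ^ 2) = emb (p (Projectivization.mk ℝ (γ t) h0)) i := by
    filter_upwards [hev] with t ht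
    refine ⟨ht.1, fun h0 => ?_⟩
    ext j
    simp only [g, neg_neg]
    exact ht.2 (i, j) h0
  have hg0 : g 0 ≠ 0 := by
    have := hgt.self_of_nhds.2 h0V.1
    rw [show -(0 : ℝ) ^ 2 = 0 by norm_num] at this
    rw [this]
    exact emb_row_ne_zero hi.ne'
  have hsqrt : Tendsto (fun s : ℝ => √(-s)) (𝓝[<] 0) (𝓝[≠] 0) := by
    refine tendsto_nhdsWithin_iff.2 ⟨?_, ?_⟩
    · have : ContinuousAt (fun s : ℝ => √(-s)) 0 := by fun_prop
      simpa using this.tendsto.mono_left (nhdsWithin_le_nhds (s := Set.Iio (0 : ℝ)))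
    · filter_upwards [self_mem_nhdsWithin] with s hs
      have : 0 < -s := by simpa using hs
      exact (Real.sqrt_pos.2 this).ne'
  have hleft : ∀ᶠ s in 𝓝[<] (0 : ℝ), g s ∈ cone (p '' X) ∧
      eval (g s) (A (Sum.inr (a, a))) + s * z ^ 2 * eval (g s) B = 0 := by
    have hgne := (hg.continuousAt.eventually_ne hg0).filter_mono
      (nhdsWithin_le_nhds (s := Set.Iio (0 : ℝ)))
    filter_upwards [hsqrt.eventually hγX, hsqrt.eventually (hgt.filter_mono nhdsWithin_le_nhds),
      hsqrt.eventually (hodd.filter_mono nhdsWithin_le_nhds), hgne, self_mem_nhdsWithin]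
      with s h1 h2 h3 h4 hs
    have hs : 0 ≤ -s := by
      have : s < 0 := hs
      linarith
    have e1 := ne_zero_of_mem_cone h1
    have h5 := h2.2 e1
    rw [Real.sq_sqrt hs, neg_neg] at h5
    have hps : p (Projectivization.mk ℝ _ e1) = Projectivization.mk ℝ (g s) h4 := by
      have h6 : emb (p (Projectivization.mk ℝ _ e1)) i ≠ 0 := h5 ▸ h4
      simp only [h5]
      exact (mk_emb_row h6).symm
    refine ⟨(mem_cone_iff h4).2 ⟨_, mk_mem_of_mem_cone h1 e1, hps⟩, ?_⟩
    rw [(hAB _ (mk_mem_of_mem_cone h2.1 e1) _ h4 hps).2]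
    simp only [invariantVec, Sum.elim_inr, h3 e1]
    have := Real.sq_sqrt hs
    linear_combination (z ^ 2 * eval (g s) B) * this
  -- For `s < 0` the square of the odd function `a` is `-s * z ^ 2`, and the resulting equation
  -- persists for `s > 0`. There a point of the image would have a negative square.
  have hzero : ∀ᶠ s in 𝓝 (0 : ℝ),
      eval (g s) (A (Sum.inr (a, a))) + s * z ^ 2 * eval (g s) B = 0 := eventually_zero_of_left ((analyticAt_eval hg _).add
    ((analyticAt_id.mul analyticAt_const).mul (analyticAt_eval hg _)))
    (hleft.mono fun s hs => hs.2)
  have hright := hgerm g hg hg0 (hleft.mono fun s hs => hs.1)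
  obtain ⟨s, ⟨h1, h2⟩, hs⟩ := ((hright.and (hzero.filter_mono nhdsWithin_le_nhds)).and
    (self_mem_nhdsWithin : Set.Ioi (0 : ℝ) ∈ 𝓝[>] 0)).exists
  have hs : 0 < s := hs
  have e1 := ne_zero_of_mem_cone h1
  obtain ⟨x, hx, hpx⟩ := mk_mem_of_mem_cone h1 e1
  obtain ⟨hB, hA⟩ := hAB x (hXV hx) _ e1 hpx
  rw [hA] at h2
  simp only [invariantVec, Sum.elim_inr] at h2
  have h3 := mul_nonneg (mul_self_nonneg (oddPart σ x a)) hB.le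
  have h4 : 0 < s * z ^ 2 * eval (g s) B := by positivity
  linarith

/-- Weighted arcs through a chart that avoid the complement of a dense semi-algebraic set. -/
theorem exists_arc {n : ℕ} {X : Set (RP n)} (hX : IsSemialgebraic (cone X)) {κ : Type*}
    [Fintype κ] {Θ : (κ → ℝ) → Fin (n + 1) → ℝ} {y₀ : κ → ℝ} (hΘ : AnalyticAt ℝ Θ y₀)
    (hdense : ∀ᶠ y in 𝓝 y₀, ∃ᶠ y' in 𝓝 y, Θ y' ∈ cone X) (k₀ : κ) (e : κ → ℕ) :
    ∃ z : κ → ℝ, z k₀ ≠ 0 ∧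
      ∀ᶠ t in 𝓝[≠] (0 : ℝ), Θ (fun k => y₀ k + t ^ e k * z k) ∈ cone X := by
  classical
  obtain ⟨δ, hδ, hball⟩ := Metric.eventually_nhds_iff_ball.1 (hΘ.eventually_analyticAt.and hdense)
  obtain ⟨Φ, hΦ⟩ := hX.exists_signs
  -- Only polynomials not vanishing identically through the chart are kept. Where they are all
  -- nonzero, signs are locally constant, and density provides a nearby parameter in `X` with the
  -- same signs.
  let Φ' := Φ.filter fun φ => ∃ y ∈ Metric.ball y₀ δ, eval (Θ y) φ ≠ 0
  have hmem : ∀ y ∈ Metric.ball y₀ δ, (∀ φ ∈ Φ', eval (Θ y) φ ≠ 0) → Θ y ∈ cone X := by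
    intro y hy hne
    have hb : ∀ᶠ z in 𝓝 y, z ∈ Metric.ball y₀ δ := Metric.isOpen_ball.mem_nhds hy
    have hs : ∀ᶠ z in 𝓝 y, ∀ φ ∈ Φ', SignType.sign (eval (Θ z) φ) =
        SignType.sign (eval (Θ y) φ) := by
      rw [Finset.eventually_all]
      intro φ hφ
      have hc := (analyticAt_eval (hball y hy).1 φ).continuousAt
      rcases lt_or_gt_of_ne (hne φ hφ) with hlt | hgt
      · filter_upwards [hc.eventually (eventually_lt_nhds hlt)] with z hz
        rw [sign_neg hz, sign_neg hlt]
      · filter_upwards [hc.eventually (eventually_gt_nhds hgt)] with z hz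
        rw [sign_pos hz, sign_pos hgt]
    obtain ⟨z, hz, hzb, hzs⟩ := ((hball y hy).2.and_eventually (hb.and hs)).exists
    refine (hΦ (Θ z) (Θ y) fun φ hφ => ?_).1 hz
    by_cases hφ' : φ ∈ Φ'
    · exact hzs φ hφ'
    · have h0 : ∀ y ∈ Metric.ball y₀ δ, eval (Θ y) φ = 0 := by
        intro y hy
        by_contra hne
        exact hφ' (Finset.mem_filter.2 ⟨hφ, y, hy, hne⟩)
      rw [h0 z hzb, h0 y hy]
  -- The value `none` stands for the additional requirement that the coordinate `k₀` differs from
  -- that of `y₀`.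
  let F : Option (MvPolynomial (Fin (n + 1)) ℝ) → (κ → ℝ) → ℝ := fun o y =>
    o.elim (y k₀ - y₀ k₀) fun φ => eval (Θ y) φ
  obtain ⟨y₁, hy₁, hne⟩ := exists_forall_ne_zero hδ (Finset.insertNone Φ') (F := F)
    (by
      intro o ho y hy
      cases o with
      | none =>
        exact (analyticAt_pi_iff.1 analyticAt_id k₀).sub analyticAt_const
      | some φ => exact analyticAt_eval (hball y hy).1 φ)
    (by
      intro o ho
      cases o with
      | none =>
        refine ⟨fun k => y₀ k + δ / 2, ?_, ?_⟩
        · rw [Metric.mem_ball, dist_pi_lt_iff hδ]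
          intro k
          rw [Real.dist_eq, add_sub_cancel_left, abs_of_pos (by positivity)]
          linarith
        · simp only [F, Option.elim_none, add_sub_cancel_left]
          positivity
      | some φ =>
        exact (Finset.mem_filter.1 (Finset.some_mem_insertNone.1 ho)).2)
  have hk₀ : y₁ k₀ - y₀ k₀ ≠ 0 := hne none (Finset.none_mem_insertNone)
  refine ⟨y₁ - y₀, hk₀, ?_⟩
  let y : ℝ → κ → ℝ := fun t k => y₀ k + t ^ e k * (y₁ - y₀) k
  have hyb : ∀ t ∈ Set.Icc (-1 : ℝ) 1, y t ∈ Metric.ball y₀ δ := by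
    intro t ht
    have ht' : |t| ≤ 1 := abs_le.2 ht
    rw [Metric.mem_ball, dist_pi_lt_iff hδ] at hy₁ ⊢
    intro k
    refine lt_of_le_of_lt ?_ (hy₁ k)
    simp only [y, Real.dist_eq, add_sub_cancel_left, Pi.sub_apply, abs_mul, abs_pow]
    exact mul_le_of_le_one_left (abs_nonneg _) (pow_le_one₀ (abs_nonneg _) ht')
  have hya : ∀ t, AnalyticAt ℝ y t := by
    intro t
    refine analyticAt_pi_iff.2 fun k => ?_
    exact analyticAt_const.add ((analyticAt_id.pow _).mul analyticAt_const)
  have hy1 : y 1 = y₁ := by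
    ext k
    simp [y]
  -- At `t = 1` the arc passes through the generic point `y₁`, so no `φ` vanishes identically along
  -- it. Its zeros therefore cannot accumulate at `0`.
  have hφ : ∀ φ ∈ Φ', ∀ᶠ t in 𝓝[≠] (0 : ℝ), eval (Θ (y t)) φ ≠ 0 := by
    intro φ hφ
    have han : AnalyticOnNhd ℝ (fun t => eval (Θ (y t)) φ) (Set.Icc (-1) 1) := fun t ht =>
      analyticAt_eval ((hball _ (hyb t ht)).1.fun_comp_of_eq (hya t) rfl) φ
    by_contra hcon
    have hf : ∃ᶠ t in 𝓝[≠] (0 : ℝ), eval (Θ (y t)) φ = 0 := hcon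
    have := han.eqOn_zero_of_preconnected_of_frequently_eq_zero isPreconnected_Icc
      (show (0 : ℝ) ∈ Set.Icc (-1) 1 by norm_num) hf (show (1 : ℝ) ∈ Set.Icc (-1) 1 by norm_num)
    simp only [hy1, Pi.zero_apply] at this
    exact hne (some φ) (Finset.some_mem_insertNone.2 hφ) this
  have hb : ∀ᶠ t in 𝓝[≠] (0 : ℝ), t ∈ Set.Icc (-1 : ℝ) 1 :=
    mem_nhdsWithin_of_mem_nhds (Icc_mem_nhds (by norm_num) (by norm_num))
  filter_upwards [hb, (Finset.eventually_all Φ').2 hφ] with t ht h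
  exact hmem _ (hyb t ht) h

/-! ### Equivariant charts -/

section

variable {n : ℕ}

/-- A point and a squared norm determine a vector up to sign. A row of the matrix, rescaled to this
norm, is a continuous choice that passes through `x₀.rep`. -/
theorem eventually_exists_mk_eq (x₀ : RP n) {P : (Fin (n + 1) → ℝ) → Prop}
    (hP : ∀ᶠ v in 𝓝 x₀.rep, P v) : ∀ᶠ q in 𝓝 (x₀, nsq x₀.rep), ∃ v, ∃ h : v ≠ 0,
      P v ∧ nsq v = q.2 ∧ q.1 = Projectivization.mk ℝ v h := by
  obtain ⟨i, hi⟩ := exists_emb_pos x₀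
  have hN := nsq_pos x₀.rep_nonzero
  have hi0 : x₀.rep i ≠ 0 := by
    intro h
    simp [emb, h] at hi
  let w : RP n → Fin (n + 1) → ℝ := fun y => x₀.rep i • emb y i
  have hw : Continuous w := by
    exact ((continuous_apply i).comp continuous_emb).const_smul (x₀.rep i)
  have hw₀ : w x₀ = (x₀.rep i ^ 2 / nsq x₀.rep) • x₀.rep := by
    simp only [w, emb_row, smul_smul]
    congr 1
    ring
  have hc : 0 < x₀.rep i ^ 2 / nsq x₀.rep := by positivity
  have hw₀' : w x₀ ≠ 0 := by
    rw [hw₀]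
    exact smul_ne_zero hc.ne' x₀.rep_nonzero
  let f : RP n × ℝ → Fin (n + 1) → ℝ := fun q => √(q.2 / nsq (w q.1)) • w q.1
  have hf₀ : f (x₀, nsq x₀.rep) = x₀.rep := by
    simp only [f, hw₀, nsq_smul, smul_smul]
    have h1 : nsq x₀.rep / ((x₀.rep i ^ 2 / nsq x₀.rep) ^ 2 * nsq x₀.rep) =
        ((x₀.rep i ^ 2 / nsq x₀.rep)⁻¹) ^ 2 := by
      field_simp
    rw [h1, Real.sqrt_sq (by positivity), inv_mul_cancel₀ hc.ne', one_smul]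
  have hf : ContinuousAt f (x₀, nsq x₀.rep) := by
    have h1 : ContinuousAt (fun q : RP n × ℝ => w q.1) (x₀, nsq x₀.rep) :=
      (hw.comp continuous_fst).continuousAt
    have h2 : ContinuousAt (fun q : RP n × ℝ => nsq (w q.1)) (x₀, nsq x₀.rep) :=
      (continuous_nsq.comp (hw.comp continuous_fst)).continuousAt
    exact ((continuousAt_snd.div h2 (nsq_pos hw₀').ne').sqrt).smul h1
  rw [ContinuousAt, hf₀] at hf
  have h1 : ∀ᶠ q in 𝓝 (x₀, nsq x₀.rep), w q.1 ≠ 0 :=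
    (hw.comp continuous_fst).continuousAt.eventually_ne hw₀'
  have h2 : ∀ᶠ q in 𝓝 (x₀, nsq x₀.rep), 0 < q.2 :=
    continuousAt_snd.eventually (eventually_gt_nhds hN)
  filter_upwards [hf.eventually hP, h1, h2] with q h3 h4 h5
  have h6 := nsq_pos h4
  have h7 : √(q.2 / nsq (w q.1)) ≠ 0 := (Real.sqrt_pos.2 (by positivity)).ne'
  have h8 : emb q.1 i ≠ 0 := fun h => h4 (by simp only [w, h, smul_zero])
  refine ⟨f q, smul_ne_zero h7 h4, h3, ?_, ?_⟩
  · rw [nsq_smul, Real.sq_sqrt (by positivity)]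
    field_simp
  · rw [mk_smul _ h4 h7]
    exact ((mk_smul _ h8 hi0).trans (mk_emb_row h8)).symm

variable {V W : Set (RP n)} {σ : RP n → RP n}

/-- A regular map that fixes a point lifts to the cones, preserving norms. -/
theorem eventually_exists_lift (hσ : ContinuousOn σ V) (hWV : W ⊆ V) {x₀ : RP n} (hx₀ : x₀ ∈ W)
    (hfix : σ x₀ = x₀) (hσW : ∀ᶠ y in 𝓝 x₀, y ∈ W → σ y ∈ W) {P : (Fin (n + 1) → ℝ) → Prop}
    (hP : ∀ᶠ v in 𝓝 x₀.rep, P v) : ∀ᶠ v in 𝓝 x₀.rep, v ∈ cone W → ∃ v' ∈ cone W, P v' ∧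
      nsq v' = nsq v ∧ ∀ h h', σ (Projectivization.mk ℝ v h) = Projectivization.mk ℝ v' h' := by
  have h1 := eventually_exists_mk_eq x₀ hP
  rw [nhds_prod_eq, eventually_prod_iff] at h1
  obtain ⟨pa, hpa, pb, hpb, h1⟩ := h1
  have h2 : ∀ᶠ y in 𝓝 x₀, y ∈ V → pa (σ y) := by
    have := hσ x₀ (hWV hx₀)
    rw [ContinuousWithinAt, hfix] at this
    exact eventually_nhdsWithin_iff.1 (this.eventually hpa)
  have h3 : ∀ᶠ v in 𝓝 x₀.rep, ∀ h : v ≠ 0, Projectivization.mk ℝ v h ∈ W →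
      pa (σ (Projectivization.mk ℝ v h)) ∧ σ (Projectivization.mk ℝ v h) ∈ W := by
    have h4 := h2.and hσW
    rw [← Projectivization.mk_rep x₀, eventually_nhds_mk] at h4
    filter_upwards [h4] with v hv h hvW
    exact ⟨(hv h).1 (hWV hvW), (hv h).2 hvW⟩
  filter_upwards [h3, continuous_nsq.continuousAt.eventually hpb] with v h4 h5 hv
  have h6 := h4 hv.1 hv.2
  obtain ⟨v', hv', h7, h8, h9⟩ := h1 h6.1 h5
  refine ⟨v', (mem_cone_iff hv').2 ?_, h7, h8, fun _ _ => h9⟩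
  rw [← h9]
  exact h6.2

/-- The squared norm and the even and odd functions of an involution, on the cone. -/
noncomputable def involutionFun (TA : Fin (n + 1) × Fin (n + 1) → MvPolynomial (Fin (n + 1)) ℝ)
    (TB : MvPolynomial (Fin (n + 1)) ℝ) :
    Unit ⊕ ((Fin (n + 1) × Fin (n + 1)) ⊕ (Fin (n + 1) × Fin (n + 1))) →
      (Fin (n + 1) → ℝ) → ℝ
  | Sum.inl _ => fun v => nsq v
  | Sum.inr (Sum.inl a) => fun v => v a.1 * v a.2 / nsq v + eval v (TA a) / eval v TB
  | Sum.inr (Sum.inr a) => fun v => v a.1 * v a.2 / nsq v - eval v (TA a) / eval v TB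

variable {TA : Fin (n + 1) × Fin (n + 1) → MvPolynomial (Fin (n + 1)) ℝ}
  {TB : MvPolynomial (Fin (n + 1)) ℝ}

theorem analyticAt_involutionFun {v : Fin (n + 1) → ℝ} (hv : v ≠ 0) (hB : eval v TB ≠ 0) (i) :
    AnalyticAt ℝ (involutionFun TA TB i) v := by
  have h0 : AnalyticAt ℝ (fun v : Fin (n + 1) → ℝ => v) v := analyticAt_id
  have hN : AnalyticAt ℝ (fun v : Fin (n + 1) → ℝ => nsq v) v := by
    simpa using analyticAt_eval h0 (nsqPoly (n + 1))
  have h1 : ∀ a : Fin (n + 1) × Fin (n + 1),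
      AnalyticAt ℝ (fun v : Fin (n + 1) → ℝ => v a.1 * v a.2 / nsq v) v := fun a =>
    ((analyticAt_pi_iff.1 h0 a.1).mul (analyticAt_pi_iff.1 h0 a.2)).div hN (nsq_pos hv).ne'
  have h2 : ∀ a, AnalyticAt ℝ (fun v => eval v (TA a) / eval v TB) v := fun a =>
    (analyticAt_eval h0 _).div (analyticAt_eval h0 _) hB
  rcases i with _ | a | a
  · exact hN
  · exact (h1 a).add (h2 a)
  · exact (h1 a).sub (h2 a)

/-- The even and odd functions recover the entries `v i * v j / nsq v`, and the norm recovers `v i *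
v j`. A vector killed by all differentials then satisfies `v i * w j + v j * w i = 0`. The norm is
needed because the other functions are constant on lines through the origin. -/
theorem eq_zero_of_fderiv_involutionFun {v : Fin (n + 1) → ℝ} (hv : v ≠ 0) (hB : eval v TB ≠ 0)
    {w : Fin (n + 1) → ℝ} (hw : ∀ i, fderiv ℝ (involutionFun TA TB i) v w = 0) : w = 0 := by
  have hd : ∀ i, HasFDerivAt (involutionFun TA TB i) (fderiv ℝ (involutionFun TA TB i) v) v :=
    fun i => (analyticAt_involutionFun hv hB i).differentiableAt.hasFDerivAt
  have key : ∀ i j, v i * w j + v j * w i = 0 := by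
    intro i j
    have h1 : HasFDerivAt (fun u : Fin (n + 1) → ℝ => u i * u j) _ v :=
      (hasFDerivAt_apply (𝕜 := ℝ) i v).mul (hasFDerivAt_apply j v)
    have h2 := ((hd (Sum.inr (Sum.inl (i, j)))).add (hd (Sum.inr (Sum.inr (i, j))))).mul
      (hd (Sum.inl ()))
    have h3 := h2.const_mul (1 / 2)
    have h4 : (fun u : Fin (n + 1) → ℝ => u i * u j) =ᶠ[𝓝 v] fun u => 1 / 2 *
        ((involutionFun TA TB (Sum.inr (Sum.inl (i, j))) u +
          involutionFun TA TB (Sum.inr (Sum.inr (i, j))) u) *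
            involutionFun TA TB (Sum.inl ()) u) := by
      filter_upwards [isOpen_ne.mem_nhds hv] with u hu
      have := (nsq_pos (show u ≠ 0 from hu)).ne'
      simp only [involutionFun]
      field_simp
      ring
    have h5 := congrArg (fun L => L w) (h1.unique (h3.congr_of_eventuallyEq h4))
    simpa [hw] using h5
  obtain ⟨i, hi⟩ := Function.ne_iff.1 hv
  have hi : v i ≠ 0 := hi
  have h0 : w i = 0 := by
    have := key i i
    have : v i * w i = 0 := by linarith
    exact (mul_eq_zero.1 this).resolve_left hi
  ext j
  have := key i j
  rw [h0, mul_zero, add_zero] at this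
  exact (mul_eq_zero.1 this).resolve_left hi

theorem involutionFun_even (hT : ∀ v ∈ cone V, 0 < eval v TB ∧ ∀ a, ∀ h : v ≠ 0,
      emb (σ (Projectivization.mk ℝ v h)) a.1 a.2 = eval v (TA a) / eval v TB)
    {v : Fin (n + 1) → ℝ} (hv : v ∈ cone V) (h : v ≠ 0) (a : Fin (n + 1) × Fin (n + 1)) :
    involutionFun TA TB (Sum.inr (Sum.inl a)) v = evenPart σ (Projectivization.mk ℝ v h) a := by
  rw [evenPart, (hT v hv).2 a h, emb_mk]
  rfl

theorem involutionFun_odd (hT : ∀ v ∈ cone V, 0 < eval v TB ∧ ∀ a, ∀ h : v ≠ 0,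
      emb (σ (Projectivization.mk ℝ v h)) a.1 a.2 = eval v (TA a) / eval v TB)
    {v : Fin (n + 1) → ℝ} (hv : v ∈ cone V) (h : v ≠ 0) (a : Fin (n + 1) × Fin (n + 1)) :
    involutionFun TA TB (Sum.inr (Sum.inr a)) v = oddPart σ (Projectivization.mk ℝ v h) a := by
  rw [oddPart, (hT v hv).2 a h, emb_mk]
  rfl

/-- Around a fixed point an involution has a chart in which it changes the signs of some
coordinates, and these coordinates are odd functions. -/
theorem exists_equivariant_chart {C : Set (RP n)}
    (hC : Disjoint C (singularLocus (zariskiClosure C))) (hV : IsCompact V)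
    (hσ : IsRegularMapOn V σ) (hinv : ∀ x ∈ V, σ (σ x) = x) (hCV : zariskiClosure C ⊆ V)
    {x₀ : RP n} (hx₀ : x₀ ∈ C) (hfix : σ x₀ = x₀)
    (hσC : ∀ᶠ y in 𝓝 x₀, y ∈ zariskiClosure C → σ y ∈ zariskiClosure C) :
    ∃ (κ : Type) (_ : Fintype κ) (s : κ → ℝ) (Θ : (κ → ℝ) → Fin (n + 1) → ℝ) (y₀ : κ → ℝ),
      AnalyticAt ℝ Θ y₀ ∧ Θ y₀ = x₀.rep ∧
      (∀ k, s k = 1 ∨ s k = -1 ∧ y₀ k = 0 ∧ ∃ a, ∀ᶠ y in 𝓝 y₀, ∀ h,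
        oddPart σ (Projectivization.mk ℝ (Θ y) h) a = y k) ∧
      (∀ᶠ y in 𝓝 y₀, Θ y ∈ cone (zariskiClosure C) ∧ ∀ h h',
        σ (Projectivization.mk ℝ (Θ y) h) = Projectivization.mk ℝ (Θ (s * y)) h') ∧
      ∀ᶠ y in 𝓝 y₀, ∀ Q : (κ → ℝ) → Prop, (∀ᶠ y' in 𝓝 y, Q y') →
        ∀ᶠ v in 𝓝 (Θ y), v ∈ cone (zariskiClosure C) → ∃ y', Q y' ∧ Θ y' = v := by
  obtain ⟨TA, TB, hT⟩ := hσ.exists_global hV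
  have hW₀ := subset_zariskiClosure C hx₀
  have hv₀ : x₀.rep ∈ cone V := rep_mem_cone.2 (hCV hW₀)
  have hB := (hT _ hv₀).1.ne'
  obtain ⟨κ, _, c, Θ, h1, h2, h3, h4⟩ := exists_nonsingular_chart hC hx₀
    (analyticAt_involutionFun (TA := TA) x₀.rep_nonzero hB)
    (fun w => eq_zero_of_fderiv_involutionFun x₀.rep_nonzero hB)
  let sg : Unit ⊕ ((Fin (n + 1) × Fin (n + 1)) ⊕ (Fin (n + 1) × Fin (n + 1))) → ℝ :=
    Sum.elim (fun _ => 1) (Sum.elim (fun _ => 1) fun _ => -1)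
  have hΘ : Tendsto Θ (𝓝 fun k => involutionFun TA TB (c k) x₀.rep) (𝓝 x₀.rep) := by
    have := h1.continuousAt.tendsto
    rwa [h2] at this
  refine ⟨κ, inferInstance, fun k => sg (c k), Θ, fun k => involutionFun TA TB (c k) x₀.rep, h1,
    h2, fun k => ?_, ?_, ?_⟩
  · rcases hck : c k with _ | a | a
    · exact Or.inl (by simp only [hck]; rfl)
    · exact Or.inl (by simp only [hck]; rfl)
    · refine Or.inr ⟨by simp only [hck]; rfl, ?_, a, ?_⟩
      · beta_reduce
        rw [hck, involutionFun_odd hT hv₀ x₀.rep_nonzero, Projectivization.mk_rep,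
          oddPart_eq_zero_iff.2 hfix, Pi.zero_apply]
      · filter_upwards [h3] with y hy h
        rw [← involutionFun_odd hT (cone_mono hCV hy.1) h, ← hck]
        exact congrFun hy.2 k
  · filter_upwards [h3, hΘ.eventually (eventually_exists_lift hσ.continuousOn hCV hW₀ hfix hσC h4)]
      with y h5 h6
    refine ⟨h5.1, fun h h' => ?_⟩
    obtain ⟨v', hv', h7, h8, h9⟩ := h6 h5.1
    have hv'0 := ne_zero_of_mem_cone hv'
    have h9 := h9 h hv'0
    have hmem : Projectivization.mk ℝ (Θ y) h ∈ V := hCV (mk_mem_of_mem_cone h5.1 h)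
    -- The lift `v'` of the image point has the same norm and even functions and opposite odd
    -- functions, so its chart coordinates are those of `Θ y` multiplied by the signs.
    have h10 : ∀ i, involutionFun TA TB i v' = sg i * involutionFun TA TB i (Θ y) := by
      rintro (_ | a | a)
      · simpa [sg, involutionFun] using h8
      · rw [involutionFun_even hT (cone_mono hCV hv') hv'0,
          involutionFun_even hT (cone_mono hCV h5.1) h, ← h9, evenPart_apply (hinv _ hmem)]
        simp [sg]
      · rw [involutionFun_odd hT (cone_mono hCV hv') hv'0,
          involutionFun_odd hT (cone_mono hCV h5.1) h, ← h9, oddPart_apply (hinv _ hmem)]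
        simp [sg]
    have h11 : Θ ((fun k => sg (c k)) * y) = v' := by
      rw [← h7 hv']
      congr 1
      ext k
      rw [h10, Pi.mul_apply, congrFun h5.2 k]
    rw [h9]
    simp only [h11]
  · have hcont : ∀ᶠ v in 𝓝 x₀.rep, ContinuousAt (fun v k => involutionFun TA TB (c k) v) v := by
      have := eventually_all.2 fun k =>
        (analyticAt_involutionFun (TA := TA) x₀.rep_nonzero hB (c k)).eventually_analyticAt
      filter_upwards [this] with v hv
      exact continuousAt_pi.2 fun k => (hv k).continuousAt
    filter_upwards [h3, hΘ.eventually hcont, hΘ.eventually h4.eventually_nhds] with y h5 h6 h7 Q hQ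
    rw [← h5.2] at hQ
    filter_upwards [h6.eventually hQ, h7] with v h8 h9 hv
    exact ⟨_, h8, h9 hv⟩

end

/-! ### The fold at a fixed point and the final equivalence -/

/-- If the quotient of `X` is arc-symmetric, then the involution is trivial on the components of
the compactification that contain a fixed point. -/
theorem IsQuotientMap.forall_fixed {n m : ℕ} {V X C : Set (RP n)} {σ : RP n → RP n}
    {p : RP n → RP m} (hp : IsQuotientMap V σ p) (hV : IsCompact V) (hσ : IsRegularMapOn V σ)
    (hinv : ∀ x ∈ V, σ (σ x) = x) (hmaps : Set.MapsTo σ V V) (hXV : X ⊆ V)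
    (hX : IsSemialgebraic (cone X)) (hpX : GermClosed (p '' X)) (hC : IsNonsingularIrreducible C)
    (hCc : IsCompact C) (hCV : zariskiClosure C ⊆ V) (hCX : C ⊆ closure X) {x₀ : RP n}
    (hx₀ : x₀ ∈ C) (hfix : σ x₀ = x₀) (hXC : ∀ᶠ y in 𝓝 x₀, y ∈ X → y ∈ C)
    (hσC : ∀ᶠ y in 𝓝 x₀, y ∈ C → σ y ∈ C) : ∀ x ∈ C, σ x = x := by
  have hopen := hC.eventually_mem hCc hx₀
  have hsub := subset_zariskiClosure C
  obtain ⟨κ, _, s, Θ, y₀, hΘ, hΘ₀, hs, hΘσ, hinvΘ⟩ := exists_equivariant_chart hC.2 hV hσ hinv hCV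
    hx₀ hfix (by filter_upwards [hopen, hσC] with y h1 h2 h3 using hsub (h2 (h1 h3)))
  have hΘt : Tendsto Θ (𝓝 y₀) (𝓝 x₀.rep) := by
    have := hΘ.continuousAt.tendsto
    rwa [hΘ₀] at this
  by_cases hodd : ∀ k, s k = 1
  -- Without odd coordinates `σ` is the identity in the chart, and its triviality near `x₀` spreads
  -- over `C`.
  · refine hC.forall_fixed hCc hσ hV (hsub.trans hCV) hx₀ hopen ?_
    have h1 : s = 1 := funext hodd
    have h2 := hinvΘ.self_of_nhds _ hΘσ
    rw [hΘ₀] at h2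
    rw [← Projectivization.mk_rep x₀, eventually_nhds_mk]
    filter_upwards [h2] with v hv h hvC
    obtain ⟨y, ⟨-, h3⟩, rfl⟩ := hv ((mem_cone_iff h).2 hvC)
    rw [h1, one_mul] at h3
    exact h3 h h
  · exfalso
    push Not at hodd
    obtain ⟨k₀, hk₀⟩ := hodd
    obtain ⟨-, hy₀k, a, ha⟩ := (hs k₀).resolve_left hk₀
    have hdense : ∀ᶠ y in 𝓝 y₀, ∃ᶠ y' in 𝓝 y, Θ y' ∈ cone X := by
      have h1 : ∀ᶠ v in 𝓝 x₀.rep, (v ∈ cone X → v ∈ cone (zariskiClosure C)) ∧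
          (v ∈ cone (zariskiClosure C) → v ∈ cone (closure X)) := by
        have h2 := hXC.and hopen
        rw [← Projectivization.mk_rep x₀, eventually_nhds_mk] at h2
        filter_upwards [h2] with v hv
        exact ⟨fun h => ⟨h.1, hsub ((hv h.1).1 h.2)⟩, fun h => ⟨h.1, hCX ((hv h.1).2 h.2)⟩⟩
      filter_upwards [hΘσ, hinvΘ, hΘt.eventually h1.eventually_nhds] with y h2 h3 h4
      rw [frequently_iff]
      intro U hU
      have h5 := h4.self_of_nhds.2 h2.1
      obtain ⟨v, hv, h6, h7⟩ := exists_mem_cone_of_mem_closure h5.1 h5.2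
        ((h3 (· ∈ U) hU).and h4)
      obtain ⟨y', hy', rfl⟩ := h6 (h7.1 hv)
      exact ⟨y', hy', hv⟩
    classical
    -- Even coordinates move with `t ^ 2` and odd ones with `t`. As the odd coordinates of `y₀` are
    -- zero, changing `t` to `-t` is the action of `σ` in the chart.
    let e : κ → ℕ := fun k => if s k = 1 then 2 else 1
    obtain ⟨z, hz, hzX⟩ := exists_arc hX hΘ hdense k₀ e
    let y : ℝ → κ → ℝ := fun t k => y₀ k + t ^ e k * z k
    have hya : AnalyticAt ℝ y 0 := by
      refine analyticAt_pi_iff.2 fun k => ?_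
      exact analyticAt_const.add ((analyticAt_id.pow _).mul analyticAt_const)
    have hy0 : y 0 = y₀ := by
      ext k
      have : e k ≠ 0 := by
        simp only [e]
        split_ifs <;> norm_num
      simp [y, this]
    have hyt : Tendsto y (𝓝 0) (𝓝 y₀) := by
      have := hya.continuousAt.tendsto
      rwa [hy0] at this
    have hys : ∀ t, s * y t = y (-t) := by
      intro t
      ext k
      rcases hs k with h | ⟨h, h', -⟩
      · simp [y, e, h]
      · have : ¬ (-1 : ℝ) = 1 := by norm_num
        simp [y, e, h, h', this]
    refine hp.not_germClosed_of_arc hV hσ hinv hmaps hXV (hΘ.fun_comp_of_eq hya hy0) hzX ?_ hz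
      (a := a) ?_ hpX
    · filter_upwards [hyt.eventually hΘσ] with t ht
      rw [hys] at ht
      exact ⟨cone_mono hCV ht.1, ht.2⟩
    · filter_upwards [hyt.eventually ha] with t ht h
      rw [ht h]
      simp [y, e, hk₀, hy₀k]

end ArcSym

open ArcSym in
theorem proposition4p3 {n : ℕ} (X X' : Set (RP n)) (σ : RP n → RP n)
    (hX : IsNonsingular X) (hσX : IsAlgebraicInvolution X σ)
    (hX' : IsNonsingular X') (hσX' : IsAlgebraicInvolution X' σ)
    (hcompact : IsCompact X') (hsub : X ⊆ X') (hdense : X' ⊆ closure X)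
    (hdiff : IsCompact (X' \ X)) :
    (∃ (m : ℕ) (p : RP n → RP m), IsQuotientMap (zariskiClosure X) σ p) ∧
    ∀ (m : ℕ) (p : RP n → RP m), IsQuotientMap (zariskiClosure X) σ p →
      (IsArcSymmetric (p '' X) ↔
        ∀ C : Set (RP n), IsIrreducibleComponent C X' → (∃ x ∈ C, σ x = x) →
          ∀ x ∈ C, σ x = x) := by
  have hVX : zariskiClosure X' = zariskiClosure X := zariskiClosure_eq_of_dense hsub hdense
  have hV : IsCompact (zariskiClosure X) := (isClosed_zariskiClosure X).isCompact
  have hX'V : X' ⊆ zariskiClosure X := hVX ▸ subset_zariskiClosure X'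
  refine ⟨exists_isQuotientMap hV hσX.regular hσX.mapsTo_closure hσX.involutive, fun m p hp => ?_⟩
  obtain ⟨-, S, hS, hdisj, hU, hSC⟩ := hX'
  have hnear := fun {C} (hC : C ∈ S) {x} (hx : x ∈ C) => eventually_mem_component hcompact hS hdisj
    hU (fun C hC => (hSC C hC).2) hC hx
  constructor
  · rintro harc C hC ⟨x₀, hx₀, hfix⟩
    rw [isIrreducibleComponent_iff_mem hS hdisj hU hSC] at hC
    obtain ⟨hCn, hCX'⟩ := hSC C hC
    refine hp.forall_fixed hV hσX.regular hσX.involutive hσX.mapsTo_closure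
      (subset_zariskiClosure X) hX.1.semialgebraic harc.germClosed hCn (hCX'.isCompact hcompact)
      (hVX ▸ zariskiClosure_mono hCX'.subset) (hCX'.subset.trans hdense) hx₀ hfix
      ((hnear hC hx₀).mono fun y hy h => hy (hsub h)) ?_
    have hcont := hσX.regular.continuousOn.mono hX'V x₀ (hCX'.subset hx₀)
    -- Continuity keeps `σ y` close to the fixed point, and near it the only component of `X'` is
    -- `C`. Hence `σ` preserves `C` locally.
    have h1 : ∀ᶠ y in 𝓝[X'] x₀, σ y ∈ X' → σ y ∈ C := by
      rw [ContinuousWithinAt, hfix] at hcont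
      exact hcont.eventually (hnear hC hx₀)
    filter_upwards [eventually_nhdsWithin_iff.1 h1] with y hy hyC
    exact hy (hCX'.subset hyC) (hσX'.mapsTo (hCX'.subset hyC))
  · intro hfix
    refine hp.isArcSymmetric_image hV hσX.regular hσX.involutive hσX.mapsTo_closure hX'V hcompact
      hsub hσX.mapsTo hX.1 fun x hx hσx => ?_
    obtain ⟨C, hC, hxC⟩ := (hU ▸ hx : x ∈ ⋃₀ S)
    have hCfix := hfix C ((isIrreducibleComponent_iff_mem hS hdisj hU hSC).2 hC) ⟨x, hxC, hσx⟩
    exact (hnear hC hxC).mono fun y hy h => hCfix y (hy h)
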